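/- \textbf{Setting.} Let $\lambda_1,\lambda_2\in\mathbb R^2$ be linearly independent, $\Lambda=\{l\lambda_1+j\lambda_2: l,j\in\mathbb Z\}$, $\Lambda_{00}=\{a_1\lambda_1+a_2\lambda_2: a_1,a_2\in(0,1)\}$, $d>0$, $D=\mathbb R^2\times(-d,0)$, $D_{00}=\Lambda_{00}\times(-d,0)$. Let $0<\gamma'<\gamma<1$, $\sigma>0$ and $g,\alpha,m_1,m_2\in\mathbb R$. The class $C^{k,\gamma}(\mathbb R^3;\mathbb R^3)$ consists of the $C^k$ maps all of whose partial derivatives of order $\le k$ are bounded and uniformly $\gamma$-Hölder continuous; $C^{k,\gamma}_{loc}$ is the class of maps satisfying this on every ball, with the topology given by the $C^{k,\gamma}$ norms on balls. The subscript $per$ means $\Lambda$-periodic in the horizontal variables. Let $M_{per}$ be the set of all $C^3$-diffeomorphisms $\mathbf F\in C^{3,\gamma}_{loc}(\mathbb R^3;\mathbb R^3)$ of $\mathbb R^3$ onto itself with bounded first partial derivatives, $\det D\mathbf F>0$, $\mathbf F(X,Y,-d)=(X,Y,-d)$ for all $X,Y$, and $\mathbf F(\mathbf x)-\mathbf x$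 $\Lambda$-periodic in the horizontal variables. For $\mathbf F\in M_{per}$ put $\Omega=\mathbf F(D)$, $\Omega_{00}=\mathbf F(D_{00})$, $\mathbf S(X,Y)=\mathbf F(X,Y,0)$; let $\partial\Omega^t=\mathbf S(\mathbb R^2)$ be the free surface (which may overhang), $\partial\Omega^t_{00}=\mathbf S(\Lambda_{00})$, $\partial\Omega^b=\{z=-d\}$ the bottom, $\mathbf n$ the outward unit normal, and $K_M$ the mean curvature of $\partial\Omega^t$, $2K_M=-\operatorname{div}\mathbf n$. A pair $(\mathbf A,\mathbf F)$ is \emph{admissible} if $\mathbf F\in M_{per}$, $\mathbf A\in C^{2,\gamma}_{per}(\mathbb R^3;\mathbb R^3)$, $\mathbf A\times\mathbf n=0$ on $\partial\Omega^t$ and $\mathbf A\times\mathbf n=(m_1,m_2,0)$ on $\partial\Omega^b$. An \emph{admissible curve} is a family $(\mathbf A(t),\mathbf F(t))$, $t\in(-\delta,\delta)$, $\delta>0$, of admissible pairs (with the same $m_1,m_2$) such that $t\mapsto\mathbf F(t)$ is continuously differentiable in the $C^{3,\gamma}_{loc}$ topology and $t\mapsto\mathbf A(t)$ is continuous in the $C^{2,\gamma'}$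 norm and differentiable in the $C^{1,\gamma'}$ norm. For $\mu\in\mathbb R$ let $\mathcal J=\mathcal E-\alpha\mathcal K-\mu\mathcal M$, where $$\mathcal E=\int_{\Omega_{00}}\bigl(|\operatorname{curl}\mathbf A|^2-2gz\bigr)\,dV-2\sigma\int_{\partial\Omega^t_{00}}dS,\qquad \mathcal K=\int_{\Omega_{00}}\mathbf A\cdot\operatorname{curl}\mathbf A\,dV,\qquad \mathcal M=\int_{\Omega_{00}}1\,dV .$$ An admissible pair $(\mathbf A,\mathbf F)$ (equivalently $(\mathbf A,\Omega)$ with $\Omega=\mathbf F(D)$) is a \emph{critical point} of $\mathcal J$ if for every admissible curve with $\mathbf A(0)=\mathbf A$, $\mathbf F(0)=\mathbf F$ the function $t\mapsto\mathcal J(\mathbf A(t),\mathbf F(t)(D))$ is differentiable at $t=0$ with derivative $0$. \textbf{Theorem.} Let $(\mathbf A,\mathbf F)$ be an admissible pair, $\Omega=\mathbf F(D)$ and $\mathbf u=\operatorname{curl}\mathbf A$. For a constant $c\in\mathbb R$ consider the conditions \begin{align*} &\operatorname{div}\mathbf u=0\ \text{ and }\ \operatorname{curl}\mathbf u=\alpha\mathbf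 u\ \text{ in }\Omega,\qquad \mathbf u\cdot\mathbf n=0\ \text{ on }\partial\Omega=\partial\Omega^t\cup\partial\Omega^b, &&(1)\\ &\tfrac12|\mathbf u|^2+gz-2\sigma K_M=c\ \text{ on }\partial\Omega^t. &&(2) \end{align*} (i) For every $\mu\in\mathbb R$: $(\mathbf A,\Omega)$ is a critical point of $\mathcal J$ if and only if (1) holds and (2) holds with $c=-\mu/2$. (ii) Consequently, $(\mathbf A,\Omega)$ is a critical point of $\mathcal J$ for some $\mu\in\mathbb R$ if and only if $\mathbf u$ is a steady Beltrami flow satisfying (1) and satisfying (2) for some constant $c$. -/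

import Mathlib

open Set Filter Topology MeasureTheory

namespace BeltramiWaves

/-- Horizontal space. -/
abbrev V2 : Type := EuclideanSpace ℝ (Fin 2)

/-- Physical space, with coordinates `x 0 = x`, `x 1 = y`, `x 2 = z`. -/
abbrev V3 : Type := EuclideanSpace ℝ (Fin 3)

noncomputable section

/-! ### Vector calculus -/

/-- The point of space with horizontal part `p` and height `z`. -/
def lift (p : V2) (z : ℝ) : V3 := !₂[p 0, p 1, z]

/-- The vector product on Euclidean three-space. -/
def cross (a b : V3) : V3 := WithLp.toLp 2 (crossProduct a.ofLp b.ofLp)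

/-- `i`-th partial derivative of a vector field on space. -/
def pd (i : Fin 3) (f : V3 → V3) (x : V3) : V3 := fderiv ℝ f x (EuclideanSpace.single i 1)

/-- Partial derivative of a space-valued map on the plane (`i = 0` for `X`, `i = 1` for `Y`). -/
def pdS (i : Fin 2) (f : V2 → V3) (p : V2) : V3 := fderiv ℝ f p (EuclideanSpace.single i 1)

/-- Curl of a vector field. -/
def curl (A : V3 → V3) (x : V3) : V3 :=
  !₂[pd 1 A x 2 - pd 2 A x 1, pd 2 A x 0 - pd 0 A x 2, pd 0 A x 1 - pd 1 A x 0]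

/-- Divergence of a vector field. -/
def div (A : V3 → V3) (x : V3) : ℝ := ∑ i, pd i A x i

/-! ### Hölder classes -/

/-- All derivatives of `f` of order at most `k` are bounded by `C` on `K` and are `γ`-Hölder
continuous on `K` with constant `C`; that is, the `C^{k,γ}` norm of `f` on `K`, taken as the largest
of these suprema, is at most `C`. -/
def HolderBoundOn (k : ℕ) (γ : ℝ) (K : Set V3) (f : V3 → V3) (C : ℝ) : Prop :=
  ∀ j ≤ k, (∀ x ∈ K, ‖iteratedFDeriv ℝ j f x‖ ≤ C) ∧
    ∀ x ∈ K, ∀ y ∈ K, ‖iteratedFDeriv ℝ j f x - iteratedFDeriv ℝ j f y‖ ≤ C * dist x y ^ γ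

/-- The space `C^{k,γ}(ℝ³; ℝ³)`. -/
def MemHolder (k : ℕ) (γ : ℝ) (f : V3 → V3) : Prop :=
  ContDiff ℝ k f ∧ ∃ C, HolderBoundOn k γ univ f C

/-- The space `C^{k,γ}_loc(ℝ³; ℝ³)`. -/
def MemHolderLoc (k : ℕ) (γ : ℝ) (f : V3 → V3) : Prop :=
  ContDiff ℝ k f ∧ ∀ R : ℝ, ∃ C, HolderBoundOn k γ (Metric.closedBall 0 R) f C

/-- The curve `s ↦ f s` is continuous at `t` for the `C^{k,γ}` norm on `K`. -/
def HolderContinuousAt (k : ℕ) (γ : ℝ) (K : Set V3) (f : ℝ → V3 → V3) (t : ℝ) : Prop :=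
  ∀ ε > 0, ∀ᶠ s in 𝓝 t, HolderBoundOn k γ K (fun x => f s x - f t x) ε

/-- The curve `s ↦ f s` has derivative `f'` at `t` for the `C^{k,γ}` norm on `K`. -/
def HolderHasDerivAt (k : ℕ) (γ : ℝ) (K : Set V3) (f : ℝ → V3 → V3) (f' : V3 → V3) (t : ℝ) :
    Prop :=
  ∀ ε > 0, ∀ᶠ s in 𝓝[≠] t,
    HolderBoundOn k γ K (fun x => (s - t)⁻¹ • (f s x - f t x) - f' x) ε

/-! ### Lattice, reference domain, domain parametrizations -/

/-- The two-dimensional lattice generated by `lam 0` and `lam 1`. -/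
def lattice (lam : Fin 2 → V2) : Set V2 := {v | ∃ l j : ℤ, v = l • lam 0 + j • lam 1}

/-- The open periodicity cell `Λ₀₀` of the lattice. -/
def cell (lam : Fin 2 → V2) : Set V2 :=
  {v | ∃ a ∈ Ioo (0 : ℝ) 1, ∃ b ∈ Ioo (0 : ℝ) 1, v = a • lam 0 + b • lam 1}

/-- The slab `D = ℝ² × (-d, 0)`. -/
def slab (d : ℝ) : Set V3 := {x | ∃ p : V2, ∃ z ∈ Ioo (-d) 0, x = lift p z}

/-- One cell of the slab, `D₀₀ = Λ₀₀ × (-d, 0)`. -/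
def slabCell (lam : Fin 2 → V2) (d : ℝ) : Set V3 :=
  {x | ∃ p ∈ cell lam, ∃ z ∈ Ioo (-d) 0, x = lift p z}

/-- Periodicity of a vector field in the horizontal variables. -/
def IsPer (lam : Fin 2 → V2) (A : V3 → V3) : Prop :=
  ∀ v ∈ lattice lam, ∀ x, A (x + lift v 0) = A x

/-- The class `M_per` of admissible domain parametrizations. -/
structure MemMper (lam : Fin 2 → V2) (d γ : ℝ) (F : V3 → V3) : Prop where
  mem_holder : MemHolderLoc 3 γ F
  diffeo : ∃ G : V3 → V3, Function.LeftInverse G F ∧ Function.RightInverse G F ∧ ContDiff ℝ 3 G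
  bounded_deriv : ∃ C, ∀ x, ‖fderiv ℝ F x‖ ≤ C
  det_pos : ∀ x, 0 < (fderiv ℝ F x).det
  bottom : ∀ p : V2, F (lift p (-d)) = lift p (-d)
  periodic : ∀ v ∈ lattice lam, ∀ x, F (x + lift v 0) = F x + lift v 0

/-! ### Geometry of the free surface -/

/-- Parametrization `S(X, Y) = F(X, Y, 0)` of the free surface. -/
def surf (F : V3 → V3) (p : V2) : V3 := F (lift p 0)

/-- The vector `S_X × S_Y`. -/
def surfCross (F : V3 → V3) (p : V2) : V3 := cross (pdS 0 (surf F) p) (pdS 1 (surf F) p)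

/-- Unit normal of the free surface at `S(p)`; it points out of the fluid since `det DF > 0`. -/
def normal (F : V3 → V3) (p : V2) : V3 := ‖surfCross F p‖⁻¹ • surfCross F p

/-- Outward unit normal `(0, 0, -1)` of the flat bottom. -/
def normalBot : V3 := !₂[0, 0, -1]

/-- Surface divergence `N_X · a + N_Y · b` of a vector field `N` along the surface, where
`a = S_Y × n / |S_X × S_Y|` and `b = n × S_X / |S_X × S_Y|` are the tangent vectors dual to
`S_X`, `S_Y`. -/
def surfDiv (F : V3 → V3) (N : V2 → V3) (p : V2) : ℝ :=
  inner ℝ (pdS 0 N p) (‖surfCross F p‖⁻¹ • cross (pdS 1 (surf F) p) (normal F p)) +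
  inner ℝ (pdS 1 N p) (‖surfCross F p‖⁻¹ • cross (normal F p) (pdS 0 (surf F) p))

/-- Mean curvature `K_M` of the free surface at `S(p)`: `2 K_M = - div n`. -/
def meanCurv (F : V3 → V3) (p : V2) : ℝ := -(surfDiv F (normal F) p) / 2

/-! ### Functionals -/

/-- `E`: the integral of `|curl A|² - 2gz` over a fluid cell, minus `2σ` times the area of the
free surface of that cell. -/
def energy (lam : Fin 2 → V2) (d g σ : ℝ) (A F : V3 → V3) : ℝ :=
  (∫ x in F '' slabCell lam d, (‖curl A x‖ ^ 2 - 2 * g * x 2)) -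
    2 * σ * ∫ p in cell lam, ‖surfCross F p‖

/-- `K`: helicity. -/
def helicity (lam : Fin 2 → V2) (d : ℝ) (A F : V3 → V3) : ℝ :=
  ∫ x in F '' slabCell lam d, inner ℝ (A x) (curl A x)

/-- `M`: volume of a fluid cell. -/
def fluidVolume (lam : Fin 2 → V2) (d : ℝ) (F : V3 → V3) : ℝ :=
  ∫ _x in F '' slabCell lam d, (1 : ℝ)

/-- `J = E - α K - μ M`. -/
def functionalJ (lam : Fin 2 → V2) (d g σ α μ : ℝ) (A F : V3 → V3) : ℝ :=
  energy lam d g σ A F - α * helicity lam d A F - μ * fluidVolume lam d F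

/-! ### Admissible pairs and curves, critical points -/

/-- The boundary conditions `A × n = 0` on the free surface and `A × n = (m₁, m₂, 0)` on the
bottom. -/
def PotentialBC (d m₁ m₂ : ℝ) (A F : V3 → V3) : Prop :=
  (∀ p : V2, cross (A (surf F p)) (normal F p) = 0) ∧
  ∀ p : V2, cross (A (lift p (-d))) normalBot = !₂[m₁, m₂, 0]

/-- Admissible pairs: `F ∈ M_per`, and `A ∈ C^{2,γ}_per` satisfies the boundary conditions. -/
structure AdmissiblePair (lam : Fin 2 → V2) (d γ m₁ m₂ : ℝ) (A F : V3 → V3) : Prop where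
  mem_Mper : MemMper lam d γ F
  mem_holder : MemHolder 2 γ A
  periodic : IsPer lam A
  bc : PotentialBC d m₁ m₂ A F

/-- Admissible curves on `(-δ, δ)`: curves of admissible pairs such that `F` is continuously
differentiable for the `C^{3,γ}_loc` topology, and `A` is continuous for the `C^{2,γ'}` norm and
differentiable for the `C^{1,γ'}` norm. -/
structure AdmissibleCurve (lam : Fin 2 → V2) (d γ γ' m₁ m₂ δ : ℝ) (A F : ℝ → V3 → V3) :
    Prop where
  pair : ∀ t ∈ Ioo (-δ) δ, AdmissiblePair lam d γ m₁ m₂ (A t) (F t)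
  F_C1 : ∃ F' : ℝ → V3 → V3, ∀ t ∈ Ioo (-δ) δ, MemHolderLoc 3 γ (F' t) ∧
    ∀ R : ℝ, HolderHasDerivAt 3 γ (Metric.closedBall 0 R) F (F' t) t ∧
      HolderContinuousAt 3 γ (Metric.closedBall 0 R) F' t
  A_cont : ∀ t ∈ Ioo (-δ) δ, HolderContinuousAt 2 γ' univ A t
  A_diff : ∀ t ∈ Ioo (-δ) δ, ∃ A' : V3 → V3, MemHolder 1 γ' A' ∧
    HolderHasDerivAt 1 γ' univ A A' t

/-- `(A, Ω)`, `Ω = F(D)`, is a critical point of `J`: the derivative of `J` vanishes along every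
admissible curve through it. -/
def IsCritical (lam : Fin 2 → V2) (d γ γ' g σ α μ m₁ m₂ : ℝ) (A F : V3 → V3) : Prop :=
  ∀ δ > 0, ∀ Ac Fc : ℝ → V3 → V3, AdmissibleCurve lam d γ γ' m₁ m₂ δ Ac Fc →
    Ac 0 = A → Fc 0 = F →
    HasDerivAt (fun t => functionalJ lam d g σ α μ (Ac t) (Fc t)) 0 0

/-! ### Beltrami flows and boundary conditions -/

/-- `u` is a steady Beltrami flow in the open set `Ω`. -/
def IsBeltrami (α : ℝ) (u : V3 → V3) (Ω : Set V3) : Prop :=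
  ∀ x ∈ Ω, div u x = 0 ∧ curl u x = α • u x

/-- Kinematic condition `u · n = 0` on the free surface and on the bottom. -/
def Kinematic (d : ℝ) (u F : V3 → V3) : Prop :=
  (∀ p : V2, inner ℝ (u (surf F p)) (normal F p) = 0) ∧
  ∀ p : V2, inner ℝ (u (lift p (-d))) normalBot = 0

/-- Dynamic condition `|u|²/2 + gz - 2σ K_M = c` on the free surface. -/
def Bernoulli (g σ c : ℝ) (u F : V3 → V3) : Prop :=
  ∀ p : V2, ‖u (surf F p)‖ ^ 2 / 2 + g * surf F p 2 - 2 * σ * meanCurv F p = c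

end

end BeltramiWaves

open BeltramiWaves

/-!
The functional is differentiated along an arbitrary admissible curve `(A(s), F(s))`. Pulled back to
the slab cell by `F(s)`, it becomes an integral over a fixed set
(`AdmissiblePair.functionalJ_eq`), which may be differentiated under the integral sign
(`hasDerivAt_setIntegral_of_lipAtZero`). Write `A'` for the derivative of the potential, `W` for the
Eulerian velocity of the domain, `u = curl A` and `C = A' + grad (A · W)`. Then

* the variation of the volume density is the divergence of an explicit field `fluxField` plus
  `2 C · (curl u - α u)` (`bulk_identity`);
* the divergence theorem on the fluid cell, obtained from the Piola transform and the periodicity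
  (`MemMper.integral_div`), turns the divergence into boundary fluxes;
* differentiating the boundary conditions along the curve shows that `C + u × W` is normal to the
  free surface (`IsVariation.top_tangential`) and that `C` is vertical at the bottom, so the flux
  through the bottom vanishes and the flux through the free surface is
  `-(|u|² + 2gz + μ)` times the normal velocity (`IsVariation.flux_top`, `IsVariation.flux_bottom`);
* the variation of the area is `-2 K_M` times the normal velocity, up to a divergence
  (`MemMper.area_identity`).

Altogether (`IsVariation.hasDerivAt_functionalJ`) the derivative of `J` is

  `∫ 2 C · (curl u - α u) dV - 2 ∫ (|u|² / 2 + gz - 2σ K_M + μ / 2) (W · n) dS`.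

Two of the conditions in the theorem are automatic: `div u = 0`, and `u · n = 0`, which follows from
the boundary conditions on `A` (`AdmissiblePair.kinematic`). The remaining two make both integrals
vanish, which is the implication from right to left (`AdmissiblePair.isCritical`).

Conversely, two families of admissible curves are needed. Adding to `A` a field with support inside
the fluid is always admissible and gives `curl u = α u` (`IsCritical.curl_curl_eq`). For the
Bernoulli condition the surface has to be moved, and the potential has to be carried along without
violating its boundary condition or its regularity. The domain is moved by `F + s η(F) e` and the
potential is replaced by its pull-back, as a one-form, under the explicit map `x - s η(x) e`. The
bump function `η` is chosen locally constant in direction `e` along the surface (`exists_bump`);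
then the explicit map sends the moved surface exactly back to the original one, and the pull-back
is normal to the moved surface (`AdmissiblePair.exists_admissibleCurve`). The pull-back involves
`A` at points depending on `s`, which is continuous in `C^{2,γ'}` and differentiable in `C^{1,γ'}`
by interpolation, because `γ' < γ` (`holderSmall_comp_shiftMap`, `holderHasDerivAt_transported`).
Since `e` is transversal to the surface, the surface integral yields the Bernoulli condition
(`IsCritical.bernoulli`).

The second assertion follows from the first with `μ = -2c`.
-/

open BeltramiWaves
namespace BeltramiWaves

/-! ### Vector calculus on Euclidean three-space -/

/-- The `i`-th standard basis vector of space. -/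
noncomputable abbrev e3 (i : Fin 3) : V3 := EuclideanSpace.single i 1

lemma inner_eq (a b : V3) : inner ℝ a b = a 0 * b 0 + a 1 * b 1 + a 2 * b 2 := by
  simp [PiLp.inner_apply, Fin.sum_univ_three]; ring

lemma norm_sq_eq (a : V3) : ‖a‖ ^ 2 = a 0 * a 0 + a 1 * a 1 + a 2 * a 2 := by
  rw [← real_inner_self_eq_norm_sq, inner_eq]

@[simp] lemma cross_zero_coord (a b : V3) : cross a b 0 = a 1 * b 2 - a 2 * b 1 := by
  simp [cross, cross_apply]
@[simp] lemma cross_one_coord (a b : V3) : cross a b 1 = a 2 * b 0 - a 0 * b 2 := by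
  simp [cross, cross_apply]
@[simp] lemma cross_two_coord (a b : V3) : cross a b 2 = a 0 * b 1 - a 1 * b 0 := by
  simp [cross, cross_apply]

lemma V3.ext' {a b : V3} (h0 : a 0 = b 0) (h1 : a 1 = b 1) (h2 : a 2 = b 2) : a = b := by
  ext i; fin_cases i <;> assumption

/-- The vector product as a continuous bilinear map. -/
noncomputable def crossL : V3 →L[ℝ] V3 →L[ℝ] V3 :=
  LinearMap.toContinuousBilinearMap (LinearMap.mk₂ ℝ cross
    (fun a b c => by apply V3.ext' <;> simp <;> ring)
    (fun a b c => by apply V3.ext' <;> simp <;> ring)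
    (fun a b c => by apply V3.ext' <;> simp <;> ring)
    (fun a b c => by apply V3.ext' <;> simp <;> ring))

@[simp] lemma crossL_apply (a b : V3) : crossL a b = cross a b := rfl

lemma eq_sum_e3 (v : V3) : v = v 0 • e3 0 + v 1 • e3 1 + v 2 • e3 2 := by
  apply V3.ext' <;> simp

lemma clm_apply_eq_sum {E : Type*} [AddCommGroup E] [Module ℝ E] [TopologicalSpace E]
    (L : V3 →L[ℝ] E) (v : V3) :
    L v = v 0 • L (e3 0) + v 1 • L (e3 1) + v 2 • L (e3 2) := by
  conv_lhs => rw [eq_sum_e3 v]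
  simp only [map_add, map_smul]

lemma det_eq_triple (L : V3 →L[ℝ] V3) :
    L.det = inner ℝ (L (e3 0)) (cross (L (e3 1)) (L (e3 2))) := by
  have : L.det = LinearMap.det (L : V3 →ₗ[ℝ] V3) := rfl
  rw [this, ← LinearMap.det_toMatrix (EuclideanSpace.basisFun (Fin 3) ℝ).toBasis, Matrix.det_fin_three,
    inner_eq]
  simp [LinearMap.toMatrix_apply]
  ring

/-- `i`-th partial derivative of a scalar function on space. -/
noncomputable def pdr (i : Fin 3) (f : V3 → ℝ) (x : V3) : ℝ := fderiv ℝ f x (e3 i)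

/-- Gradient of a scalar function on space. -/
noncomputable def grad (f : V3 → ℝ) (x : V3) : V3 := !₂[pdr 0 f x, pdr 1 f x, pdr 2 f x]

@[simp] lemma grad_apply_zero (f : V3 → ℝ) (x : V3) : grad f x 0 = pdr 0 f x := rfl
@[simp] lemma grad_apply_one (f : V3 → ℝ) (x : V3) : grad f x 1 = pdr 1 f x := rfl
@[simp] lemma grad_apply_two (f : V3 → ℝ) (x : V3) : grad f x 2 = pdr 2 f x := rfl
@[simp] lemma curl_apply_zero (f : V3 → V3) (x : V3) : curl f x 0 = pd 1 f x 2 - pd 2 f x 1 := rfl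
@[simp] lemma curl_apply_one (f : V3 → V3) (x : V3) : curl f x 1 = pd 2 f x 0 - pd 0 f x 2 := rfl
@[simp] lemma curl_apply_two (f : V3 → V3) (x : V3) : curl f x 2 = pd 0 f x 1 - pd 1 f x 0 := rfl

lemma div_eq (A : V3 → V3) (x : V3) : div A x = pd 0 A x 0 + pd 1 A x 1 + pd 2 A x 2 := by
  simp [div, Fin.sum_univ_three]

lemma grad_inner (f : V3 → ℝ) (x v : V3) : inner ℝ (grad f x) v = fderiv ℝ f x v := by
  rw [clm_apply_eq_sum (fderiv ℝ f x) v, inner_eq]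
  simp [pdr]; ring

section rules
variable {f g : V3 → V3} {c : V3 → ℝ} {x : V3} (i : Fin 3)

lemma pd_add (hf : DifferentiableAt ℝ f x) (hg : DifferentiableAt ℝ g x) :
    pd i (fun y => f y + g y) x = pd i f x + pd i g x := by
  simp [pd, fderiv_fun_add hf hg]

lemma pd_sub (hf : DifferentiableAt ℝ f x) (hg : DifferentiableAt ℝ g x) :
    pd i (fun y => f y - g y) x = pd i f x - pd i g x := by
  simp [pd, fderiv_fun_sub hf hg]

lemma pd_const_smul (a : ℝ) (hf : DifferentiableAt ℝ f x) :
    pd i (fun y => a • f y) x = a • pd i f x := by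
  simp [pd, fderiv_fun_const_smul hf]

lemma pd_smul (hc : DifferentiableAt ℝ c x) (hf : DifferentiableAt ℝ f x) :
    pd i (fun y => c y • f y) x = c x • pd i f x + pdr i c x • f x := by
  simp [pd, pdr, fderiv_fun_smul hc hf]

lemma pd_cross (hf : DifferentiableAt ℝ f x) (hg : DifferentiableAt ℝ g x) :
    pd i (fun y => cross (f y) (g y)) x = cross (f x) (pd i g x) + cross (pd i f x) (g x) := by
  have := crossL.hasFDerivAt_of_bilinear hf.hasFDerivAt hg.hasFDerivAt
  simp only [crossL_apply] at this
  simp [pd, this.fderiv]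

lemma pdr_inner (hf : DifferentiableAt ℝ f x) (hg : DifferentiableAt ℝ g x) :
    pdr i (fun y => inner ℝ (f y) (g y)) x = inner ℝ (f x) (pd i g x) + inner ℝ (pd i f x) (g x) := by
  simp [pd, pdr, fderiv_inner_apply ℝ hf hg]

lemma pd_apply_coord (hf : DifferentiableAt ℝ f x) (j : Fin 3) :
    pd i f x j = pdr i (fun y => f y j) x := by
  have h := ((EuclideanSpace.proj j : V3 →L[ℝ] ℝ).hasFDerivAt (x := f x)).comp x
    hf.hasFDerivAt
  simp only [pd, pdr]
  have : fderiv ℝ (fun y => f y j) x = _ := h.fderiv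
  rw [this]; simp

lemma div_add (hf : DifferentiableAt ℝ f x) (hg : DifferentiableAt ℝ g x) :
    div (fun y => f y + g y) x = div f x + div g x := by
  simp [div_eq, pd_add _ hf hg]; ring

lemma div_sub (hf : DifferentiableAt ℝ f x) (hg : DifferentiableAt ℝ g x) :
    div (fun y => f y - g y) x = div f x - div g x := by
  simp [div_eq, pd_sub _ hf hg]; ring

lemma div_const_smul (a : ℝ) (hf : DifferentiableAt ℝ f x) :
    div (fun y => a • f y) x = a * div f x := by
  simp [div_eq, pd_const_smul _ a hf]; ring

lemma div_smul (hc : DifferentiableAt ℝ c x) (hf : DifferentiableAt ℝ f x) :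
    div (fun y => c y • f y) x = c x * div f x + inner ℝ (grad c x) (f x) := by
  simp [div_eq, pd_smul _ hc hf, inner_eq]; ring

lemma div_cross (hf : DifferentiableAt ℝ f x) (hg : DifferentiableAt ℝ g x) :
    div (fun y => cross (f y) (g y)) x =
      inner ℝ (g x) (curl f x) - inner ℝ (f x) (curl g x) := by
  simp [div_eq, pd_cross _ hf hg, inner_eq]; ring

lemma curl_add (hf : DifferentiableAt ℝ f x) (hg : DifferentiableAt ℝ g x) :
    curl (fun y => f y + g y) x = curl f x + curl g x := by
  apply V3.ext' <;> simp [pd_add _ hf hg] <;> ring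

end rules

/-! ### Second derivatives -/

lemma pdr_pdr_comm {φ : V3 → ℝ} (h : ContDiff ℝ 2 φ) (i j : Fin 3) (x : V3) :
    pdr i (pdr j φ) x = pdr j (pdr i φ) x := by
  have hs : IsSymmSndFDerivAt ℝ φ x := h.contDiffAt.isSymmSndFDerivAt (by simp)
  have hd : DifferentiableAt ℝ (fderiv ℝ φ) x :=
    (h.fderiv_right (m := 1) (by norm_num)).differentiable (by norm_num) x
  have key : ∀ i j, pdr i (pdr j φ) x = fderiv ℝ (fderiv ℝ φ) x (e3 i) (e3 j) := by
    intro i j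
    have := (hd.hasFDerivAt.clm_apply (hasFDerivAt_const (e3 j) x)).fderiv
    change fderiv ℝ (fun y => fderiv ℝ φ y (e3 j)) x (e3 i) = _
    rw [this]; simp
  rw [key, key]; exact hs _ _

lemma pd_pd_comm {E : V3 → V3} (h : ContDiff ℝ 2 E) (i j : Fin 3) (x : V3) :
    pd i (pd j E) x = pd j (pd i E) x := by
  have hs : IsSymmSndFDerivAt ℝ E x := h.contDiffAt.isSymmSndFDerivAt (by simp)
  have hd : DifferentiableAt ℝ (fderiv ℝ E) x :=
    (h.fderiv_right (m := 1) (by norm_num)).differentiable (by norm_num) x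
  have key : ∀ i j, pd i (pd j E) x = fderiv ℝ (fderiv ℝ E) x (e3 i) (e3 j) := by
    intro i j
    have := (hd.hasFDerivAt.clm_apply (hasFDerivAt_const (e3 j) x)).fderiv
    change fderiv ℝ (fun y => fderiv ℝ E y (e3 j)) x (e3 i) = _
    rw [this]; simp
  rw [key, key]; exact hs _ _

lemma contDiff_pd {f : V3 → V3} {n m : WithTop ℕ∞} (hf : ContDiff ℝ n f) (hmn : m + 1 ≤ n)
    (i : Fin 3) : ContDiff ℝ m (pd i f) :=
  (hf.fderiv_right hmn).clm_apply contDiff_const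

lemma contDiff_pdr {f : V3 → ℝ} {n m : WithTop ℕ∞} (hf : ContDiff ℝ n f) (hmn : m + 1 ≤ n)
    (i : Fin 3) : ContDiff ℝ m (pdr i f) :=
  (hf.fderiv_right hmn).clm_apply contDiff_const

lemma contDiff_coord {E : Type*} [NormedAddCommGroup E] [NormedSpace ℝ E] {f : E → V3}
    {n : WithTop ℕ∞} (hf : ContDiff ℝ n f) (i : Fin 3) : ContDiff ℝ n (fun x => f x i) :=
  (EuclideanSpace.proj i : V3 →L[ℝ] ℝ).contDiff.comp hf

lemma contDiff_vec3 {E : Type*} [NormedAddCommGroup E] [NormedSpace ℝ E] {a b c : E → ℝ}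
    {n : WithTop ℕ∞} (ha : ContDiff ℝ n a) (hb : ContDiff ℝ n b) (hc : ContDiff ℝ n c) :
    ContDiff ℝ n (fun x => (!₂[a x, b x, c x] : V3)) := by
  rw [contDiff_euclidean]
  intro i; fin_cases i <;> simpa

lemma contDiff_curl {f : V3 → V3} {n m : WithTop ℕ∞} (hf : ContDiff ℝ n f) (hmn : m + 1 ≤ n) :
    ContDiff ℝ m (curl f) :=
  contDiff_vec3 ((contDiff_coord (contDiff_pd hf hmn 1) 2).sub (contDiff_coord (contDiff_pd hf hmn 2) 1))
    ((contDiff_coord (contDiff_pd hf hmn 2) 0).sub (contDiff_coord (contDiff_pd hf hmn 0) 2))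
    ((contDiff_coord (contDiff_pd hf hmn 0) 1).sub (contDiff_coord (contDiff_pd hf hmn 1) 0))

lemma contDiff_grad {f : V3 → ℝ} {n m : WithTop ℕ∞} (hf : ContDiff ℝ n f) (hmn : m + 1 ≤ n) :
    ContDiff ℝ m (grad f) :=
  contDiff_vec3 (contDiff_pdr hf hmn 0) (contDiff_pdr hf hmn 1) (contDiff_pdr hf hmn 2)

lemma contDiff_cross {E : Type*} [NormedAddCommGroup E] [NormedSpace ℝ E] {f g : E → V3}
    {n : WithTop ℕ∞} (hf : ContDiff ℝ n f) (hg : ContDiff ℝ n g) :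
    ContDiff ℝ n (fun x => cross (f x) (g x)) :=
  (crossL.contDiff.comp hf).clm_apply hg

lemma curl_grad {φ : V3 → ℝ} (h : ContDiff ℝ 2 φ) (x : V3) : curl (grad φ) x = 0 := by
  have hd : DifferentiableAt ℝ (grad φ) x :=
    (contDiff_grad h (m := 1) (by norm_num)).differentiable (by norm_num) x
  apply V3.ext' <;> simp only [curl_apply_zero, curl_apply_one, curl_apply_two,
    pd_apply_coord _ hd, grad_apply_zero, grad_apply_one, grad_apply_two, PiLp.zero_apply]
  · exact sub_eq_zero.2 (pdr_pdr_comm h _ _ _)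
  · exact sub_eq_zero.2 (pdr_pdr_comm h _ _ _)
  · exact sub_eq_zero.2 (pdr_pdr_comm h _ _ _)

lemma div_curl {f : V3 → V3} (h : ContDiff ℝ 2 f) (x : V3) : div (curl f) x = 0 := by
  have hd : DifferentiableAt ℝ (curl f) x :=
    (contDiff_curl h (m := 1) (by norm_num)).differentiable (by norm_num) x
  have hp : ∀ i, DifferentiableAt ℝ (pd i f) x := fun i =>
    (contDiff_pd h (m := 1) (by norm_num) i).differentiable (by norm_num) x
  have hpc : ∀ i j, DifferentiableAt ℝ (fun y => pd i f y j) x := fun i j =>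
    (contDiff_coord (contDiff_pd h (m := 1) (by norm_num) i) j).differentiable (by norm_num) x
  have hs : ∀ i j k l m, pdr i (fun y => pd j f y k - pd l f y m) x
      = pd i (pd j f) x k - pd i (pd l f) x m := by
    intro i j k l m
    rw [pd_apply_coord _ (hp j), pd_apply_coord _ (hp l)]
    simp [pdr, fderiv_fun_sub (hpc j k) (hpc l m)]
  simp only [div_eq, pd_apply_coord _ hd, curl_apply_zero, curl_apply_one, curl_apply_two, hs]
  rw [pd_pd_comm h 1 0, pd_pd_comm h 2 0, pd_pd_comm h 2 1]
  ring

/-- The antisymmetric part of the derivative in terms of the curl. It turns derivatives of boundary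
conditions on `A` along and across the surface into statements on `curl A`. -/
lemma inner_cross_curl (A : V3 → V3) (x w τ : V3) :
    inner ℝ (cross (curl A x) w) τ
      = inner ℝ (fderiv ℝ A x w) τ - inner ℝ (fderiv ℝ A x τ) w := by
  rw [clm_apply_eq_sum _ w, clm_apply_eq_sum _ τ]
  simp [inner_eq, pd]
  ring

lemma contDiff_inner3 {E : Type*} [NormedAddCommGroup E] [NormedSpace ℝ E] {f g : E → V3}
    {n : WithTop ℕ∞} (hf : ContDiff ℝ n f) (hg : ContDiff ℝ n g) :
    ContDiff ℝ n (fun x => inner ℝ (f x) (g x)) := hf.inner ℝ hg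

/-! ### The variation of the energy density as a divergence -/

/-- The vector field whose flux is the boundary part of the first variation; here `C` is the
derivative of the potential plus the gradient of `A · W`, and `e` is the energy density. -/
noncomputable def fluxField (α : ℝ) (A C W : V3 → V3) (e : V3 → ℝ) (x : V3) : V3 :=
  ((2 : ℝ) • cross (C x) (curl A x) - α • cross (C x) (A x)) +
    (e x • W x + (α * inner ℝ (A x) (W x)) • curl A x)

lemma contDiff_fluxField {α : ℝ} {A C W : V3 → V3} {e : V3 → ℝ} (hA : ContDiff ℝ 2 A)
    (hC : ContDiff ℝ 1 C) (hW : ContDiff ℝ 1 W) (he : ContDiff ℝ 1 e) :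
    ContDiff ℝ 1 (fluxField α A C W e) := by
  have hA1 : ContDiff ℝ 1 A := hA.of_le (by norm_num)
  have hu : ContDiff ℝ 1 (curl A) := contDiff_curl hA (by norm_num)
  have h1 : ContDiff ℝ 1 (fun y => (2 : ℝ) • cross (C y) (curl A y)) :=
    (contDiff_cross hC hu).const_smul 2
  have h2 : ContDiff ℝ 1 (fun y => α • cross (C y) (A y)) :=
    (contDiff_cross hC hA1).const_smul α
  have h3 : ContDiff ℝ 1 (fun y => (α * inner ℝ (A y) (W y)) • curl A y) :=
    (contDiff_const.mul (contDiff_inner3 hA1 hW)).smul hu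
  exact (h1.sub h2).add ((he.smul hW).add h3)

/-- The divergence of `fluxField` with the field `u`, the density `e` and the factor `ψ` left
generic, by the product rules. -/
lemma div_combination {C u A W : V3 → V3} {e ψ : V3 → ℝ} {x : V3} (α : ℝ)
    (dC : DifferentiableAt ℝ C x) (du : DifferentiableAt ℝ u x) (dA : DifferentiableAt ℝ A x)
    (dW : DifferentiableAt ℝ W x) (de : DifferentiableAt ℝ e x) (dψ : DifferentiableAt ℝ ψ x) :
    div (fun y => ((2 : ℝ) • cross (C y) (u y) - α • cross (C y) (A y)) +
      (e y • W y + ψ y • u y)) x =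
    (2 * (inner ℝ (u x) (curl C x) - inner ℝ (C x) (curl u x)) -
      α * (inner ℝ (A x) (curl C x) - inner ℝ (C x) (curl A x))) +
    ((e x * div W x + inner ℝ (grad e x) (W x)) + (ψ x * div u x + inner ℝ (grad ψ x) (u x))) := by
  have dCu : DifferentiableAt ℝ (fun y => cross (C y) (u y)) x :=
    (crossL.hasFDerivAt_of_bilinear dC.hasFDerivAt du.hasFDerivAt).differentiableAt
  have dCA : DifferentiableAt ℝ (fun y => cross (C y) (A y)) x :=
    (crossL.hasFDerivAt_of_bilinear dC.hasFDerivAt dA.hasFDerivAt).differentiableAt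
  rw [div_add ((dCu.fun_const_smul (2 : ℝ)).fun_sub (dCA.fun_const_smul α))
    ((de.fun_smul dW).fun_add (dψ.fun_smul du)),
    div_sub (dCu.fun_const_smul (2 : ℝ)) (dCA.fun_const_smul α),
    div_add (de.fun_smul dW) (dψ.fun_smul du), div_const_smul _ dCu, div_const_smul _ dCA,
    div_cross dC du, div_cross dC dA, div_smul de dW, div_smul dψ du]

/-- The variation of the density of `J`, in Eulerian form, is a divergence plus a term that is
proportional to `curl u - α u`. -/
lemma bulk_identity {α : ℝ} {A A' W : V3 → V3} {e : V3 → ℝ} (hA : ContDiff ℝ 2 A)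
    (hA' : ContDiff ℝ 1 A') (hW : ContDiff ℝ 2 W) (he : ContDiff ℝ 1 e) (x : V3) :
    2 * inner ℝ (curl A x) (curl A' x) - α * inner ℝ (A' x) (curl A x)
        - α * inner ℝ (A x) (curl A' x) + fderiv ℝ e x (W x) + e x * div W x =
      div (fluxField α A (fun y => A' y + grad (fun z => inner ℝ (A z) (W z)) y) W e) x +
        2 * inner ℝ (A' x + grad (fun z => inner ℝ (A z) (W z)) x)
          (curl (curl A) x - α • curl A x) := by
  have hφ : ContDiff ℝ 2 (fun z => inner ℝ (A z) (W z)) := contDiff_inner3 hA hW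
  have one : (1 : WithTop ℕ∞) ≠ 0 := by norm_num
  have two : (2 : WithTop ℕ∞) ≠ 0 := by norm_num
  have dG := (contDiff_grad hφ (m := 1) (by norm_num)).differentiable one x
  have du := (contDiff_curl hA (m := 1) (by norm_num)).differentiable one x
  have dA' := hA'.differentiable one x
  have dφ := hφ.differentiable two x
  have hcg : grad (fun y => α * inner ℝ (A y) (W y)) x
      = α • grad (fun z => inner ℝ (A z) (W z)) x := by
    apply V3.ext' <;> simp [pdr, fderiv_const_mul dφ]
  have key := div_combination α (dA'.fun_add dG) du (hA.differentiable two x)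
    (hW.differentiable two x) (he.differentiable one x) (dφ.const_mul α)
  rw [curl_add dA' dG, curl_grad hφ, div_curl hA, hcg, grad_inner] at key
  change div (fluxField α A (fun y => A' y + grad (fun z => inner ℝ (A z) (W z)) y) W e) x = _ at key
  rw [key]
  generalize grad (fun z => inner ℝ (A z) (W z)) x = G
  -- what remains is bilinear algebra, linear in `G = grad (A · W)`
  simp only [inner_add_left, inner_add_right, inner_smul_right, inner_sub_right, add_zero,
    real_inner_comm (curl A x)]
  ring

/-- `fluxField` in terms of `B = C + u × W`, whose tangential part vanishes at the boundary. -/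
lemma fluxField_eq (α : ℝ) (A C W : V3 → V3) (e : V3 → ℝ) (x : V3) :
    fluxField α A C W e x =
      (2 : ℝ) • cross (C x + cross (curl A x) (W x)) (curl A x)
        - α • cross (C x + cross (curl A x) (W x)) (A x)
        + (2 * inner ℝ (curl A x) (W x)) • curl A x
        + (e x - 2 * ‖curl A x‖ ^ 2 + α * inner ℝ (A x) (curl A x)) • W x := by
  apply V3.ext' <;> simp [fluxField, inner_eq, norm_sq_eq] <;> ring

/-! ### Horizontal and vertical coordinates -/

@[simp] lemma lift_apply_zero (p : V2) (z : ℝ) : lift p z 0 = p 0 := rfl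
@[simp] lemma lift_apply_one (p : V2) (z : ℝ) : lift p z 1 = p 1 := rfl
@[simp] lemma lift_apply_two (p : V2) (z : ℝ) : lift p z 2 = z := rfl

/-- Splitting of space into horizontal part and height. -/
noncomputable def liftL : (V2 × ℝ) ≃L[ℝ] V3 :=
  LinearEquiv.toContinuousLinearEquiv
  { toFun := fun q => lift q.1 q.2
    invFun := fun x => (!₂[x 0, x 1], x 2)
    map_add' := fun a b => by apply V3.ext' <;> simp
    map_smul' := fun a b => by apply V3.ext' <;> simp
    left_inv := fun q => by
      ext i
      · fin_cases i <;> simp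
      · simp
    right_inv := fun x => by apply V3.ext' <;> simp }

/-- Horizontal part of a point of space. -/
noncomputable def hor (x : V3) : V2 := !₂[x 0, x 1]

@[simp] lemma hor_apply_zero (x : V3) : hor x 0 = x 0 := rfl
@[simp] lemma hor_apply_one (x : V3) : hor x 1 = x 1 := rfl

lemma V2.ext' {a b : V2} (h0 : a 0 = b 0) (h1 : a 1 = b 1) : a = b := by
  ext i; fin_cases i <;> assumption

lemma lift_hor (x : V3) : lift (hor x) (x 2) = x := by apply V3.ext' <;> simp
lemma hor_lift (p : V2) (z : ℝ) : hor (lift p z) = p := by apply V2.ext' <;> simp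
lemma lift_add_zero (p q : V2) (z : ℝ) : lift (p + q) z = lift p z + lift q 0 := by
  apply V3.ext' <;> simp

lemma contDiff_lift {n : WithTop ℕ∞} (z : ℝ) : ContDiff ℝ n (fun p => lift p z) :=
  liftL.contDiff.comp (contDiff_id.prodMk contDiff_const)

lemma continuous_lift : Continuous (fun q : V2 × ℝ => lift q.1 q.2) := liftL.continuous

/-- Horizontal inclusion as a continuous linear map. -/
noncomputable def inclL : V2 →L[ℝ] V3 :=
  (liftL : (V2 × ℝ) →L[ℝ] V3).comp (ContinuousLinearMap.inl ℝ V2 ℝ)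

@[simp] lemma inclL_apply (p : V2) : inclL p = lift p 0 := rfl

lemma hasFDerivAt_lift (p : V2) (z : ℝ) : HasFDerivAt (fun p => lift p z) inclL p := by
  have h : (fun p => lift p z) = fun p => inclL p + lift 0 z := by
    funext p; apply V3.ext' <;> simp
  rw [h]; exact inclL.hasFDerivAt.add_const _

lemma hasDerivAt_lift (p : V2) (z : ℝ) : HasDerivAt (fun z => lift p z) (e3 2) z := by
  have h : (fun z => lift p z) = fun z => lift p 0 + z • e3 2 := by
    funext p; apply V3.ext' <;> simp
  rw [h]
  simpa using ((hasDerivAt_id z).smul_const (e3 2)).const_add (lift p 0)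

lemma lift_single_zero : lift (EuclideanSpace.single 0 1) 0 = e3 0 := by apply V3.ext' <;> simp
lemma lift_single_one : lift (EuclideanSpace.single 1 1) 0 = e3 1 := by apply V3.ext' <;> simp

lemma measurePreserving_lift :
    MeasurePreserving (fun q : V2 × ℝ => lift q.1 q.2) := by
  have h1 : MeasurePreserving (fun q : V2 × ℝ => (q.1.ofLp, q.2)) :=
    (PiLp.volume_preserving_ofLp (Fin 2)).prod (MeasurePreserving.id volume)
  have h2 : MeasurePreserving (Prod.swap : (Fin 2 → ℝ) × ℝ → ℝ × (Fin 2 → ℝ)) :=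
    Measure.measurePreserving_swap
  have h3 := (volume_preserving_piFinSuccAbove (fun _ : Fin 3 => ℝ) (Fin.last 2)).symm
  have h4 := PiLp.volume_preserving_toLp (Fin 3)
  have := h4.comp (h3.comp (h2.comp h1))
  convert this using 1
  funext q
  apply V3.ext' <;> simp [MeasurableEquiv.piFinSuccAbove] <;> rfl

/-! ### The lattice cell -/

/-- Lattice coordinates on the plane: `(a, b) ↦ a λ₁ + b λ₂`. -/
noncomputable def latL (lam : Fin 2 → V2) (hlam : LinearIndependent ℝ lam) :
    (ℝ × ℝ) ≃L[ℝ] V2 :=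
  (LinearMap.linearEquivOfInjective
    ((LinearMap.toSpanSingleton ℝ V2 (lam 0)).coprod (LinearMap.toSpanSingleton ℝ V2 (lam 1)))
    (by
      rw [injective_iff_map_eq_zero]
      rintro ⟨a, b⟩ h
      have h' := LinearIndependent.pair_iff.1
        (show LinearIndependent ℝ ![lam 0, lam 1] by
          convert hlam using 1; funext i; fin_cases i <;> rfl) a b (by simpa using h)
      exact Prod.ext h'.1 h'.2)
    (by simp)).toContinuousLinearEquiv

lemma latL_apply (lam : Fin 2 → V2) (hlam : LinearIndependent ℝ lam) (q : ℝ × ℝ) :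
    latL lam hlam q = q.1 • lam 0 + q.2 • lam 1 := by
  simp [latL, LinearMap.linearEquivOfInjective_apply]

lemma cell_eq (lam : Fin 2 → V2) (hlam : LinearIndependent ℝ lam) :
    cell lam = latL lam hlam '' (Ioo 0 1 ×ˢ Ioo 0 1) := by
  ext v
  simp only [cell, mem_ofPred_eq, mem_image, mem_prod, latL_apply, Prod.exists]
  constructor
  · rintro ⟨a, ha, b, hb, rfl⟩; exact ⟨a, b, ⟨ha, hb⟩, rfl⟩
  · rintro ⟨a, b, ⟨ha, hb⟩, rfl⟩; exact ⟨a, ha, b, hb, rfl⟩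

lemma slabCell_eq (lam : Fin 2 → V2) (d : ℝ) :
    slabCell lam d = (fun q : V2 × ℝ => lift q.1 q.2) '' (cell lam ×ˢ Ioo (-d) 0) := by
  ext v
  simp only [slabCell, mem_ofPred_eq, mem_image, mem_prod, Prod.exists]
  constructor
  · rintro ⟨a, ha, b, hb, rfl⟩; exact ⟨a, b, ⟨ha, hb⟩, rfl⟩
  · rintro ⟨a, b, ⟨ha, hb⟩, rfl⟩; exact ⟨a, ha, b, hb, rfl⟩

variable {lam : Fin 2 → V2} {d : ℝ}

lemma isOpen_cell (hlam : LinearIndependent ℝ lam) : IsOpen (cell lam) := by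
  rw [cell_eq lam hlam]
  exact (latL lam hlam).toHomeomorph.isOpenMap _ (isOpen_Ioo.prod isOpen_Ioo)

lemma isOpen_slabCell (hlam : LinearIndependent ℝ lam) : IsOpen (slabCell lam d) := by
  rw [slabCell_eq]
  exact liftL.toHomeomorph.isOpenMap _ ((isOpen_cell hlam).prod isOpen_Ioo)

/-- The closed cell. -/
def closedCell (lam : Fin 2 → V2) : Set V2 :=
  (fun q : ℝ × ℝ => q.1 • lam 0 + q.2 • lam 1) '' (Icc 0 1 ×ˢ Icc 0 1)

/-- The closed cell of the slab. -/
def closedSlabCell (lam : Fin 2 → V2) (d : ℝ) : Set V3 :=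
  (fun q : V2 × ℝ => lift q.1 q.2) '' (closedCell lam ×ˢ Icc (-d) 0)

lemma isCompact_closedCell : IsCompact (closedCell lam) :=
  (isCompact_Icc.prod isCompact_Icc).image (by fun_prop)

lemma isCompact_closedSlabCell : IsCompact (closedSlabCell lam d) :=
  (isCompact_closedCell.prod isCompact_Icc).image continuous_lift

lemma cell_subset : cell lam ⊆ closedCell lam := by
  rintro v ⟨a, ha, b, hb, rfl⟩
  exact ⟨(a, b), ⟨Ioo_subset_Icc_self ha, Ioo_subset_Icc_self hb⟩, rfl⟩

lemma slabCell_subset : slabCell lam d ⊆ closedSlabCell lam d := by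
  rintro v ⟨p, hp, z, hz, rfl⟩
  exact ⟨(p, z), ⟨cell_subset hp, Ioo_subset_Icc_self hz⟩, rfl⟩

lemma integrableOn_cell {E : Type*} [NormedAddCommGroup E] {h : V2 → E} (hh : Continuous h) :
    IntegrableOn h (cell lam) :=
  (hh.continuousOn.integrableOn_compact isCompact_closedCell).mono_set cell_subset

lemma integrableOn_slabCell {E : Type*} [NormedAddCommGroup E] {h : V3 → E} (hh : Continuous h) :
    IntegrableOn h (slabCell lam d) :=
  (hh.continuousOn.integrableOn_compact isCompact_closedSlabCell).mono_set slabCell_subset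

/-! ### Derivatives of periodic functions integrate to zero -/

lemma cell_swap : cell (fun i => lam (Equiv.swap 0 1 i)) = cell lam := by
  ext v
  simp only [cell, mem_ofPred_eq, Equiv.swap_apply_left, Equiv.swap_apply_right]
  constructor
  · rintro ⟨a, ha, b, hb, rfl⟩; exact ⟨b, hb, a, ha, add_comm _ _⟩
  · rintro ⟨a, ha, b, hb, rfl⟩; exact ⟨b, hb, a, ha, add_comm _ _⟩

/-- The integral over a cell of the derivative in the first lattice direction of a function that is
periodic in that direction: in lattice coordinates it is a difference of boundary values. -/
lemma integral_cell_deriv_lattice (hlam : LinearIndependent ℝ lam) {h : V2 → ℝ}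
    (hh : ContDiff ℝ 1 h) (hper : ∀ p, h (p + lam 0) = h p) :
    ∫ p in cell lam, fderiv ℝ h p (lam 0) = 0 := by
  -- up to a constant, the planar measure is Lebesgue measure in lattice coordinates
  obtain ⟨c, hμ⟩ : ∃ c : NNReal, (volume : Measure V2) =
      c • (volume : Measure (ℝ × ℝ)).map (latL lam hlam).toHomeomorph :=
    ⟨_, Measure.isAddLeftInvariant_eq_smul volume
      ((volume : Measure (ℝ × ℝ)).map (latL lam hlam))⟩
  have hcont : Continuous fun p => fderiv ℝ h p (lam 0) :=
    (hh.continuous_fderiv (by norm_num)).clm_apply continuous_const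
  rw [hμ, Measure.restrict_smul, integral_smul_nnreal_measure, cell_eq lam hlam,
    show latL lam hlam '' (Ioo 0 1 ×ˢ Ioo 0 1) =
      (latL lam hlam).toHomeomorph '' (Ioo 0 1 ×ˢ Ioo 0 1) from rfl,
    ((latL lam hlam).toHomeomorph.measurableEmbedding.measurable.measurePreserving
      volume).setIntegral_image_emb (latL lam hlam).toHomeomorph.measurableEmbedding]
  rw [Measure.volume_eq_prod, ← Measure.prod_restrict, integral_prod_symm]
  · have : ∀ b : ℝ, ∫ a in Ioo (0 : ℝ) 1, fderiv ℝ h (latL lam hlam (a, b)) (lam 0) = 0 := by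
      intro b
      rw [← integral_Ioc_eq_integral_Ioo, ← intervalIntegral.integral_of_le zero_le_one]
      have hd : ∀ a ∈ uIcc (0 : ℝ) 1, HasDerivAt (fun a => h (latL lam hlam (a, b)))
          (fderiv ℝ h (latL lam hlam (a, b)) (lam 0)) a := by
        intro a _
        have h1 : HasDerivAt (fun a : ℝ => latL lam hlam (a, b)) (lam 0) a := by
          simp only [latL_apply]
          simpa using ((hasDerivAt_id a).smul_const (lam 0)).add_const (b • lam 1)
        exact (hh.differentiable (by norm_num) _).hasFDerivAt.comp_hasDerivAt a h1
      rw [intervalIntegral.integral_eq_sub_of_hasDerivAt hd]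
      · have := hper (latL lam hlam (0, b))
        simp only [latL_apply] at this ⊢
        rw [← this]; simp [add_comm]
      · exact (hcont.comp ((latL lam hlam).continuous.comp (by fun_prop))).intervalIntegrable _ _
    simp [this]
  · rw [Measure.prod_restrict]
    exact ((hcont.comp (latL lam hlam).continuous).continuousOn.integrableOn_compact
      (isCompact_Icc.prod isCompact_Icc)).mono_set
        (prod_mono Ioo_subset_Icc_self Ioo_subset_Icc_self)

lemma mem_lattice_zero : lam 0 ∈ lattice lam := ⟨1, 0, by simp⟩
lemma mem_lattice_one : lam 1 ∈ lattice lam := ⟨0, 1, by simp⟩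

/-- Integration by parts on a periodicity cell has no boundary terms. -/
lemma integral_cell_fderiv (hlam : LinearIndependent ℝ lam) {h : V2 → ℝ}
    (hh : ContDiff ℝ 1 h) (hper : ∀ v ∈ lattice lam, ∀ p, h (p + v) = h p) (v : V2) :
    ∫ p in cell lam, fderiv ℝ h p v = 0 := by
  have h0 := integral_cell_deriv_lattice hlam hh (hper _ mem_lattice_zero)
  -- the second lattice direction, by exchanging the two generators
  have h1 := integral_cell_deriv_lattice (lam := fun i => lam (Equiv.swap 0 1 i))
    (hlam.comp _ (Equiv.swap 0 1).injective) hh (by simpa using hper _ mem_lattice_one)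
  rw [cell_swap] at h1
  have hv := latL_apply lam hlam ((latL lam hlam).symm v)
  rw [ContinuousLinearEquiv.apply_symm_apply] at hv
  rw [hv]
  have hcont : ∀ w, Continuous fun p => fderiv ℝ h p w := fun w =>
    (hh.continuous_fderiv (by norm_num)).clm_apply continuous_const
  simp only [map_add, map_smul, smul_eq_mul]
  rw [integral_add ((integrableOn_cell (hcont _)).const_mul _)
    ((integrableOn_cell (hcont _)).const_mul _), integral_const_mul, integral_const_mul, h0]
  simp only [Equiv.swap_apply_left] at h1
  rw [h1]; simp

/-! ### Fubini and the divergence theorem on a cell of the slab -/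

lemma integral_slabCell {f : V3 → ℝ} (hf : Continuous f) :
    ∫ x in slabCell lam d, f x = ∫ p in cell lam, ∫ z in Ioo (-d) 0, f (lift p z) := by
  rw [slabCell_eq, measurePreserving_lift.setIntegral_image_emb
    liftL.toHomeomorph.measurableEmbedding, Measure.volume_eq_prod, setIntegral_prod]
  exact ((hf.comp continuous_lift).continuousOn.integrableOn_compact
      (isCompact_closedCell.prod isCompact_Icc)).mono_set
        (prod_mono cell_subset Ioo_subset_Icc_self)

lemma integral_slabCell_symm {f : V3 → ℝ} (hf : Continuous f) :
    ∫ x in slabCell lam d, f x = ∫ z in Ioo (-d) 0, ∫ p in cell lam, f (lift p z) := by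
  rw [slabCell_eq, measurePreserving_lift.setIntegral_image_emb
    liftL.toHomeomorph.measurableEmbedding, Measure.volume_eq_prod, ← Measure.prod_restrict, integral_prod_symm]
  rw [Measure.prod_restrict]
  exact ((hf.comp continuous_lift).continuousOn.integrableOn_compact
      (isCompact_closedCell.prod isCompact_Icc)).mono_set
        (prod_mono cell_subset Ioo_subset_Icc_self)

/-- Divergence theorem for periodic vector fields on the slab; the lateral fluxes cancel. -/
lemma integral_div_slabCell (hlam : LinearIndependent ℝ lam) (hd : 0 < d) {Z : V3 → V3}
    (hZ : ContDiff ℝ 1 Z) (hper : IsPer lam Z) :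
    ∫ x in slabCell lam d, div Z x =
      ∫ p in cell lam, (Z (lift p 0) 2 - Z (lift p (-d)) 2) := by
  have one : (1 : WithTop ℕ∞) ≠ 0 := by norm_num
  have hc : ∀ i j, Continuous fun x => pd i Z x j := fun i j =>
    (contDiff_coord (contDiff_pd hZ (m := 0) (by norm_num) i) j).continuous
  have hcoord : ∀ j, ContDiff ℝ 1 fun x => Z x j := fun j => contDiff_coord hZ j
  -- horizontal derivatives of periodic functions do not contribute
  have hor0 : ∀ (v : V2) (j : Fin 3),
      ∫ x in slabCell lam d, fderiv ℝ (fun y => Z y j) x (lift v 0) = 0 := by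
    intro v j
    rw [integral_slabCell_symm (((hcoord j).continuous_fderiv one).clm_apply continuous_const)]
    have : ∀ z, ∫ p in cell lam, fderiv ℝ (fun y => Z y j) (lift p z) (lift v 0) = 0 := by
      intro z
      refine Eq.trans ?_ (integral_cell_fderiv hlam (h := fun p => Z (lift p z) j)
        ((hcoord j).comp (contDiff_lift z)) (fun w hw p => by
          rw [lift_add_zero, hper w hw]) v)
      congr 1; funext p
      have := ((hcoord j).differentiable one (lift p z)).hasFDerivAt.comp p (hasFDerivAt_lift p z)
      rw [show fderiv ℝ (fun p => Z (lift p z) j) p = _ from this.fderiv]; rfl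
    simp [this]
  have hpd : ∀ i j x, pd i Z x j = fderiv ℝ (fun y => Z y j) x (e3 i) := fun i j x =>
    pd_apply_coord i (hZ.differentiable one x) j
  simp only [div_eq]
  have hi := fun i => integrableOn_slabCell (lam := lam) (d := d) (hc i i)
  have hsum : ∫ x in slabCell lam d, pd 0 Z x 0 + pd 1 Z x 1 + pd 2 Z x 2 =
      (∫ x in slabCell lam d, pd 0 Z x 0) + (∫ x in slabCell lam d, pd 1 Z x 1) +
        ∫ x in slabCell lam d, pd 2 Z x 2 := by
    rw [← integral_add (hi 0) (hi 1)]
    exact integral_add ((hi 0).add (hi 1)) (hi 2)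
  rw [hsum]
  have e0 : ∫ x in slabCell lam d, pd 0 Z x 0 = 0 := by
    simp only [hpd, ← lift_single_zero]; exact hor0 _ _
  have e1 : ∫ x in slabCell lam d, pd 1 Z x 1 = 0 := by
    simp only [hpd, ← lift_single_one]; exact hor0 _ _
  rw [e0, e1, integral_slabCell (hc _ _), zero_add, zero_add]
  congr 1; funext p
  rw [← integral_Ioc_eq_integral_Ioo, ← intervalIntegral.integral_of_le (by linarith)]
  have hd : ∀ z ∈ uIcc (-d) 0, HasDerivAt (fun z => Z (lift p z) 2) (pd 2 Z (lift p z) 2) z := by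
    intro z _
    rw [hpd]
    exact ((hcoord 2).differentiable one _).hasFDerivAt.comp_hasDerivAt z (hasDerivAt_lift p z)
  rw [intervalIntegral.integral_eq_sub_of_hasDerivAt hd]
  exact ((hc 2 2).comp (continuous_lift.comp
    (continuous_const.prodMk continuous_id))).intervalIntegrable _ _

variable {lam : Fin 2 → V2} {d γ : ℝ} {F : V3 → V3}

/-! ### Elementary consequences of membership in `M_per` -/

lemma MemMper.contDiff (hF : MemMper lam d γ F) : ContDiff ℝ 3 F := hF.mem_holder.1

lemma MemMper.injective (hF : MemMper lam d γ F) : Function.Injective F := by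
  obtain ⟨G, hG, -⟩ := hF.diffeo; exact hG.injective

lemma MemMper.differentiable (hF : MemMper lam d γ F) : Differentiable ℝ F :=
  hF.contDiff.differentiable (by norm_num)

lemma fderiv_periodic {E : Type*} [NormedAddCommGroup E] [NormedSpace ℝ E] {f : V3 → E} {v : V3}
    {c : E} (h : ∀ x, f (x + v) = f x + c) (x : V3) : fderiv ℝ f (x + v) = fderiv ℝ f x := by
  rw [← fderiv_comp_add_right]
  simp only [h, fderiv_add_const]

/-- Partial derivatives of a map that is periodic up to an additive constant are periodic. -/
lemma pd_periodic {f : V3 → V3} {v : V3} {c : V3} (h : ∀ x, f (x + v) = f x + c) (i : Fin 3)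
    (x : V3) : pd i f (x + v) = pd i f x := by
  simp only [pd, fderiv_periodic h]

lemma IsPer.pd {f : V3 → V3} (h : IsPer lam f) (i : Fin 3) : IsPer lam (pd i f) :=
  fun v hv x => pd_periodic (c := 0) (by simpa using h v hv) i x

lemma IsPer.curl {f : V3 → V3} (h : IsPer lam f) : IsPer lam (curl f) := by
  intro v hv x
  apply V3.ext' <;> simp [h.pd _ v hv x]

lemma pd_lift_top {f : V3 → V3} {p : V2} {z : ℝ} (hf : DifferentiableAt ℝ f (lift p z)) (v : V2) :
    fderiv ℝ (fun q => f (lift q z)) p v = fderiv ℝ f (lift p z) (lift v 0) := by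
  have h := hf.hasFDerivAt.comp p (hasFDerivAt_lift p z)
  rw [show fderiv ℝ (fun q => f (lift q z)) p = _ from h.fderiv]; rfl

lemma pdS_surf_zero {f : V3 → V3} {p : V2} (hf : DifferentiableAt ℝ f (lift p 0)) :
    pdS 0 (surf f) p = pd 0 f (lift p 0) := by
  rw [pdS, pd]; change fderiv ℝ (fun q => f (lift q 0)) p _ = _
  rw [pd_lift_top hf, lift_single_zero]

lemma pdS_surf_one {f : V3 → V3} {p : V2} (hf : DifferentiableAt ℝ f (lift p 0)) :
    pdS 1 (surf f) p = pd 1 f (lift p 0) := by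
  rw [pdS, pd]; change fderiv ℝ (fun q => f (lift q 0)) p _ = _
  rw [pd_lift_top hf, lift_single_one]

/-- Since `F` fixes the bottom pointwise, its derivative there is the identity on horizontal
vectors. -/
lemma MemMper.fderiv_bottom (hF : MemMper lam d γ F) (p v : V2) :
    fderiv ℝ F (lift p (-d)) (lift v 0) = lift v 0 := by
  rw [← pd_lift_top (hF.differentiable _)]
  simp only [hF.bottom]
  rw [(hasFDerivAt_lift p (-d)).fderiv]; rfl

lemma MemMper.surfCross_eq (hF : MemMper lam d γ F) (p : V2) :
    surfCross F p = cross (pd 0 F (lift p 0)) (pd 1 F (lift p 0)) := by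
  rw [surfCross, pdS_surf_zero (hF.differentiable _), pdS_surf_one (hF.differentiable _)]

/-- The free surface is regular: `S_X` and `S_Y` are two columns of the invertible matrix `DF`. -/
lemma MemMper.surfCross_ne_zero (hF : MemMper lam d γ F) (p : V2) : surfCross F p ≠ 0 := by
  intro h
  have hp := hF.det_pos (lift p 0)
  rw [det_eq_triple] at hp
  rw [hF.surfCross_eq] at h
  have h0 := congr_arg (fun v : V3 => v 0) h
  have h1 := congr_arg (fun v : V3 => v 1) h
  have h2 := congr_arg (fun v : V3 => v 2) h
  simp only [cross_zero_coord, cross_one_coord, cross_two_coord, PiLp.zero_apply, pd] at h0 h1 h2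
  refine hp.ne' ?_
  simp only [inner_eq, cross_zero_coord, cross_one_coord, cross_two_coord]
  linear_combination (fderiv ℝ F (lift p 0) (e3 2) 0) * h0 + (fderiv ℝ F (lift p 0) (e3 2) 1) * h1
    + (fderiv ℝ F (lift p 0) (e3 2) 2) * h2

/-! ### The Piola transform and the divergence theorem -/

/-- The Piola transform `adj(DF) X` of a vector field `X` given along `F`. -/
noncomputable def piola (F X : V3 → V3) (x : V3) : V3 :=
  !₂[inner ℝ (X x) (cross (pd 1 F x) (pd 2 F x)), inner ℝ (X x) (cross (pd 2 F x) (pd 0 F x)),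
    inner ℝ (X x) (cross (pd 0 F x) (pd 1 F x))]

lemma contDiff_piola {X : V3 → V3} (hF : ContDiff ℝ 2 F) (hX : ContDiff ℝ 1 X) :
    ContDiff ℝ 1 (piola F X) := by
  have h : ∀ i, ContDiff ℝ 1 (pd i F) := contDiff_pd hF (by norm_num)
  exact contDiff_vec3 (contDiff_inner3 hX (contDiff_cross (h 1) (h 2)))
    (contDiff_inner3 hX (contDiff_cross (h 2) (h 0)))
    (contDiff_inner3 hX (contDiff_cross (h 0) (h 1)))

lemma pd_comp {V : V3 → V3} {x : V3} (hV : DifferentiableAt ℝ V (F x))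
    (hF : DifferentiableAt ℝ F x) (i : Fin 3) :
    pd i (fun y => V (F y)) x =
      pd i F x 0 • pd 0 V (F x) + pd i F x 1 • pd 1 V (F x) + pd i F x 2 • pd 2 V (F x) := by
  have h := hV.hasFDerivAt.comp x hF.hasFDerivAt
  rw [pd, show fderiv ℝ (fun y => V (F y)) x = _ from h.fderiv]
  exact clm_apply_eq_sum (fderiv ℝ V (F x)) (fderiv ℝ F x (e3 i))

/-- The Piola identity: the transform of `V ∘ F` has divergence `det DF · (div V) ∘ F`. It replaces
an integration by parts on the curved fluid cell by one on the flat reference cell. -/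
lemma div_piola {V : V3 → V3} (hF : ContDiff ℝ 2 F) (hV : ContDiff ℝ 1 V) (x : V3) :
    div (piola F (fun y => V (F y))) x = (fderiv ℝ F x).det * div V (F x) := by
  have one : (1 : WithTop ℕ∞) ≠ 0 := by norm_num
  have hX : ContDiff ℝ 1 (fun y => V (F y)) := hV.comp (hF.of_le (by norm_num))
  have dX := hX.differentiable one x
  have dF : ∀ i, DifferentiableAt ℝ (pd i F) x := fun i =>
    (contDiff_pd hF (m := 1) (by norm_num) i).differentiable one x
  have dc : ∀ i j, DifferentiableAt ℝ (fun y => cross (pd i F y) (pd j F y)) x := fun i j =>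
    (crossL.hasFDerivAt_of_bilinear (dF i).hasFDerivAt (dF j).hasFDerivAt).differentiableAt
  have dp := (contDiff_piola hF hX).differentiable one x
  have h0 : pd 0 (piola F (fun y => V (F y))) x 0 =
      pdr 0 (fun y => inner ℝ (V (F y)) (cross (pd 1 F y) (pd 2 F y))) x := pd_apply_coord 0 dp 0
  have h1 : pd 1 (piola F (fun y => V (F y))) x 1 =
      pdr 1 (fun y => inner ℝ (V (F y)) (cross (pd 2 F y) (pd 0 F y))) x := pd_apply_coord 1 dp 1
  have h2 : pd 2 (piola F (fun y => V (F y))) x 2 =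
      pdr 2 (fun y => inner ℝ (V (F y)) (cross (pd 0 F y) (pd 1 F y))) x := pd_apply_coord 2 dp 2
  rw [div_eq, h0, h1, h2, pdr_inner _ dX (dc 1 2), pdr_inner _ dX (dc 2 0), pdr_inner _ dX (dc 0 1),
    pd_cross _ (dF 1) (dF 2), pd_cross _ (dF 2) (dF 0), pd_cross _ (dF 0) (dF 1), det_eq_triple,
    div_eq, pd_pd_comm hF 1 0, pd_pd_comm hF 2 0, pd_pd_comm hF 2 1]
  simp only [pd_comp (hV.differentiable one _) (hF.differentiable (by norm_num) x)]
  change _ = inner ℝ (pd 0 F x) (cross (pd 1 F x) (pd 2 F x)) * _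
  simp only [inner_eq, cross_zero_coord, cross_one_coord, cross_two_coord, PiLp.add_apply,
    PiLp.smul_apply, smul_eq_mul]
  ring

/-- Change of variables for the fluid cell. -/
lemma MemMper.integral_image (hF : MemMper lam d γ F) (hlam : LinearIndependent ℝ lam)
    (f : V3 → ℝ) :
    ∫ x in F '' slabCell lam d, f x = ∫ x in slabCell lam d, (fderiv ℝ F x).det * f (F x) := by
  rw [integral_image_eq_integral_abs_det_fderiv_smul volume (isOpen_slabCell hlam).measurableSet
    (fun x _ => (hF.differentiable x).hasFDerivAt.hasFDerivWithinAt) hF.injective.injOn]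
  simp only [abs_of_pos (hF.det_pos _), smul_eq_mul]

/-- Divergence theorem on a fluid cell, for periodic vector fields, written on the reference cell:
the vector `surfCross F` is the outward normal of the free surface times the area element. -/
lemma MemMper.integral_div (hF : MemMper lam d γ F) (hlam : LinearIndependent ℝ lam) (hd : 0 < d)
    {V : V3 → V3} (hV : ContDiff ℝ 1 V) (hper : IsPer lam V) :
    ∫ x in slabCell lam d, (fderiv ℝ F x).det * div V (F x) =
      ∫ p in cell lam, (inner ℝ (V (surf F p)) (surfCross F p) - V (lift p (-d)) 2) := by
  have hF2 : ContDiff ℝ 2 F := hF.contDiff.of_le (by norm_num)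
  have hX : ContDiff ℝ 1 (fun y => V (F y)) := hV.comp (hF2.of_le (by norm_num))
  simp only [← div_piola hF2 hV]
  rw [integral_div_slabCell hlam hd (contDiff_piola hF2 hX)]
  · congr 1; funext p
    rw [hF.surfCross_eq]
    congr 1
    -- at the bottom the flux of the Piola transform is the vertical component of `V`
    have h0 : pd 0 F (lift p (-d)) = e3 0 := by
      have := hF.fderiv_bottom p (EuclideanSpace.single 0 1)
      rwa [lift_single_zero] at this
    have h1 : pd 1 F (lift p (-d)) = e3 1 := by
      have := hF.fderiv_bottom p (EuclideanSpace.single 1 1)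
      rwa [lift_single_one] at this
    simp [piola, h0, h1, hF.bottom, inner_eq]
  · intro v hv x
    simp only [piola, pd_periodic (hF.periodic v hv), hF.periodic v hv, hper v hv]

/-! ### Differentiation of integrals along curves -/

/-- Uniform Lipschitz continuity at `0` of the curve `s ↦ ξ s`, together with boundedness of `ξ 0`,
on the set `S` of parameters. -/
def LipAtZero {X E : Type*} [NormedAddCommGroup E] (S : Set X) (ξ : ℝ → X → E) : Prop :=
  (∃ C, ∀ᶠ s in 𝓝 (0 : ℝ), ∀ x ∈ S, ‖ξ s x - ξ 0 x‖ ≤ C * |s|) ∧ ∃ R, ∀ x ∈ S, ‖ξ 0 x‖ ≤ R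

lemma LipAtZero.prodMk {X E E' : Type*} [NormedAddCommGroup E] [NormedAddCommGroup E'] {S : Set X}
    {ξ : ℝ → X → E} {η : ℝ → X → E'} (h : LipAtZero S ξ) (k : LipAtZero S η) :
    LipAtZero S (fun s x => (ξ s x, η s x)) := by
  obtain ⟨⟨C, hC⟩, R, hR⟩ := h
  obtain ⟨⟨C', hC'⟩, R', hR'⟩ := k
  refine ⟨⟨max C C', ?_⟩, max R R', fun x hx => ?_⟩
  · filter_upwards [hC, hC'] with s h1 h2 x hx
    rw [Prod.mk_sub_mk, Prod.norm_mk]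
    refine max_le ((h1 x hx).trans ?_) ((h2 x hx).trans ?_) <;> gcongr
    exacts [le_max_left _ _, le_max_right _ _]
  · rw [Prod.norm_mk]
    exact max_le_max (hR x hx) (hR' x hx)

/-- A curve that is Lipschitz at `0` stays in a fixed compact set near `0`, where `Q` is
Lipschitz. -/
lemma LipAtZero.comp {X E E' : Type*} [NormedAddCommGroup E] [NormedSpace ℝ E]
    [FiniteDimensional ℝ E] [NormedAddCommGroup E'] {S : Set X}
    {ξ : ℝ → X → E} (h : LipAtZero S ξ) {Q : E → E'} (hQ : LocallyLipschitz Q) :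
    LipAtZero S (fun s x => Q (ξ s x)) := by
  obtain ⟨⟨C, hC⟩, R, hR⟩ := h
  have := FiniteDimensional.proper ℝ E
  obtain ⟨K, hK⟩ := LocallyLipschitzOn.exists_lipschitzOnWith_of_compact
    (isCompact_closedBall (0 : E) (R + 1)) hQ.locallyLipschitzOn
  refine ⟨⟨K * C, ?_⟩, ?_⟩
  · have h1 : ∀ᶠ s in 𝓝 (0 : ℝ), C * |s| < 1 := by
      have : Tendsto (fun s : ℝ => C * |s|) (𝓝 0) (𝓝 (C * |0|)) :=
        (continuous_const.mul continuous_abs).continuousAt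
      rw [abs_zero, mul_zero] at this
      exact this.eventually (gt_mem_nhds one_pos)
    filter_upwards [hC, h1] with s hs hs1 x hx
    have hb := hs x hx
    have m0 : ξ 0 x ∈ Metric.closedBall (0 : E) (R + 1) := by
      rw [mem_closedBall_zero_iff]; linarith [hR x hx]
    have m1 : ξ s x ∈ Metric.closedBall (0 : E) (R + 1) := by
      rw [mem_closedBall_zero_iff]
      calc ‖ξ s x‖ = ‖(ξ s x - ξ 0 x) + ξ 0 x‖ := by simp
        _ ≤ ‖ξ s x - ξ 0 x‖ + ‖ξ 0 x‖ := norm_add_le _ _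
        _ ≤ R + 1 := by linarith [hR x hx]
    have := hK.dist_le_mul _ m1 _ m0
    rw [dist_eq_norm, dist_eq_norm] at this
    refine this.trans ?_
    rw [mul_assoc]; gcongr
  · obtain ⟨M, hM⟩ := ((isCompact_closedBall (0 : E) (R + 1)).image_of_continuousOn
      hQ.continuous.continuousOn).isBounded.exists_norm_le
    refine ⟨M, fun x hx => hM _ ⟨_, ?_, rfl⟩⟩
    rw [mem_closedBall_zero_iff]; linarith [hR x hx]

/-- Differentiation under the integral sign at `0`. Only the derivative at the point `0` is assumed
to exist; the Lipschitz bound at `0` provides the dominating constant. -/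
lemma hasDerivAt_setIntegral_of_lipAtZero {X : Type*} [MeasurableSpace X] {ν : Measure X}
    {S : Set X} (hS : MeasurableSet S) (hfin : ν S ≠ ⊤) {f : ℝ → X → ℝ} {f' : X → ℝ}
    (hmeas : ∀ᶠ s in 𝓝 (0 : ℝ), AEStronglyMeasurable (f s) (ν.restrict S))
    (hlip : LipAtZero S f) (hder : ∀ x ∈ S, HasDerivAt (fun s => f s x) (f' x) 0) :
    HasDerivAt (fun s => ∫ x in S, f s x ∂ν) (∫ x in S, f' x ∂ν) 0 := by
  obtain ⟨⟨C, hC⟩, R, hR⟩ := hlip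
  have : IsFiniteMeasure (ν.restrict S) := ⟨by simpa using hfin.lt_top⟩
  have hm0 := hmeas.self_of_nhds
  have hf'm : AEStronglyMeasurable f' (ν.restrict S) := by
    -- `f'` is measurable as a pointwise limit of difference quotients
    obtain ⟨u, hu⟩ : ∃ u : ℕ → ℝ, Tendsto u atTop (𝓝[≠] 0) := exists_seq_tendsto _
    have hu' : ∀ᶠ n in atTop, AEStronglyMeasurable (f (u n)) (ν.restrict S) :=
      (hu.mono_right nhdsWithin_le_nhds).eventually hmeas
    obtain ⟨N, hN⟩ := eventually_atTop.1 hu'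
    refine aestronglyMeasurable_of_tendsto_ae (f := fun n x => (u (n + N))⁻¹ • (f (u (n + N)) x - f 0 x))
      atTop (fun n => ((hN (n + N) (Nat.le_add_left N n)).sub hm0).const_smul (u (n + N))⁻¹) ?_
    filter_upwards [ae_restrict_mem hS] with x hx
    have := hasDerivAt_iff_tendsto_slope_zero.1 (hder x hx)
    simp only [zero_add] at this
    exact this.comp (hu.comp (tendsto_add_atTop_nat N))
  have key := hasFDerivAt_integral_of_dominated_loc_of_lip' (μ := ν.restrict S) (F := f)
    (F' := fun x => ContinuousLinearMap.toSpanSingleton ℝ (f' x)) (bound := fun _ => C)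
    (hmeas.and hC) (fun s hs => hs.1)
    (Integrable.of_bound hm0 R ((ae_restrict_mem hS).mono fun x hx => hR x hx))
    ((ContinuousLinearMap.toSpanSingletonCLE (𝕜 := ℝ) (E := ℝ)).continuous.comp_aestronglyMeasurable hf'm)
    ((ae_restrict_mem hS).mono fun x hx s hs => by simpa using hs.2 x hx)
    (integrable_const _)
    ((ae_restrict_mem hS).mono fun x hx => (hder x hx).hasFDerivAt)
  have h2 := key.2.hasDerivAt
  rw [ContinuousLinearMap.integral_apply key.1] at h2
  simpa using h2

/-- Uniform convergence of the difference quotients at `0`. -/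
def UnifDiffAtZero {X E : Type*} [NormedAddCommGroup E] [NormedSpace ℝ E] (K : Set X)
    (f : ℝ → X → E) (f' : X → E) : Prop :=
  ∀ ε > 0, ∀ᶠ s in 𝓝[≠] (0 : ℝ), ∀ y ∈ K, ‖s⁻¹ • (f s y - f 0 y) - f' y‖ ≤ ε

section unif
variable {X E : Type*} [NormedAddCommGroup E] [NormedSpace ℝ E] {K : Set X}
  {f : ℝ → X → E} {f' : X → E}

lemma UnifDiffAtZero.hasDerivAt (h : UnifDiffAtZero K f f') {y : X} (hy : y ∈ K) :
    HasDerivAt (fun s => f s y) (f' y) 0 := by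
  rw [hasDerivAt_iff_tendsto_slope_zero]
  simp only [zero_add]
  rw [Metric.tendsto_nhds]
  intro ε hε
  filter_upwards [h (ε / 2) (by linarith)] with s hs
  rw [dist_eq_norm]
  linarith [hs y hy]

lemma UnifDiffAtZero.lip (h : UnifDiffAtZero K f f') {M : ℝ} (hM : ∀ y ∈ K, ‖f' y‖ ≤ M) :
    ∀ᶠ s in 𝓝 (0 : ℝ), ∀ y ∈ K, ‖f s y - f 0 y‖ ≤ (M + 1) * |s| := by
  have h1 := h 1 one_pos
  rw [eventually_nhdsWithin_iff] at h1
  filter_upwards [h1] with s hs y hy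
  by_cases h0 : s = 0
  · simp [h0]
  have h2 := hs h0 y hy
  have h3 : ‖s⁻¹ • (f s y - f 0 y)‖ ≤ M + 1 := by
    calc _ = ‖(s⁻¹ • (f s y - f 0 y) - f' y) + f' y‖ := by simp
      _ ≤ _ := norm_add_le _ _
      _ ≤ M + 1 := by linarith [hM y hy]
  rw [norm_smul, norm_inv, Real.norm_eq_abs] at h3
  have hp : 0 < |s| := abs_pos.2 h0
  rwa [inv_mul_le_iff₀ hp, mul_comm] at h3

lemma UnifDiffAtZero.clm_comp {E' : Type*} [NormedAddCommGroup E'] [NormedSpace ℝ E']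
    (h : UnifDiffAtZero K f f') (L : E →L[ℝ] E') :
    UnifDiffAtZero K (fun s y => L (f s y)) (fun y => L (f' y)) := by
  intro ε hε
  filter_upwards [h (ε / (‖L‖ + 1)) (by positivity)] with s hs y hy
  rw [← map_sub, ← map_smul, ← map_sub]
  refine (L.le_opNorm _).trans ?_
  calc ‖L‖ * _ ≤ (‖L‖ + 1) * (ε / (‖L‖ + 1)) := by
        gcongr
        · linarith
        · exact hs y hy
    _ = ε := by field_simp

end unif

/-- Chain rule for a uniformly differentiable curve of maps, evaluated along a curve of points. -/
lemma UnifDiffAtZero.hasDerivAt_comp {E : Type*} [NormedAddCommGroup E] [NormedSpace ℝ E]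
    {f : ℝ → V3 → E} {f' : V3 → E} (h : UnifDiffAtZero univ f f') {y : ℝ → V3} {y' : V3}
    (hf' : ContinuousAt f' (y 0)) (hf : DifferentiableAt ℝ (f 0) (y 0)) (hy : HasDerivAt y y' 0) :
    HasDerivAt (fun s => f s (y s)) (f' (y 0) + fderiv ℝ (f 0) (y 0) y') 0 := by
  -- uniformity permits evaluating the difference quotient at the moving point `y s`
  have h1 : HasDerivAt (fun s => f s (y s) - f 0 (y s)) (f' (y 0)) 0 := by
    rw [hasDerivAt_iff_tendsto_slope_zero]
    simp only [zero_add, sub_self, sub_zero]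
    have h2 : Tendsto (fun s => f' (y s)) (𝓝[≠] 0) (𝓝 (f' (y 0))) :=
      (hf'.tendsto.comp hy.continuousAt.tendsto).mono_left nhdsWithin_le_nhds
    have h3 : Tendsto (fun s => s⁻¹ • (f s (y s) - f 0 (y s)) - f' (y s)) (𝓝[≠] 0) (𝓝 0) := by
      rw [Metric.tendsto_nhds]
      intro ε hε
      filter_upwards [h (ε / 2) (by linarith)] with s hs
      rw [dist_eq_norm, sub_zero]
      linarith [hs (y s) (mem_univ _)]
    simpa using h3.add h2
  have h2 := hf.hasFDerivAt.comp_hasDerivAt (0 : ℝ) hy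
  refine (h1.add h2).congr_of_eventuallyEq (Eventually.of_forall fun s => ?_)
  simp

/-- A uniformly differentiable curve of maps `f s`, evaluated along a Lipschitz curve of points.
Used for `A(s) ∘ F(s)` and `DA(s) ∘ F(s)`. -/
lemma LipAtZero.comp_curve {X E : Type*} [NormedAddCommGroup E] [NormedSpace ℝ E] {S : Set X}
    {f : ℝ → V3 → E} {f' : V3 → E} (h : UnifDiffAtZero univ f f') {M L : ℝ}
    (hM : ∀ y, ‖f' y‖ ≤ M) (hf : Differentiable ℝ (f 0)) (hL : ∀ y, ‖fderiv ℝ (f 0) y‖ ≤ L)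
    (hb : ∃ R, ∀ y, ‖f 0 y‖ ≤ R)
    {Y : ℝ → X → V3} (hY : LipAtZero S Y) : LipAtZero S (fun s x => f s (Y s x)) := by
  obtain ⟨⟨C, hC⟩, -⟩ := hY
  obtain ⟨R, hR⟩ := hb
  refine ⟨⟨(M + 1) + L * C, ?_⟩, R, fun x _ => hR _⟩
  have hL0 : 0 ≤ L := (norm_nonneg _).trans (hL 0)
  filter_upwards [h.lip (fun y _ => hM y), hC] with s h1 h2 x hx
  have h3 : ‖f 0 (Y s x) - f 0 (Y 0 x)‖ ≤ L * ‖Y s x - Y 0 x‖ :=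
    Convex.norm_image_sub_le_of_norm_fderiv_le (fun z _ => hf z) (fun z _ => hL z) convex_univ
      (mem_univ _) (mem_univ _)
  calc ‖f s (Y s x) - f 0 (Y 0 x)‖
      = ‖(f s (Y s x) - f 0 (Y s x)) + (f 0 (Y s x) - f 0 (Y 0 x))‖ := by congr 1; abel
    _ ≤ _ := norm_add_le _ _
    _ ≤ (M + 1) * |s| + L * (C * |s|) := by
        refine add_le_add (h1 _ (mem_univ _)) (h3.trans ?_)
        gcongr; exact h2 x hx
    _ = _ := by ring

/-! ### Hölder derivatives give uniform derivatives -/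

lemma HolderHasDerivAt.unif_zero {k : ℕ} {γ : ℝ} {K : Set V3} {f : ℝ → V3 → V3} {f' : V3 → V3}
    (h : HolderHasDerivAt k γ K f f' 0) : UnifDiffAtZero K f f' := by
  intro ε hε
  filter_upwards [h ε hε] with s hs y hy
  have := (hs 0 (Nat.zero_le _)).1 y hy
  rwa [norm_iteratedFDeriv_zero, sub_zero] at this

lemma HolderHasDerivAt.unif_one {k : ℕ} (hk : 1 ≤ k) {γ : ℝ} {K : Set V3} {f : ℝ → V3 → V3}
    {f' : V3 → V3} (h : HolderHasDerivAt k γ K f f' 0) (hf : ∀ᶠ s in 𝓝 0, Differentiable ℝ (f s))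
    (hf' : Differentiable ℝ f') :
    UnifDiffAtZero K (fun s => fderiv ℝ (f s)) (fderiv ℝ f') := by
  intro ε hε
  filter_upwards [h ε hε, hf.filter_mono nhdsWithin_le_nhds] with s hs hd y hy
  have := (hs 1 hk).1 y hy
  rw [norm_iteratedFDeriv_one, sub_zero] at this
  have h0 := hf.self_of_nhds
  rwa [fderiv_fun_sub (((hd y).fun_sub (h0 y)).fun_const_smul _) (hf' y),
    fderiv_fun_const_smul ((hd y).fun_sub (h0 y)), fderiv_fun_sub (hd y) (h0 y)] at this

/-! ### First-order data of an admissible curve -/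

/-- The curl as a linear function of the derivative. -/
noncomputable def curlL : (V3 →L[ℝ] V3) →L[ℝ] V3 :=
  LinearMap.toContinuousLinearMap
  { toFun := fun L => !₂[L (e3 1) 2 - L (e3 2) 1, L (e3 2) 0 - L (e3 0) 2, L (e3 0) 1 - L (e3 1) 0]
    map_add' := fun a b => by apply V3.ext' <;> simp <;> ring
    map_smul' := fun a b => by apply V3.ext' <;> simp <;> ring }

lemma curlL_fderiv (A : V3 → V3) (x : V3) : curlL (fderiv ℝ A x) = curl A x := rfl

/-- First-order data at `s = 0` of an admissible curve `(Ac s, Fc s)`: the derivatives of `Ac` and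
`Fc` at `0` are `A'` and `w`, uniformly together with their first space derivatives. -/
structure IsVariation (lam : Fin 2 → V2) (d γ m₁ m₂ : ℝ) (Ac Fc : ℝ → V3 → V3) (A' w : V3 → V3) :
    Prop where
  pair : ∀ᶠ s in 𝓝 0, AdmissiblePair lam d γ m₁ m₂ (Ac s) (Fc s)
  contDiff_A' : ContDiff ℝ 1 A'
  bdd_A' : ∃ C, ∀ x, ‖A' x‖ ≤ C
  bdd_fderiv_A' : ∃ C, ∀ x, ‖fderiv ℝ A' x‖ ≤ C
  contDiff_w : ContDiff ℝ 3 w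
  A_zero : UnifDiffAtZero univ Ac A'
  A_one : UnifDiffAtZero univ (fun s => fderiv ℝ (Ac s)) (fderiv ℝ A')
  F_zero : ∀ R, UnifDiffAtZero (Metric.closedBall 0 R) Fc w
  F_one : ∀ R, UnifDiffAtZero (Metric.closedBall 0 R) (fun s => fderiv ℝ (Fc s)) (fderiv ℝ w)

/-- The fields in `C^{k,γ}` are bounded together with their derivatives; here for order zero. -/
lemma MemHolder.bdd {k : ℕ} {γ : ℝ} {f : V3 → V3} (h : MemHolder k γ f) : ∃ C, ∀ x, ‖f x‖ ≤ C := by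
  obtain ⟨-, C, hC⟩ := h
  refine ⟨C, fun x => ?_⟩
  have := (hC 0 (Nat.zero_le _)).1 x (mem_univ _)
  rwa [norm_iteratedFDeriv_zero] at this

lemma MemHolder.bdd_fderiv {k : ℕ} (hk : 1 ≤ k) {γ : ℝ} {f : V3 → V3} (h : MemHolder k γ f) :
    ∃ C, ∀ x, ‖fderiv ℝ f x‖ ≤ C := by
  obtain ⟨-, C, hC⟩ := h
  refine ⟨C, fun x => ?_⟩
  have := (hC 1 hk).1 x (mem_univ _)
  rwa [norm_iteratedFDeriv_one] at this

lemma MemHolder.bdd_fderiv_fderiv {k : ℕ} (hk : 2 ≤ k) {γ : ℝ} {f : V3 → V3}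
    (h : MemHolder k γ f) : ∃ C, ∀ x, ‖fderiv ℝ (fderiv ℝ f) x‖ ≤ C := by
  obtain ⟨-, C, hC⟩ := h
  refine ⟨C, fun x => ?_⟩
  have := (hC 2 hk).1 x (mem_univ _)
  rwa [← norm_iteratedFDeriv_fderiv, norm_iteratedFDeriv_one] at this

variable {lam : Fin 2 → V2} {d γ γ' m₁ m₂ δ : ℝ} {Ac Fc : ℝ → V3 → V3} {A' w : V3 → V3}

lemma AdmissibleCurve.exists_isVariation (hδ : 0 < δ)
    (h : AdmissibleCurve lam d γ γ' m₁ m₂ δ Ac Fc) :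
    ∃ A' w, IsVariation lam d γ m₁ m₂ Ac Fc A' w := by
  have h0 : (0 : ℝ) ∈ Ioo (-δ) δ := ⟨by linarith, hδ⟩
  obtain ⟨A', hA', hAd⟩ := h.A_diff 0 h0
  obtain ⟨F', hF'⟩ := h.F_C1
  obtain ⟨hw, hF⟩ := hF' 0 h0
  have hp : ∀ᶠ s in 𝓝 0, AdmissiblePair lam d γ m₁ m₂ (Ac s) (Fc s) :=
    (isOpen_Ioo.eventually_mem h0).mono fun s hs => h.pair s hs
  refine ⟨A', F' 0, ⟨hp, hA'.1, hA'.bdd, hA'.bdd_fderiv le_rfl, hw.1, hAd.unif_zero,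
    hAd.unif_one le_rfl (hp.mono fun s hs => hs.mem_holder.1.differentiable (by norm_num))
      (hA'.1.differentiable (by norm_num)), fun R => (hF R).1.unif_zero,
    fun R => (hF R).1.unif_one (by norm_num)
      (hp.mono fun s hs => hs.mem_Mper.differentiable)
      (hw.1.differentiable (by norm_num))⟩⟩

namespace IsVariation

variable (h : IsVariation lam d γ m₁ m₂ Ac Fc A' w)
include h

lemma pair_zero : AdmissiblePair lam d γ m₁ m₂ (Ac 0) (Fc 0) := h.pair.self_of_nhds

lemma memMper : MemMper lam d γ (Fc 0) := h.pair_zero.mem_Mper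

lemma contDiff_A : ContDiff ℝ 2 (Ac 0) := h.pair_zero.mem_holder.1

lemma hasDerivAt_A (y : V3) : HasDerivAt (fun s => Ac s y) (A' y) 0 :=
  h.A_zero.hasDerivAt (mem_univ y)

lemma hasDerivAt_F (x : V3) : HasDerivAt (fun s => Fc s x) (w x) 0 :=
  (h.F_zero ‖x‖).hasDerivAt (by simp)

lemma hasDerivAt_DF (x v : V3) :
    HasDerivAt (fun s => fderiv ℝ (Fc s) x v) (fderiv ℝ w x v) 0 :=
  (ContinuousLinearMap.apply ℝ V3 v).hasFDerivAt.comp_hasDerivAt 0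
    ((h.F_one ‖x‖).hasDerivAt (by simp))

/-- Material derivative of the potential along the curve. -/
lemma hasDerivAt_A_F (x : V3) : HasDerivAt (fun s => Ac s (Fc s x))
    (A' (Fc 0 x) + fderiv ℝ (Ac 0) (Fc 0 x) (w x)) 0 :=
  h.A_zero.hasDerivAt_comp h.contDiff_A'.continuous.continuousAt
    (h.contDiff_A.differentiable (by norm_num) _) (h.hasDerivAt_F x)

/-- Material derivative of the velocity field along the curve. -/
lemma hasDerivAt_curl_F (x : V3) : HasDerivAt (fun s => curl (Ac s) (Fc s x))
    (curl A' (Fc 0 x) + fderiv ℝ (curl (Ac 0)) (Fc 0 x) (w x)) 0 :=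
  (h.A_one.clm_comp curlL).hasDerivAt_comp
    (contDiff_curl h.contDiff_A' (m := 0) (by norm_num)).continuous.continuousAt
    ((contDiff_curl h.contDiff_A (m := 1) (by norm_num)).differentiable (by norm_num) _)
    (h.hasDerivAt_F x)

lemma isPer_A' : IsPer lam A' := by
  intro v hv x
  refine (h.hasDerivAt_A (x + lift v 0)).unique ((h.hasDerivAt_A x).congr_of_eventuallyEq ?_)
  filter_upwards [h.pair] with s hs using hs.periodic v hv x

lemma isPer_w : IsPer lam w := by
  intro v hv x
  refine (h.hasDerivAt_F (x + lift v 0)).unique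
    (((h.hasDerivAt_F x).add_const (lift v 0)).congr_of_eventuallyEq ?_)
  filter_upwards [h.pair] with s hs using hs.mem_Mper.periodic v hv x

lemma w_bottom (p : V2) : w (lift p (-d)) = 0 := by
  refine (h.hasDerivAt_F (lift p (-d))).unique
    ((hasDerivAt_const (0 : ℝ) (lift p (-d))).congr_of_eventuallyEq ?_)
  filter_upwards [h.pair] with s hs using hs.mem_Mper.bottom p

end IsVariation

/-! ### Boundary values of an admissible pair -/

/-- The bottom condition `A × (0, 0, -1) = (m₁, m₂, 0)` prescribes the horizontal part of `A`. -/
lemma AdmissiblePair.bottom_coord {A F : V3 → V3} (h : AdmissiblePair lam d γ m₁ m₂ A F) (p : V2) :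
    A (lift p (-d)) 0 = m₂ ∧ A (lift p (-d)) 1 = -m₁ := by
  have := h.bc.2 p
  have h0 := congr_arg (fun v : V3 => v 0) this
  have h1 := congr_arg (fun v : V3 => v 1) this
  simp [normalBot] at h0 h1
  exact ⟨h1, by linarith⟩

lemma inner_eq_zero_of_cross_eq_zero {a N τ : V3} (h : cross a N = 0) (hN : N ≠ 0)
    (hτ : inner ℝ N τ = 0) : inner ℝ a τ = 0 := by
  have hN2 : ‖N‖ ^ 2 ≠ 0 := by positivity
  have h0 := congr_arg (fun v : V3 => v 0) h
  have h1 := congr_arg (fun v : V3 => v 1) h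
  have h2 := congr_arg (fun v : V3 => v 2) h
  simp only [cross_zero_coord, cross_one_coord, cross_two_coord, PiLp.zero_apply] at h0 h1 h2
  rw [norm_sq_eq] at hN2
  rw [inner_eq] at hτ ⊢
  apply (mul_eq_zero.1 _).resolve_left hN2
  linear_combination (a 0 * N 0 + a 1 * N 1 + a 2 * N 2) * hτ
    - (N 1 * τ 2 - N 2 * τ 1) * h0 - (N 2 * τ 0 - N 0 * τ 2) * h1 - (N 0 * τ 1 - N 1 * τ 0) * h2

lemma inner_cross_self_left (a b : V3) : inner ℝ (cross a b) a = 0 := by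
  simp [inner_eq]; ring
lemma inner_cross_self_right (a b : V3) : inner ℝ (cross a b) b = 0 := by
  simp [inner_eq]; ring

/-- The potential is normal to the free surface. -/
lemma AdmissiblePair.top_tangential {A F : V3 → V3} (h : AdmissiblePair lam d γ m₁ m₂ A F)
    (p : V2) :
    inner ℝ (A (surf F p)) (pd 0 F (lift p 0)) = 0 ∧
      inner ℝ (A (surf F p)) (pd 1 F (lift p 0)) = 0 := by
  have h1 := h.bc.1 p
  have hN := h.mem_Mper.surfCross_ne_zero p
  have h2 : cross (A (surf F p)) (surfCross F p) = 0 := by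
    have h3 := (crossL (A (surf F p))).map_smul (‖surfCross F p‖⁻¹) (surfCross F p)
    simp only [crossL_apply] at h3
    rw [normal, h3] at h1
    exact (smul_eq_zero.1 h1).resolve_left (by simpa using hN)
  constructor
  · exact inner_eq_zero_of_cross_eq_zero h2 hN (by
      rw [h.mem_Mper.surfCross_eq]; exact inner_cross_self_left _ _)
  · exact inner_eq_zero_of_cross_eq_zero h2 hN (by
      rw [h.mem_Mper.surfCross_eq]; exact inner_cross_self_right _ _)

/-- The velocity field is tangential to the free surface: differentiating `A · S_X = A · S_Y = 0`
along the surface and subtracting gives `curl A · (S_X × S_Y) = 0`, the second derivatives of `S`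
cancelling by symmetry. -/
lemma AdmissiblePair.curl_surfCross {A F : V3 → V3} (h : AdmissiblePair lam d γ m₁ m₂ A F)
    (p : V2) : inner ℝ (curl A (surf F p)) (surfCross F p) = 0 := by
  have hF := h.mem_Mper
  have hF2 : ContDiff ℝ 2 F := hF.contDiff.of_le (by norm_num)
  have hA : Differentiable ℝ A := h.mem_holder.1.differentiable (by norm_num)
  have dF : ∀ i x, DifferentiableAt ℝ (pd i F) x := fun i x =>
    (contDiff_pd hF2 (m := 1) (by norm_num) i).differentiable (by norm_num) x
  have key : ∀ i (v : V2), (∀ q : V2, inner ℝ (A (surf F q)) (pd i F (lift q 0)) = 0) →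
      inner ℝ (A (surf F p)) (fderiv ℝ (pd i F) (lift p 0) (lift v 0)) +
      inner ℝ (fderiv ℝ A (surf F p) (fderiv ℝ F (lift p 0) (lift v 0))) (pd i F (lift p 0)) = 0 := by
    intro i v hq
    have h1 := ((hA (F (lift p 0))).hasFDerivAt.comp (lift p 0)
      (hF.differentiable (lift p 0)).hasFDerivAt).comp p (hasFDerivAt_lift p 0)
    have h2 := (dF i (lift p 0)).hasFDerivAt.comp p (hasFDerivAt_lift p 0)
    have h3 := h1.inner ℝ h2
    have h4 : HasFDerivAt (fun q : V2 => inner ℝ (A (surf F q)) (pd i F (lift q 0)))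
      (0 : V2 →L[ℝ] ℝ) p := by
      simp only [hq]; exact hasFDerivAt_const _ _
    have h5 := congr_arg (fun L : V2 →L[ℝ] ℝ => L v) (h3.unique h4)
    simpa [surf] using h5
  have k0 := key 0 (EuclideanSpace.single 1 1) fun q => (h.top_tangential q).1
  have k1 := key 1 (EuclideanSpace.single 0 1) fun q => (h.top_tangential q).2
  rw [lift_single_one] at k0
  rw [lift_single_zero] at k1
  have hs : fderiv ℝ (pd 0 F) (lift p 0) (e3 1) = fderiv ℝ (pd 1 F) (lift p 0) (e3 0) :=
    pd_pd_comm hF2 1 0 (lift p 0)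
  rw [hs] at k0
  have h6 := inner_cross_curl A (surf F p) (pd 0 F (lift p 0)) (pd 1 F (lift p 0))
  have h7 : inner ℝ (curl A (surf F p)) (surfCross F p) =
      inner ℝ (cross (curl A (surf F p)) (pd 0 F (lift p 0))) (pd 1 F (lift p 0)) := by
    rw [hF.surfCross_eq]; simp [inner_eq]; ring
  rw [h7, h6]
  simp only [pd] at k0 k1 ⊢
  linarith

/-- The velocity field is tangential to the bottom. -/
lemma AdmissiblePair.curl_bottom {A F : V3 → V3} (h : AdmissiblePair lam d γ m₁ m₂ A F)
    (p : V2) : curl A (lift p (-d)) 2 = 0 := by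
  have hA : Differentiable ℝ A := h.mem_holder.1.differentiable (by norm_num)
  have key : ∀ (j : Fin 3) (v : V2) (c : ℝ), (∀ q : V2, A (lift q (-d)) j = c) →
      fderiv ℝ A (lift p (-d)) (lift v 0) j = 0 := by
    intro j v c hc
    have h1 := (EuclideanSpace.proj j : V3 →L[ℝ] ℝ).hasFDerivAt.comp p
      ((hA (lift p (-d))).hasFDerivAt.comp p (hasFDerivAt_lift p (-d)))
    have h2 : HasFDerivAt (fun q : V2 => A (lift q (-d)) j) (0 : V2 →L[ℝ] ℝ) p := by
      simp only [hc]; exact hasFDerivAt_const _ _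
    simpa using congr_arg (fun L : V2 →L[ℝ] ℝ => L v) (h1.unique h2)
  have k0 := key 1 (EuclideanSpace.single 0 1) _ fun q => (h.bottom_coord q).2
  have k1 := key 0 (EuclideanSpace.single 1 1) _ fun q => (h.bottom_coord q).1
  rw [lift_single_zero] at k0
  rw [lift_single_one] at k1
  simp [pd, k0, k1]

/-- The kinematic condition holds for every admissible pair: the boundary conditions on the
potential imply it. -/
lemma AdmissiblePair.kinematic {A F : V3 → V3} (h : AdmissiblePair lam d γ m₁ m₂ A F) :
    Kinematic d (curl A) F := by
  refine ⟨fun p => ?_, fun p => ?_⟩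
  · rw [normal, inner_smul_right, h.curl_surfCross, mul_zero]
  · have := h.curl_bottom p
    rw [inner_eq]; simp only [normalBot]
    rw [this]; simp

variable {lam : Fin 2 → V2} {d γ γ' m₁ m₂ δ g σ α μ : ℝ} {Ac Fc : ℝ → V3 → V3} {A' w : V3 → V3}

/-! ### The functional on the reference cell -/

/-- Density of the volume part of `J`. -/
noncomputable def density (g α μ : ℝ) (A : V3 → V3) (y : V3) : ℝ :=
  ‖curl A y‖ ^ 2 - 2 * g * y 2 - α * inner ℝ (A y) (curl A y) - μ

lemma contDiff_density {A : V3 → V3} (hA : ContDiff ℝ 2 A) :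
    ContDiff ℝ 1 (density g α μ A) := by
  have hu : ContDiff ℝ 1 (curl A) := contDiff_curl hA (by norm_num)
  exact (((hu.norm_sq ℝ).sub (contDiff_const.mul (contDiff_coord contDiff_id 2))).sub
    (contDiff_const.mul (contDiff_inner3 (hA.of_le (by norm_num)) hu))).sub contDiff_const

lemma continuous_fderiv_det {F : V3 → V3} (hF : ContDiff ℝ 1 F) :
    Continuous fun x => (fderiv ℝ F x).det := by
  simp only [det_eq_triple]
  have h : ∀ i, ContDiff ℝ 0 (fun x => fderiv ℝ F x (e3 i)) := fun i =>
    contDiff_pd hF (by norm_num) i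
  exact (contDiff_inner3 (h 0) (contDiff_cross (h 1) (h 2))).continuous

/-- `J` pulled back to the fixed reference cell, where it can be differentiated under the
integral. -/
lemma AdmissiblePair.functionalJ_eq (hlam : LinearIndependent ℝ lam) {A F : V3 → V3}
    (h : AdmissiblePair lam d γ m₁ m₂ A F) :
    functionalJ lam d g σ α μ A F =
      (∫ x in slabCell lam d, (fderiv ℝ F x).det * density g α μ A (F x)) -
        2 * σ * ∫ p in cell lam, ‖surfCross F p‖ := by
  have hF := h.mem_Mper
  have hA : ContDiff ℝ 2 A := h.mem_holder.1
  have cF : Continuous F := hF.contDiff.continuous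
  have cdet := continuous_fderiv_det (hF.contDiff.of_le (by norm_num) : ContDiff ℝ 1 F)
  have cu : Continuous (curl A) := (contDiff_curl hA (m := 1) (by norm_num)).continuous
  have i1 : IntegrableOn (fun x => (fderiv ℝ F x).det * (‖curl A (F x)‖ ^ 2 - 2 * g * F x 2))
      (slabCell lam d) := integrableOn_slabCell (cdet.mul (((cu.comp cF).norm.pow 2).sub
        (continuous_const.mul (contDiff_coord hF.contDiff 2).continuous)))
  have i2 : IntegrableOn (fun x => (fderiv ℝ F x).det * (inner ℝ (A (F x)) (curl A (F x))))
      (slabCell lam d) := integrableOn_slabCell (cdet.mul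
        ((hA.continuous.comp cF).inner (cu.comp cF)))
  have i3 : IntegrableOn (fun x => (fderiv ℝ F x).det * 1) (slabCell lam d) :=
    integrableOn_slabCell (cdet.mul continuous_const)
  have key : ∫ x in slabCell lam d, (fderiv ℝ F x).det * density g α μ A (F x) =
      (∫ x in slabCell lam d, (fderiv ℝ F x).det * (‖curl A (F x)‖ ^ 2 - 2 * g * F x 2)) -
      α * (∫ x in slabCell lam d, (fderiv ℝ F x).det * (inner ℝ (A (F x)) (curl A (F x)))) -
      μ * ∫ x in slabCell lam d, (fderiv ℝ F x).det * 1 := by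
    rw [← integral_const_mul, ← integral_const_mul]
    refine Eq.trans ?_ ((integral_sub (i1.sub (i2.const_mul α)) (i3.const_mul μ)).trans
      (congr_arg₂ _ (integral_sub i1 (i2.const_mul α)) rfl))
    congr 1; funext x
    simp only [density, Pi.sub_apply]; ring
  rw [key, functionalJ, energy, helicity, fluidVolume, hF.integral_image hlam,
    hF.integral_image hlam, hF.integral_image hlam]
  ring

lemma hasDerivAt_cross {a b : ℝ → V3} {a' b' : V3} {t : ℝ} (ha : HasDerivAt a a' t)
    (hb : HasDerivAt b b' t) :
    HasDerivAt (fun s => cross (a s) (b s)) (cross (a t) b' + cross a' (b t)) t := by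
  simpa using (crossL.hasFDerivAt_of_bilinear ha.hasFDerivAt hb.hasFDerivAt).hasDerivAt

lemma volume_slabCell_ne_top : volume (slabCell lam d) ≠ ⊤ :=
  ((isCompact_closedSlabCell.measure_lt_top).trans_le' (measure_mono slabCell_subset)).ne

lemma volume_cell_ne_top : volume (cell lam) ≠ ⊤ :=
  ((isCompact_closedCell.measure_lt_top).trans_le' (measure_mono cell_subset)).ne

/-! ### Variation of the volume part of the functional -/

namespace IsVariation

variable (h : IsVariation lam d γ m₁ m₂ Ac Fc A' w)
include h

lemma lip_F {S : Set V3} (hS : Bornology.IsBounded S) : LipAtZero S Fc := by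
  obtain ⟨R, hR⟩ := hS.subset_closedBall (0 : V3)
  obtain ⟨M, hM⟩ := ((isCompact_closedBall (0 : V3) R).image
    h.contDiff_w.continuous).isBounded.exists_norm_le
  obtain ⟨M', hM'⟩ := ((isCompact_closedBall (0 : V3) R).image
    h.memMper.contDiff.continuous).isBounded.exists_norm_le
  refine ⟨⟨M + 1, ?_⟩, M', fun x hx => hM' _ ⟨x, hR hx, rfl⟩⟩
  filter_upwards [(h.F_zero R).lip (fun y hy => hM _ ⟨y, hy, rfl⟩)] with s hs x hx
    using hs x (hR hx)

lemma lip_DF {S : Set V3} (hS : Bornology.IsBounded S) :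
    LipAtZero S (fun s => fderiv ℝ (Fc s)) := by
  obtain ⟨R, hR⟩ := hS.subset_closedBall (0 : V3)
  obtain ⟨M, hM⟩ := ((isCompact_closedBall (0 : V3) R).image
    (h.contDiff_w.continuous_fderiv (by norm_num))).isBounded.exists_norm_le
  obtain ⟨M', hM'⟩ := ((isCompact_closedBall (0 : V3) R).image
    (h.memMper.contDiff.continuous_fderiv (by norm_num))).isBounded.exists_norm_le
  refine ⟨⟨M + 1, ?_⟩, M', fun x hx => hM' _ ⟨x, hR hx, rfl⟩⟩
  filter_upwards [(h.F_one R).lip (fun y hy => hM _ ⟨y, hy, rfl⟩)] with s hs x hx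
    using hs x (hR hx)

lemma lip_A_F {S : Set V3} (hS : Bornology.IsBounded S) :
    LipAtZero S (fun s x => Ac s (Fc s x)) := by
  obtain ⟨M, hM⟩ := h.bdd_A'
  obtain ⟨L, hL⟩ := h.pair_zero.mem_holder.bdd_fderiv (by norm_num)
  exact LipAtZero.comp_curve h.A_zero hM (h.contDiff_A.differentiable (by norm_num)) hL
    h.pair_zero.mem_holder.bdd (h.lip_F hS)

lemma lip_DA_F {S : Set V3} (hS : Bornology.IsBounded S) :
    LipAtZero S (fun s x => fderiv ℝ (Ac s) (Fc s x)) := by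
  obtain ⟨M, hM⟩ := h.bdd_fderiv_A'
  obtain ⟨L, hL⟩ := h.pair_zero.mem_holder.bdd_fderiv_fderiv le_rfl
  exact LipAtZero.comp_curve h.A_one hM
    ((h.contDiff_A.fderiv_right (m := 1) (by norm_num)).differentiable (by norm_num)) hL
    (h.pair_zero.mem_holder.bdd_fderiv (by norm_num)) (h.lip_F hS)

/-- Dominating bound for differentiating the volume part of `J` under the integral sign. -/
lemma lip_density {S : Set V3} (hS : Bornology.IsBounded S) :
    LipAtZero S (fun s x => (fderiv ℝ (Fc s) x).det * density g α μ (Ac s) (Fc s x)) := by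
  -- the pulled-back density is a `C¹` function of `A ∘ F`, `DA ∘ F`, `F` and `DF`
  let Q : V3 × (V3 →L[ℝ] V3) × V3 × (V3 →L[ℝ] V3) → ℝ := fun q =>
    inner ℝ (q.2.2.2 (e3 0)) (cross (q.2.2.2 (e3 1)) (q.2.2.2 (e3 2))) *
      (‖curlL q.2.1‖ ^ 2 - 2 * g * q.2.2.1 2 - α * inner ℝ q.1 (curlL q.2.1) - μ)
  have hQ : ContDiff ℝ 1 Q := by
    have hP : ∀ v : V3, ContDiff ℝ 1
        (fun q : V3 × (V3 →L[ℝ] V3) × V3 × (V3 →L[ℝ] V3) => q.2.2.2 v) := fun v =>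
      contDiff_snd.snd.snd.clm_apply contDiff_const
    have hu : ContDiff ℝ 1
        (fun q : V3 × (V3 →L[ℝ] V3) × V3 × (V3 →L[ℝ] V3) => curlL q.2.1) :=
      curlL.contDiff.comp contDiff_snd.fst
    exact (contDiff_inner3 (hP _) (contDiff_cross (hP _) (hP _))).mul
      ((((hu.norm_sq ℝ).sub (contDiff_const.mul (contDiff_coord contDiff_snd.snd.fst 2))).sub
        (contDiff_const.mul (contDiff_inner3 contDiff_fst hu))).sub contDiff_const)
  have := ((h.lip_A_F hS).prodMk ((h.lip_DA_F hS).prodMk ((h.lip_F hS).prodMk (h.lip_DF hS)))).comp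
    hQ.locallyLipschitz
  simp only [Q, ← det_eq_triple, curlL_fderiv] at this
  exact this

lemma hasDerivAt_pd_F (i : Fin 3) (x : V3) :
    HasDerivAt (fun s => pd i (Fc s) x) (pd i w x) 0 := h.hasDerivAt_DF x (e3 i)

/-- Derivative of the Jacobian along a curve of diffeomorphisms with Eulerian velocity `W`. -/
lemma hasDerivAt_det {W : V3 → V3} (hW : Differentiable ℝ W) (hw : ∀ x, W (Fc 0 x) = w x) (x : V3) :
    HasDerivAt (fun s => (fderiv ℝ (Fc s) x).det)
      ((fderiv ℝ (Fc 0) x).det * div W (Fc 0 x)) 0 := by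
  simp only [det_eq_triple]
  have h1 := (h.hasDerivAt_pd_F 0 x).inner ℝ
    (hasDerivAt_cross (h.hasDerivAt_pd_F 1 x) (h.hasDerivAt_pd_F 2 x))
  have hpd := fun i => (show pd i w x = pd i (fun y => W (Fc 0 y)) x by simp only [hw]).trans
    (pd_comp (hW _) (h.memMper.differentiable x) i)
  refine h1.congr_deriv ?_
  simp only [hpd, div_eq]
  change _ = inner ℝ (pd 0 (Fc 0) x) (cross (pd 1 (Fc 0) x) (pd 2 (Fc 0) x)) * _
  simp only [inner_eq, cross_zero_coord, cross_one_coord, cross_two_coord, PiLp.add_apply,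
    PiLp.smul_apply, smul_eq_mul]
  ring

/-- Variation of the pulled-back density, for a curve with Eulerian velocity `W` (that is,
`W ∘ F = w`), in the form given by `bulk_identity`. -/
lemma hasDerivAt_density {W : V3 → V3} (hW : ContDiff ℝ 3 W) (hw : ∀ x, W (Fc 0 x) = w x) (x : V3) :
    HasDerivAt (fun s => (fderiv ℝ (Fc s) x).det * density g α μ (Ac s) (Fc s x))
      ((fderiv ℝ (Fc 0) x).det *
        (div (fluxField α (Ac 0) (fun y => A' y + grad (fun z => inner ℝ (Ac 0 z) (W z)) y) W
          (density g α μ (Ac 0))) (Fc 0 x) +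
        2 * inner ℝ (A' (Fc 0 x) + grad (fun z => inner ℝ (Ac 0 z) (W z)) (Fc 0 x))
          (curl (curl (Ac 0)) (Fc 0 x) - α • curl (Ac 0) (Fc 0 x)))) 0 := by
  rw [← bulk_identity h.contDiff_A h.contDiff_A' (hW.of_le (by norm_num))
    (contDiff_density h.contDiff_A)]
  have hA := h.contDiff_A
  have dA := hA.differentiable (by norm_num) (Fc 0 x)
  have du := (contDiff_curl hA (m := 1) (by norm_num)).differentiable (by norm_num) (Fc 0 x)
  have h1 := h.hasDerivAt_curl_F x
  have h2 := h.hasDerivAt_A_F x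
  have h3 : HasDerivAt (fun s => Fc s x 2) (w x 2) 0 :=
    (EuclideanSpace.proj 2 : V3 →L[ℝ] ℝ).hasFDerivAt.comp_hasDerivAt 0 (h.hasDerivAt_F x)
  have h4 := ((h1.norm_sq.sub (h3.const_mul (2 * g))).sub ((h2.inner ℝ h1).const_mul α)).sub_const μ
  have h5 := (h.hasDerivAt_det (hW.differentiable (by norm_num)) hw x).mul h4
  have h6 : fderiv ℝ (density g α μ (Ac 0)) (Fc 0 x) (w x) =
      2 * inner ℝ (curl (Ac 0) (Fc 0 x)) (fderiv ℝ (curl (Ac 0)) (Fc 0 x) (w x)) - 2 * g * w x 2 -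
      α * (inner ℝ (Ac 0 (Fc 0 x)) (fderiv ℝ (curl (Ac 0)) (Fc 0 x) (w x)) +
        inner ℝ (fderiv ℝ (Ac 0) (Fc 0 x) (w x)) (curl (Ac 0) (Fc 0 x))) := by
    have k := (((du.hasFDerivAt.norm_sq.sub
      ((EuclideanSpace.proj 2 : V3 →L[ℝ] ℝ).hasFDerivAt.const_mul (2 * g))).sub
      ((dA.hasFDerivAt.inner ℝ du.hasFDerivAt).const_mul α)).sub_const μ)
    rw [show fderiv ℝ (density g α μ (Ac 0)) (Fc 0 x) = _ from k.fderiv]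
    simp
  refine h5.congr_deriv ?_
  rw [hw, h6]
  simp only [density, inner_add_left, inner_add_right, Pi.sub_apply]
  ring

end IsVariation

variable {lam : Fin 2 → V2} {d γ γ' m₁ m₂ δ g σ α μ : ℝ} {Ac Fc : ℝ → V3 → V3} {A' w : V3 → V3}

/-! ### Calculus on the parameter plane of the surface -/

lemma contDiff_pdS {f : V2 → V3} {n m : WithTop ℕ∞} (hf : ContDiff ℝ n f) (hmn : m + 1 ≤ n)
    (i : Fin 2) : ContDiff ℝ m (pdS i f) :=
  (hf.fderiv_right hmn).clm_apply contDiff_const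

lemma pdS_cross {f k : V2 → V3} {p : V2} (hf : DifferentiableAt ℝ f p)
    (hk : DifferentiableAt ℝ k p) (i : Fin 2) :
    pdS i (fun q => cross (f q) (k q)) p = cross (f p) (pdS i k p) + cross (pdS i f p) (k p) := by
  have := crossL.hasFDerivAt_of_bilinear hf.hasFDerivAt hk.hasFDerivAt
  simp only [crossL_apply] at this
  simp [pdS, this.fderiv]

lemma pdS_pdS_comm {f : V2 → V3} (h : ContDiff ℝ 2 f) (i j : Fin 2) (p : V2) :
    pdS i (pdS j f) p = pdS j (pdS i f) p := by
  have hs : IsSymmSndFDerivAt ℝ f p := h.contDiffAt.isSymmSndFDerivAt (by simp)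
  have hd : DifferentiableAt ℝ (fderiv ℝ f) p :=
    (h.fderiv_right (m := 1) (by norm_num)).differentiable (by norm_num) p
  have key : ∀ i j : Fin 2, pdS i (pdS j f) p = fderiv ℝ (fderiv ℝ f) p
      (EuclideanSpace.single i 1) (EuclideanSpace.single j 1) := by
    intro i j
    have := (hd.hasFDerivAt.clm_apply
      (hasFDerivAt_const (EuclideanSpace.single j (1 : ℝ)) p)).fderiv
    change fderiv ℝ (fun y => fderiv ℝ f y (EuclideanSpace.single j 1)) p _ = _
    rw [this]; simp
  rw [key, key]; exact hs _ _

section surface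
variable {F : V3 → V3} (hF : MemMper lam d γ F)
include hF

lemma MemMper.contDiff_surf : ContDiff ℝ 3 (surf F) := hF.contDiff.comp (contDiff_lift 0)

lemma MemMper.contDiff_surfCross : ContDiff ℝ 2 (surfCross F) :=
  contDiff_cross (contDiff_pdS hF.contDiff_surf (by norm_num) 0)
    (contDiff_pdS hF.contDiff_surf (by norm_num) 1)

lemma MemMper.contDiff_normal : ContDiff ℝ 2 (normal F) :=
  ((hF.contDiff_surfCross.norm ℝ hF.surfCross_ne_zero).inv
    (fun p => norm_ne_zero_iff.2 (hF.surfCross_ne_zero p))).smul hF.contDiff_surfCross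

lemma MemMper.inner_normal_self (p : V2) : inner ℝ (normal F p) (normal F p) = 1 := by
  rw [real_inner_self_eq_norm_sq, normal, norm_smul, norm_inv, norm_norm,
    inv_mul_cancel₀ (norm_ne_zero_iff.2 (hF.surfCross_ne_zero p))]
  norm_num

/-- The derivatives of the unit normal are tangential. -/
lemma MemMper.inner_normal_pdS (i : Fin 2) (p : V2) :
    inner ℝ (normal F p) (pdS i (normal F) p) = 0 := by
  have hn := (hF.contDiff_normal.differentiable (by norm_num) p).hasFDerivAt
  have h1 := hn.inner ℝ hn
  simp only [hF.inner_normal_self] at h1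
  have h2 := congr_arg (fun L : V2 →L[ℝ] ℝ => L (EuclideanSpace.single i 1))
    (h1.unique (hasFDerivAt_const (1 : ℝ) p))
  simp only [ContinuousLinearMap.comp_apply, ContinuousLinearMap.prod_apply,
    fderivInnerCLM_apply, zero_apply] at h2
  rw [real_inner_comm (normal F p) (fderiv ℝ (normal F) p _)] at h2
  simp only [pdS]
  linarith

lemma MemMper.surf_periodic {v : V2} (hv : v ∈ lattice lam) (p : V2) :
    surf F (p + v) = surf F p + lift v 0 := by
  rw [surf, lift_add_zero, hF.periodic v hv]; rfl

lemma MemMper.pdS_surf_periodic {v : V2} (hv : v ∈ lattice lam) (i : Fin 2) (p : V2) :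
    pdS i (surf F) (p + v) = pdS i (surf F) p := by
  simp only [pdS]
  rw [← fderiv_comp_add_right]
  simp only [hF.surf_periodic hv, fderiv_add_const]

lemma MemMper.surfCross_periodic {v : V2} (hv : v ∈ lattice lam) (p : V2) :
    surfCross F (p + v) = surfCross F p := by
  simp only [surfCross, hF.pdS_surf_periodic hv]

lemma MemMper.normal_periodic {v : V2} (hv : v ∈ lattice lam) (p : V2) :
    normal F (p + v) = normal F p := by
  simp only [normal, hF.surfCross_periodic hv]

end surface

/-- The vector product of two vectors orthogonal to the unit vector `n` is a multiple of `n`. -/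
lemma cross_eq_smul_of_inner_eq_zero {a b n : V3} (ha : inner ℝ n a = 0) (hb : inner ℝ n b = 0)
    (hn : inner ℝ n n = 1) : cross a b = inner ℝ n (cross a b) • n := by
  simp only [inner_eq] at ha hb hn
  apply V3.ext' <;> simp only [inner_eq, cross_zero_coord, cross_one_coord, cross_two_coord,
    PiLp.smul_apply, smul_eq_mul]
  · linear_combination (-(a 1 * b 2 - a 2 * b 1)) * hn - (n 2 * b 1 - n 1 * b 2) * ha
      - (a 2 * n 1 - a 1 * n 2) * hb
  · linear_combination (-(a 2 * b 0 - a 0 * b 2)) * hn - (n 0 * b 2 - n 2 * b 0) * ha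
      - (a 0 * n 2 - a 2 * n 0) * hb
  · linear_combination (-(a 0 * b 1 - a 1 * b 0)) * hn - (n 1 * b 0 - n 0 * b 1) * ha
      - (a 1 * n 0 - a 0 * n 1) * hb

/-- The first variation of the area element is a divergence minus twice the mean curvature times
the normal velocity. -/
lemma MemMper.area_identity {F : V3 → V3} (hF : MemMper lam d γ F) {ω : V2 → V3}
    (hω : ContDiff ℝ 1 ω) (p : V2) :
    inner ℝ (normal F p) (cross (pdS 0 ω p) (pdS 1 (surf F) p) + cross (pdS 0 (surf F) p) (pdS 1 ω p)) =
      fderiv ℝ (fun q => inner ℝ (ω q) (cross (pdS 1 (surf F) q) (normal F q))) p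
          (EuclideanSpace.single 0 1) +
        fderiv ℝ (fun q => inner ℝ (ω q) (cross (normal F q) (pdS 0 (surf F) q))) p
          (EuclideanSpace.single 1 1) -
        2 * meanCurv F p * inner ℝ (ω p) (surfCross F p) := by
  have dω := hω.differentiable (by norm_num) p
  have dn := hF.contDiff_normal.differentiable (by norm_num) p
  have dS := fun i => (contDiff_pdS hF.contDiff_surf (m := 2) (by norm_num) i).differentiable
    (by norm_num) p
  have d1 := ((contDiff_cross (contDiff_pdS hF.contDiff_surf (m := 2) (by norm_num) 1)
    hF.contDiff_normal).differentiable (by norm_num) p)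
  have d2 := ((contDiff_cross hF.contDiff_normal
    (contDiff_pdS hF.contDiff_surf (m := 2) (by norm_num) 0)).differentiable (by norm_num) p)
  rw [fderiv_inner_apply ℝ dω d1, fderiv_inner_apply ℝ dω d2]
  change _ = inner ℝ (ω p) (pdS 0 (fun q => cross (pdS 1 (surf F) q) (normal F q)) p) +
      inner ℝ (pdS 0 ω p) _ + (inner ℝ (ω p)
        (pdS 1 (fun q => cross (normal F q) (pdS 0 (surf F) q)) p) + inner ℝ (pdS 1 ω p) _) - _
  rw [pdS_cross (dS 1) dn, pdS_cross dn (dS 0),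
    pdS_pdS_comm (hF.contDiff_surf.of_le (by norm_num)) 1 0]
  have hR : ‖surfCross F p‖ ≠ 0 := norm_ne_zero_iff.2 (hF.surfCross_ne_zero p)
  have hN : surfCross F p = ‖surfCross F p‖ • normal F p := by
    rw [normal, smul_smul, mul_inv_cancel₀ hR, one_smul]
  have hn0 : inner ℝ (normal F p) (pdS 0 (surf F) p) = 0 := by
    rw [normal, inner_smul_left, surfCross, inner_cross_self_left, mul_zero]
  have hn1 : inner ℝ (normal F p) (pdS 1 (surf F) p) = 0 := by
    rw [normal, inner_smul_left, surfCross, inner_cross_self_right, mul_zero]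
  -- `S_X × n_Y` and `n_X × S_Y` are normal, so only the normal part of `ω` meets the terms with
  -- `n_X`, `n_Y`
  have e1 := cross_eq_smul_of_inner_eq_zero hn1 (hF.inner_normal_pdS 0 p) (hF.inner_normal_self p)
  have e2 := cross_eq_smul_of_inner_eq_zero (hF.inner_normal_pdS 1 p) hn0 (hF.inner_normal_self p)
  rw [meanCurv, surfDiv, hN]
  simp only [norm_smul, norm_norm]
  have hnn : ‖normal F p‖ = 1 := by
    have := hF.inner_normal_self p
    rw [real_inner_self_eq_norm_sq] at this
    nlinarith [norm_nonneg (normal F p)]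
  rw [hnn, mul_one, e1, e2]
  generalize normal F p = n at *
  generalize ‖surfCross F p‖ = R at *
  generalize pdS 0 (normal F) p = n0 at *
  generalize pdS 1 (normal F) p = n1 at *
  generalize pdS 1 (surf F) p = S1 at *
  generalize pdS 0 (surf F) p = S0 at *
  simp only [inner_smul_right, inner_add_right]
  field_simp
  simp only [inner_eq, cross_zero_coord, cross_one_coord, cross_two_coord]
  ring

variable {lam : Fin 2 → V2} {d γ γ' m₁ m₂ δ g σ α μ : ℝ} {Ac Fc : ℝ → V3 → V3} {A' w : V3 → V3}

/-! ### First variation of the area and of the functional -/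

lemma hasDerivAt_norm {c : ℝ → V3} {c' : V3} (hc : HasDerivAt c c' 0) (h0 : c 0 ≠ 0) :
    HasDerivAt (fun s => ‖c s‖) (inner ℝ (‖c 0‖⁻¹ • c 0) c') 0 := by
  have h1 := (hc.norm_sq).sqrt (pow_ne_zero 2 (norm_ne_zero_iff.2 h0))
  simp only [Real.sqrt_sq (norm_nonneg _)] at h1
  refine h1.congr_deriv ?_
  rw [inner_smul_left]
  have : ‖c 0‖ ≠ 0 := norm_ne_zero_iff.2 h0
  simp only [conj_trivial]
  field_simp

lemma IsPer.inner_lift {w : V3 → V3} (hw : IsPer lam w) (N : V2 → V3)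
    (hN : ∀ v ∈ lattice lam, ∀ p, N (p + v) = N p) :
    ∀ v ∈ lattice lam, ∀ p,
      inner ℝ (w (lift (p + v) 0)) (N (p + v)) = inner ℝ (w (lift p 0)) (N p) := by
  intro v hv p
  rw [hN v hv, lift_add_zero, hw v hv]

lemma MemMper.continuous_meanCurv {F : V3 → V3} (hF : MemMper lam d γ F) :
    Continuous (meanCurv F) := by
  have hS : ∀ i, Continuous (pdS i (surf F)) := fun i =>
    (contDiff_pdS hF.contDiff_surf (m := 2) (by norm_num) i).continuous
  have hn := hF.contDiff_normal
  have hn' : ∀ i, Continuous (pdS i (normal F)) := fun i =>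
    (contDiff_pdS hn (m := 1) (by norm_num) i).continuous
  have hi : Continuous fun p => ‖surfCross F p‖⁻¹ := hF.contDiff_surfCross.continuous.norm.inv₀
    fun p => norm_ne_zero_iff.2 (hF.surfCross_ne_zero p)
  have hc : ∀ {f k : V2 → V3}, Continuous f → Continuous k →
      Continuous fun p => cross (f p) (k p) := fun hf hk =>
    (crossL.continuous.comp hf).clm_apply hk
  exact ((((hn' 0).inner (hi.smul (hc (hS 1) hn.continuous))).add
    ((hn' 1).inner (hi.smul (hc hn.continuous (hS 0))))).neg).div_const 2

namespace IsVariation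

variable (h : IsVariation lam d γ m₁ m₂ Ac Fc A' w)
include h

lemma hasDerivAt_surfCross (p : V2) : HasDerivAt (fun s => surfCross (Fc s) p)
    (cross (pdS 0 (surf w) p) (pdS 1 (surf (Fc 0)) p) +
      cross (pdS 0 (surf (Fc 0)) p) (pdS 1 (surf w) p)) 0 := by
  have dw := h.contDiff_w.differentiable (by norm_num)
  have h1 := hasDerivAt_cross (h.hasDerivAt_pd_F 0 (lift p 0)) (h.hasDerivAt_pd_F 1 (lift p 0))
  rw [pdS_surf_zero (dw _), pdS_surf_one (dw _), pdS_surf_zero (h.memMper.differentiable _),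
    pdS_surf_one (h.memMper.differentiable _), add_comm]
  refine h1.congr_of_eventuallyEq ?_
  filter_upwards [h.pair] with s hs using hs.mem_Mper.surfCross_eq p

/-- First variation of the area of the free surface: the divergences in `area_identity` have
periodic primitives and integrate to zero. -/
lemma hasDerivAt_area (hlam : LinearIndependent ℝ lam) :
    HasDerivAt (fun s => ∫ p in cell lam, ‖surfCross (Fc s) p‖)
      (-2 * ∫ p in cell lam, meanCurv (Fc 0) p * inner ℝ (w (lift p 0)) (surfCross (Fc 0) p)) 0 := by
  have hF := h.memMper
  have hω : ContDiff ℝ 1 (surf w) := (h.contDiff_w.of_le (by norm_num)).comp (contDiff_lift 0)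
  have hlip : LipAtZero (cell lam) (fun s p => ‖surfCross (Fc s) p‖) := by
    have h1 : LipAtZero (cell lam) (fun s p => fderiv ℝ (Fc s) (lift p 0)) := by
      obtain ⟨⟨C, hC⟩, R, hR⟩ := h.lip_DF
        ((isCompact_closedCell (lam := lam)).image (contDiff_lift (n := 0) 0).continuous).isBounded
      exact ⟨⟨C, hC.mono fun s hs p hp => hs _ ⟨p, cell_subset hp, rfl⟩⟩, R,
        fun p hp => hR _ ⟨p, cell_subset hp, rfl⟩⟩
    have hQ : ContDiff ℝ 1 (fun P : V3 →L[ℝ] V3 => cross (P (e3 0)) (P (e3 1))) :=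
      contDiff_cross (contDiff_id.clm_apply contDiff_const) (contDiff_id.clm_apply contDiff_const)
    obtain ⟨⟨C, hC⟩, hR⟩ := h1.comp
      ((lipschitzWith_one_norm (E := V3)).locallyLipschitz.comp hQ.locallyLipschitz)
    refine ⟨⟨C, ?_⟩, ?_⟩
    · filter_upwards [hC, h.pair] with s hs hp p hpc
      rw [hp.mem_Mper.surfCross_eq, hF.surfCross_eq]
      exact hs p hpc
    · simp only [hF.surfCross_eq]; exact hR
  have hder := hasDerivAt_setIntegral_of_lipAtZero (ν := volume) (isOpen_cell hlam).measurableSet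
    volume_cell_ne_top (h.pair.mono fun s hs =>
      (hs.mem_Mper.contDiff_surfCross.continuous.norm).aestronglyMeasurable)
    hlip (fun p _ => hasDerivAt_norm (h.hasDerivAt_surfCross p) (hF.surfCross_ne_zero p))
  refine hder.congr_deriv ?_
  have e1 : ∀ p, inner ℝ (‖surfCross (Fc 0) p‖⁻¹ • surfCross (Fc 0) p)
      (cross (pdS 0 (surf w) p) (pdS 1 (surf (Fc 0)) p) +
      cross (pdS 0 (surf (Fc 0)) p) (pdS 1 (surf w) p)) = _ := fun p => hF.area_identity hω p
  simp only [e1]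
  have hS : ∀ i, ContDiff ℝ 1 (pdS i (surf (Fc 0))) := fun i =>
    contDiff_pdS hF.contDiff_surf (by norm_num) i
  have hn : ContDiff ℝ 1 (normal (Fc 0)) := hF.contDiff_normal.of_le (by norm_num)
  have c1 : ContDiff ℝ 1 (fun q => inner ℝ (surf w q) (cross (pdS 1 (surf (Fc 0)) q) (normal (Fc 0) q))) :=
    contDiff_inner3 hω (contDiff_cross (hS 1) hn)
  have c2 : ContDiff ℝ 1 (fun q => inner ℝ (surf w q) (cross (normal (Fc 0) q) (pdS 0 (surf (Fc 0)) q))) :=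
    contDiff_inner3 hω (contDiff_cross hn (hS 0))
  have z1 := integral_cell_fderiv hlam c1 (h.isPer_w.inner_lift
    (fun q => cross (pdS 1 (surf (Fc 0)) q) (normal (Fc 0) q)) (fun v hv p => by
      simp only [hF.pdS_surf_periodic hv, hF.normal_periodic hv])) (EuclideanSpace.single 0 1)
  have z2 := integral_cell_fderiv hlam c2 (h.isPer_w.inner_lift
    (fun q => cross (normal (Fc 0) q) (pdS 0 (surf (Fc 0)) q)) (fun v hv p => by
      simp only [hF.pdS_surf_periodic hv, hF.normal_periodic hv])) (EuclideanSpace.single 1 1)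
  have i1 := integrableOn_cell (lam := lam) ((c1.continuous_fderiv (by norm_num)).clm_apply
    (continuous_const (y := EuclideanSpace.single 0 (1 : ℝ))))
  have i2 := integrableOn_cell (lam := lam) ((c2.continuous_fderiv (by norm_num)).clm_apply
    (continuous_const (y := EuclideanSpace.single 1 (1 : ℝ))))
  have i3 : IntegrableOn (fun p => 2 * meanCurv (Fc 0) p * inner ℝ (surf w p) (surfCross (Fc 0) p))
      (cell lam) := by
    refine integrableOn_cell ((continuous_const.mul hF.continuous_meanCurv).mul ?_)
    exact hω.continuous.inner hF.contDiff_surfCross.continuous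
  refine (integral_sub (i1.add i2) i3).trans ?_
  refine (congr_arg₂ _ (integral_add i1 i2) rfl).trans ?_
  rw [z1, z2, ← integral_const_mul]
  simp only [mul_assoc, zero_add, zero_sub, ← integral_neg]
  congr 1; funext p
  simp [surf]

/-- On the free surface, `B = A' + grad (A · W) + u × W` is normal: differentiate the boundary
condition along the curve. -/
lemma top_tangential {W : V3 → V3} (hW : ContDiff ℝ 3 W) (hw : ∀ x, W (Fc 0 x) = w x) (p : V2)
    (i : Fin 3)
    (hi : ∀ᶠ s in 𝓝 0, inner ℝ (Ac s (surf (Fc s) p)) (pd i (Fc s) (lift p 0)) = 0) :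
    inner ℝ (A' (surf (Fc 0) p) + grad (fun z => inner ℝ (Ac 0 z) (W z)) (surf (Fc 0) p) +
      cross (curl (Ac 0) (surf (Fc 0) p)) (W (surf (Fc 0) p))) (pd i (Fc 0) (lift p 0)) = 0 := by
  have h1 := (h.hasDerivAt_A_F (lift p 0)).inner ℝ (h.hasDerivAt_pd_F i (lift p 0))
  have h2 := h1.unique ((hasDerivAt_const (0 : ℝ) (0 : ℝ)).congr_of_eventuallyEq hi)
  have dA := h.contDiff_A.differentiable (by norm_num)
  have dW := hW.differentiable (by norm_num)
  have h3 : pd i w (lift p 0) = fderiv ℝ W (surf (Fc 0) p) (pd i (Fc 0) (lift p 0)) := by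
    have := (dW (Fc 0 (lift p 0))).hasFDerivAt.comp (lift p 0)
      (h.memMper.differentiable (lift p 0)).hasFDerivAt
    rw [show w = W ∘ Fc 0 from funext fun x => (hw x).symm, pd, this.fderiv]; rfl
  rw [inner_add_left, inner_add_left, grad_inner, inner_cross_curl,
    fderiv_inner_apply ℝ (dA _) (dW _), ← h3]
  change inner ℝ (Ac 0 (surf (Fc 0) p)) (pd i w (lift p 0)) +
    inner ℝ (A' (surf (Fc 0) p) + fderiv ℝ (Ac 0) (surf (Fc 0) p) (w (lift p 0)))
      (pd i (Fc 0) (lift p 0)) = 0 at h2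
  rw [inner_add_left, ← hw (lift p 0)] at h2
  change _ + (_ + inner ℝ (fderiv ℝ (Ac 0) (surf (Fc 0) p) (W (surf (Fc 0) p))) _) = 0 at h2
  linarith

/-- On the bottom, the horizontal components of `A' + grad (A · W)` vanish. -/
lemma bottom_horizontal {W : V3 → V3} (hW : ContDiff ℝ 3 W) (hw : ∀ x, W (Fc 0 x) = w x) (p : V2) :
    (A' (lift p (-d)) + grad (fun z => inner ℝ (Ac 0 z) (W z)) (lift p (-d))) 0 = 0 ∧
    (A' (lift p (-d)) + grad (fun z => inner ℝ (Ac 0 z) (W z)) (lift p (-d))) 1 = 0 := by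
  have hWb : ∀ q : V2, W (lift q (-d)) = 0 := fun q => by
    have := hw (lift q (-d))
    rwa [h.memMper.bottom, h.w_bottom] at this
  have hφ : ∀ v : V2, fderiv ℝ (fun z => inner ℝ (Ac 0 z) (W z)) (lift p (-d)) (lift v 0) = 0 := by
    intro v
    have hd : Differentiable ℝ (fun z => inner ℝ (Ac 0 z) (W z)) :=
      (contDiff_inner3 h.contDiff_A (hW.of_le (by norm_num))).differentiable
        (n := 2) (by norm_num)
    have h1 := (hd (lift p (-d))).hasFDerivAt.comp p (hasFDerivAt_lift p (-d))
    have h2 : HasFDerivAt ((fun z => inner ℝ (Ac 0 z) (W z)) ∘ fun q : V2 => lift q (-d))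
        (0 : V2 →L[ℝ] ℝ) p := by
      have : ((fun z => inner ℝ (Ac 0 z) (W z)) ∘ fun q : V2 => lift q (-d)) = fun _ => (0 : ℝ) := by
        funext q; simp [hWb]
      rw [this]; exact hasFDerivAt_const _ _
    simpa using congr_arg (fun L : V2 →L[ℝ] ℝ => L v) (h1.unique h2)
  have hA : ∀ (j : Fin 3) (c : ℝ), (∀ᶠ s in 𝓝 0, Ac s (lift p (-d)) j = c) →
      A' (lift p (-d)) j = 0 := fun j c hc =>
    ((EuclideanSpace.proj j : V3 →L[ℝ] ℝ).hasFDerivAt.comp_hasDerivAt 0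
      (h.hasDerivAt_A (lift p (-d)))).unique
      ((hasDerivAt_const (0 : ℝ) c).congr_of_eventuallyEq hc)
  have g0 := hφ (EuclideanSpace.single 0 1)
  have g1 := hφ (EuclideanSpace.single 1 1)
  rw [lift_single_zero] at g0
  rw [lift_single_one] at g1
  refine ⟨?_, ?_⟩
  · rw [PiLp.add_apply, hA 0 m₂ (h.pair.mono fun s hs => (hs.bottom_coord p).1), grad_apply_zero,
      pdr, g0, add_zero]
  · rw [PiLp.add_apply, hA 1 (-m₁) (h.pair.mono fun s hs => (hs.bottom_coord p).2), grad_apply_one,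
      pdr, g1, add_zero]

/-- The flux through the free surface: the part of `fluxField` that contains the normal field `B` is
tangential, as is `curl A`, and the helicity density cancels. -/
lemma flux_top {W : V3 → V3} (hW : ContDiff ℝ 3 W) (hw : ∀ x, W (Fc 0 x) = w x) (p : V2) :
    inner ℝ (fluxField α (Ac 0) (fun y => A' y + grad (fun z => inner ℝ (Ac 0 z) (W z)) y) W
      (density g α μ (Ac 0)) (surf (Fc 0) p)) (surfCross (Fc 0) p) =
    -(‖curl (Ac 0) (surf (Fc 0) p)‖ ^ 2 + 2 * g * surf (Fc 0) p 2 + μ) *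
      inner ℝ (w (lift p 0)) (surfCross (Fc 0) p) := by
  have h0 := h.top_tangential hW hw p 0 (h.pair.mono fun s hs => (hs.top_tangential p).1)
  have h1 := h.top_tangential hW hw p 1 (h.pair.mono fun s hs => (hs.top_tangential p).2)
  have hu := h.pair_zero.curl_surfCross p
  have hwp : W (surf (Fc 0) p) = w (lift p 0) := hw _
  rw [hwp] at h0 h1
  rw [fluxField_eq, hwp]
  beta_reduce
  generalize A' (surf (Fc 0) p) + grad (fun z => inner ℝ (Ac 0 z) (W z)) (surf (Fc 0) p) +
    cross (curl (Ac 0) (surf (Fc 0) p)) (w (lift p 0)) = B at *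
  have key : ∀ b v : V3, inner ℝ b (pd 0 (Fc 0) (lift p 0)) = 0 →
      inner ℝ b (pd 1 (Fc 0) (lift p 0)) = 0 → inner ℝ (cross b v) (surfCross (Fc 0) p) = 0 := by
    intro b v hb0 hb1
    rw [h.memMper.surfCross_eq]
    simp only [inner_eq] at hb0 hb1
    simp only [inner_eq, cross_zero_coord, cross_one_coord, cross_two_coord]
    generalize pd 0 (Fc 0) (lift p 0) = a0 at *
    generalize pd 1 (Fc 0) (lift p 0) = a1 at *
    linear_combination (v 0 * a1 0 + v 1 * a1 1 + v 2 * a1 2) * hb0 -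
      (v 0 * a0 0 + v 1 * a0 1 + v 2 * a0 2) * hb1
  simp only [inner_add_left, inner_sub_left, inner_smul_left, conj_trivial, hu, key B _ h0 h1,
    density]
  ring

/-- No flux through the bottom: there `W` vanishes and `C = A' + grad (A · W)` is vertical, so that
the vertical components of `C × u` and `C × A` vanish. -/
lemma flux_bottom {W : V3 → V3} (hW : ContDiff ℝ 3 W) (hw : ∀ x, W (Fc 0 x) = w x) (p : V2) :
    fluxField α (Ac 0) (fun y => A' y + grad (fun z => inner ℝ (Ac 0 z) (W z)) y) W
      (density g α μ (Ac 0)) (lift p (-d)) 2 = 0 := by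
  obtain ⟨h0, h1⟩ := h.bottom_horizontal hW hw p
  have hWb : W (lift p (-d)) = 0 := by
    have := hw (lift p (-d))
    rwa [h.memMper.bottom, h.w_bottom] at this
  rw [fluxField, hWb]
  generalize A' (lift p (-d)) + grad (fun z => inner ℝ (Ac 0 z) (W z)) (lift p (-d)) = b at *
  simp [h0, h1]

/-- **First variation of `J`** along an admissible curve with Eulerian velocity `W`: a volume
integral against `curl u - α u` and a surface integral against the defect in the Bernoulli
condition. -/
theorem hasDerivAt_functionalJ (hlam : LinearIndependent ℝ lam) (hd : 0 < d) {W : V3 → V3}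
    (hW : ContDiff ℝ 3 W) (hw : ∀ x, W (Fc 0 x) = w x) :
    HasDerivAt (fun s => functionalJ lam d g σ α μ (Ac s) (Fc s))
      ((∫ x in slabCell lam d, (fderiv ℝ (Fc 0) x).det *
        (2 * inner ℝ (A' (Fc 0 x) + grad (fun z => inner ℝ (Ac 0 z) (W z)) (Fc 0 x))
          (curl (curl (Ac 0)) (Fc 0 x) - α • curl (Ac 0) (Fc 0 x)))) -
      2 * ∫ p in cell lam, (‖curl (Ac 0) (surf (Fc 0) p)‖ ^ 2 / 2 + g * surf (Fc 0) p 2 -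
        2 * σ * meanCurv (Fc 0) p + μ / 2) * inner ℝ (w (lift p 0)) (surfCross (Fc 0) p)) 0 := by
  have hF := h.memMper
  have hA := h.contDiff_A
  have cF := hF.contDiff.continuous
  have cu : ContDiff ℝ 1 (curl (Ac 0)) := contDiff_curl hA (by norm_num)
  have hC : ContDiff ℝ 1 (fun y => A' y + grad (fun z => inner ℝ (Ac 0 z) (W z)) y) :=
    h.contDiff_A'.add (contDiff_grad (contDiff_inner3 hA (hW.of_le (by norm_num))) (by norm_num))
  have hV : ContDiff ℝ 1 (fluxField α (Ac 0)
      (fun y => A' y + grad (fun z => inner ℝ (Ac 0 z) (W z)) y) W (density g α μ (Ac 0))) :=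
    contDiff_fluxField hA hC (hW.of_le (by norm_num)) (contDiff_density hA)
  have hper : IsPer lam (fluxField α (Ac 0)
      (fun y => A' y + grad (fun z => inner ℝ (Ac 0 z) (W z)) y) W (density g α μ (Ac 0))) := by
    intro v hv y
    have pA := h.pair_zero.periodic v hv
    have pu := h.pair_zero.periodic.curl v hv
    have pW : ∀ y, W (y + lift v 0) = W y := by
      intro y
      obtain ⟨G, -, hG, -⟩ := hF.diffeo
      have h1 := hw (G y + lift v 0)
      rw [hF.periodic v hv, h.isPer_w v hv, ← hw, hG y] at h1
      exact h1
    have pg : grad (fun z => inner ℝ (Ac 0 z) (W z)) (y + lift v 0) =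
        grad (fun z => inner ℝ (Ac 0 z) (W z)) y := by
      have := fderiv_periodic (f := fun z => inner ℝ (Ac 0 z) (W z)) (v := lift v 0) (c := 0)
        (fun z => by rw [pA, pW, add_zero]) y
      simp only [grad, pdr, this]
    simp only [fluxField, density, pA, pu, pW, pg, h.isPer_A' v hv y, PiLp.add_apply,
      lift_apply_two, add_zero]
  have cdet := continuous_fderiv_det (hF.contDiff.of_le (by norm_num) : ContDiff ℝ 1 (Fc 0))
  have cdiv : Continuous (div (fluxField α (Ac 0)
      (fun y => A' y + grad (fun z => inner ℝ (Ac 0 z) (W z)) y) W (density g α μ (Ac 0)))) := by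
    have := fun i j => (contDiff_coord (contDiff_pd hV (m := 0) (by norm_num) i) j).continuous
    refine Continuous.congr (((this 0 0).add (this 1 1)).add (this 2 2)) fun x => ?_
    rw [div_eq]; rfl
  have hbulk := hasDerivAt_setIntegral_of_lipAtZero (ν := volume)
    (isOpen_slabCell (d := d) hlam).measurableSet volume_slabCell_ne_top
    (h.pair.mono fun s hs => ((continuous_fderiv_det (hs.mem_Mper.contDiff.of_le
      (by norm_num) : ContDiff ℝ 1 (Fc s))).mul ((contDiff_density hs.mem_holder.1).continuous.comp
        hs.mem_Mper.contDiff.continuous)).aestronglyMeasurable)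
    (h.lip_density (g := g) (α := α) (μ := μ)
      (isCompact_closedSlabCell.isBounded.subset slabCell_subset))
    (fun x _ => h.hasDerivAt_density hW hw x)
  have harea := (h.hasDerivAt_area hlam).const_mul (2 * σ)
  have htot := (hbulk.sub harea).congr_of_eventuallyEq (f₁ := fun s => functionalJ lam d g σ α μ (Ac s) (Fc s))
    (h.pair.mono fun s hs => hs.functionalJ_eq hlam)
  refine htot.congr_deriv ?_
  set V := fluxField α (Ac 0) (fun y => A' y + grad (fun z => inner ℝ (Ac 0 z) (W z)) y) W
    (density g α μ (Ac 0)) with hVdef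
  have hsplit : ∀ k : V3 → ℝ, Continuous k → ∫ x in slabCell lam d, (fderiv ℝ (Fc 0) x).det *
      (div V (Fc 0 x) + k x) = (∫ x in slabCell lam d, (fderiv ℝ (Fc 0) x).det * div V (Fc 0 x)) +
        ∫ x in slabCell lam d, (fderiv ℝ (Fc 0) x).det * k x := by
    intro k hk
    simp only [mul_add]
    exact integral_add (integrableOn_slabCell (cdet.mul (cdiv.comp cF)))
      (integrableOn_slabCell (cdet.mul hk))
  rw [hsplit (fun x => 2 * inner ℝ (A' (Fc 0 x) + grad (fun z => inner ℝ (Ac 0 z) (W z)) (Fc 0 x))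
    (curl (curl (Ac 0)) (Fc 0 x) - α • curl (Ac 0) (Fc 0 x))) ((continuous_const (y := (2 : ℝ))).mul
    ((hC.continuous.comp cF).inner (((contDiff_curl cu (m := 0) (by norm_num)).continuous.comp cF).sub
      ((cu.continuous.comp cF).const_smul α)))), hF.integral_div hlam hd hV hper, hVdef]
  simp only [h.flux_top hW hw, h.flux_bottom hW hw, sub_zero]
  have cw : Continuous fun p => inner ℝ (w (lift p 0)) (surfCross (Fc 0) p) :=
    (h.contDiff_w.continuous.comp (contDiff_lift (n := 0) 0).continuous).inner
      hF.contDiff_surfCross.continuous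
  have cS := hF.contDiff_surf.continuous
  have hsplit2 : ∀ k : V2 → ℝ, Continuous k → ∫ p in cell lam,
      (k p + 4 * σ * (meanCurv (Fc 0) p * inner ℝ (w (lift p 0)) (surfCross (Fc 0) p))) =
      (∫ p in cell lam, k p) + 4 * σ * ∫ p in cell lam,
        meanCurv (Fc 0) p * inner ℝ (w (lift p 0)) (surfCross (Fc 0) p) := by
    intro k hk
    rw [← integral_const_mul]
    exact integral_add (integrableOn_cell hk)
      ((integrableOn_cell (hF.continuous_meanCurv.mul cw)).const_mul (4 * σ))
  have e : 2 * ∫ p in cell lam, (‖curl (Ac 0) (surf (Fc 0) p)‖ ^ 2 / 2 + g * surf (Fc 0) p 2 -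
        2 * σ * meanCurv (Fc 0) p + μ / 2) * inner ℝ (w (lift p 0)) (surfCross (Fc 0) p) =
      -∫ p in cell lam, (-(‖curl (Ac 0) (surf (Fc 0) p)‖ ^ 2 + 2 * g * surf (Fc 0) p 2 + μ) *
      inner ℝ (w (lift p 0)) (surfCross (Fc 0) p) + 4 * σ *
        (meanCurv (Fc 0) p * inner ℝ (w (lift p 0)) (surfCross (Fc 0) p))) := by
    rw [← integral_const_mul, ← integral_neg]
    congr 1; funext p; ring
  rw [e, hsplit2 (fun p => -(‖curl (Ac 0) (surf (Fc 0) p)‖ ^ 2 +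
    2 * g * surf (Fc 0) p 2 + μ) * inner ℝ (w (lift p 0)) (surfCross (Fc 0) p)) ((((((cu.continuous.comp cS).norm.pow 2).add
    ((continuous_const (y := 2 * g)).mul (contDiff_coord hF.contDiff_surf 2).continuous)).add
      (continuous_const (y := μ))).neg).mul cw)]
  ring

end IsVariation

/-! ### Hölder bounds -/

section holder
variable {E E₁ E₂ : Type} [NormedAddCommGroup E] [NormedSpace ℝ E]
  [NormedAddCommGroup E₁] [NormedSpace ℝ E₁] [NormedAddCommGroup E₂] [NormedSpace ℝ E₂]

/-- The `C^{k,γ}` norm of `f` on `K` is at most `C`, for maps into an arbitrary normed space. -/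
def HolderLE (k : ℕ) (γ : ℝ) (K : Set V3) (f : V3 → E) (C : ℝ) : Prop :=
  ∀ j ≤ k, (∀ x ∈ K, ‖iteratedFDeriv ℝ j f x‖ ≤ C) ∧
    ∀ x ∈ K, ∀ y ∈ K, ‖iteratedFDeriv ℝ j f x - iteratedFDeriv ℝ j f y‖ ≤ C * dist x y ^ γ

lemma holderLE_iff {k : ℕ} {γ : ℝ} {K : Set V3} {f : V3 → V3} {C : ℝ} :
    HolderLE k γ K f C ↔ HolderBoundOn k γ K f C := Iff.rfl

variable {k : ℕ} {γ γ' : ℝ} {K : Set V3} {f g : V3 → E} {C D : ℝ}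

lemma norm_iteratedFDeriv_zero_sub (f : V3 → E) (x y : V3) :
    ‖iteratedFDeriv ℝ 0 f x - iteratedFDeriv ℝ 0 f y‖ = ‖f x - f y‖ := by
  rw [iteratedFDeriv_zero_eq_comp, Function.comp_apply, Function.comp_apply, ← map_sub,
    LinearIsometryEquiv.norm_map]

lemma norm_iteratedFDeriv_succ_sub (j : ℕ) (f : V3 → E) (x y : V3) :
    ‖iteratedFDeriv ℝ (j + 1) f x - iteratedFDeriv ℝ (j + 1) f y‖ =
      ‖iteratedFDeriv ℝ j (fderiv ℝ f) x - iteratedFDeriv ℝ j (fderiv ℝ f) y‖ := by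
  rw [← dist_eq_norm, ← dist_eq_norm, iteratedFDeriv_succ_eq_comp_right,
    iteratedFDeriv_succ_eq_comp_right]
  exact LinearIsometryEquiv.dist_map _ _ _

lemma holderLE_zero : HolderLE 0 γ K f C ↔
    (∀ x ∈ K, ‖f x‖ ≤ C) ∧ ∀ x ∈ K, ∀ y ∈ K, ‖f x - f y‖ ≤ C * dist x y ^ γ := by
  simp only [HolderLE, Nat.le_zero, forall_eq, norm_iteratedFDeriv_zero,
    norm_iteratedFDeriv_zero_sub]

/-- Recursion on the order: all product and composition estimates below are proved by induction
along it. -/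
lemma holderLE_succ : HolderLE (k + 1) γ K f C ↔
    HolderLE 0 γ K f C ∧ HolderLE k γ K (fderiv ℝ f) C := by
  constructor
  · intro h
    refine ⟨fun j hj => h j (hj.trans (Nat.zero_le _)), fun j hj => ?_⟩
    have := h (j + 1) (by omega)
    simpa only [norm_iteratedFDeriv_fderiv, norm_iteratedFDeriv_succ_sub] using this
  · rintro ⟨h0, h1⟩ j hj
    cases j with
    | zero => exact h0 0 le_rfl
    | succ j =>
      have := h1 j (by omega)
      simpa only [norm_iteratedFDeriv_fderiv, norm_iteratedFDeriv_succ_sub] using this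

lemma HolderLE.mono {C' : ℝ} (h : HolderLE k γ K f C) (hC : C ≤ C') : HolderLE k γ K f C' :=
  fun j hj => ⟨fun x hx => ((h j hj).1 x hx).trans hC, fun x hx y hy =>
    ((h j hj).2 x hx y hy).trans
      (mul_le_mul_of_nonneg_right hC (Real.rpow_nonneg dist_nonneg _))⟩

lemma HolderLE.of_le {j : ℕ} (h : HolderLE k γ K f C) (hj : j ≤ k) : HolderLE j γ K f C :=
  fun i hi => h i (hi.trans hj)

lemma HolderLE.congr_fun (h : HolderLE k γ K f C) (hfg : ∀ x, f x = g x) : HolderLE k γ K g C := by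
  rwa [← funext hfg]

/-- Interpolation between a sup bound and a Hölder bound. -/
lemma le_rpow_of_le_of_le {a M r γ γ' : ℝ} (hr : 0 ≤ r) (hM : 0 ≤ M) (hγ' : 0 < γ') (hγ : γ' ≤ γ)
    (h1 : a ≤ 2 * M) (h2 : a ≤ M * r ^ γ) : a ≤ 2 * M * r ^ γ' := by
  rcases le_total r 1 with h | h
  · have h3 : r ^ γ ≤ r ^ γ' := by
      rcases hr.eq_or_lt with rfl | hr
      · rw [Real.zero_rpow hγ'.ne', Real.zero_rpow (hγ'.trans_le hγ).ne']
      · exact Real.rpow_le_rpow_of_exponent_ge hr h hγ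
    have h4 : 0 ≤ r ^ γ' := Real.rpow_nonneg hr _
    nlinarith
  · have : 1 ≤ r ^ γ' := Real.one_le_rpow h hγ'.le
    nlinarith

/-- Lowering the Hölder exponent: distances `≤ 1` are controlled by the larger exponent, distances
`≥ 1` by the sup bound. -/
lemma HolderLE.exponent (hγ' : 0 < γ') (hγ : γ' ≤ γ) (hC : 0 ≤ C) (h : HolderLE k γ K f C) :
    HolderLE k γ' K f (2 * C) := by
  intro j hj
  obtain ⟨h1, h2⟩ := h j hj
  refine ⟨fun x hx => (h1 x hx).trans (by linarith), fun x hx y hy => ?_⟩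
  exact le_rpow_of_le_of_le dist_nonneg hC hγ' hγ
    ((norm_sub_le _ _).trans (by linarith [h1 x hx, h1 y hy])) (h2 x hx y hy)

lemma holderLE_add (hf : ContDiff ℝ k f) (hg : ContDiff ℝ k g) (h1 : HolderLE k γ K f C)
    (h2 : HolderLE k γ K g D) : HolderLE k γ K (fun x => f x + g x) (C + D) := by
  intro j hj
  have e : ∀ x, iteratedFDeriv ℝ j (fun x => f x + g x) x =
      iteratedFDeriv ℝ j f x + iteratedFDeriv ℝ j g x := fun x =>
    iteratedFDeriv_add_apply (hf.of_le (by exact_mod_cast hj)).contDiffAt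
      (hg.of_le (by exact_mod_cast hj)).contDiffAt
  simp only [e]
  refine ⟨fun x hx => (norm_add_le _ _).trans (add_le_add ((h1 j hj).1 x hx) ((h2 j hj).1 x hx)),
    fun x hx y hy => ?_⟩
  rw [add_sub_add_comm, add_mul]
  exact (norm_add_le _ _).trans (add_le_add ((h1 j hj).2 x hx y hy) ((h2 j hj).2 x hx y hy))

lemma holderLE_const_smul (a : ℝ) (hf : ContDiff ℝ k f) (h1 : HolderLE k γ K f C) :
    HolderLE k γ K (fun x => a • f x) (|a| * C) := by
  intro j hj
  have e : ∀ x, iteratedFDeriv ℝ j (fun x => a • f x) x = a • iteratedFDeriv ℝ j f x := fun x =>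
    iteratedFDeriv_const_smul_apply (hf.of_le (by exact_mod_cast hj)).contDiffAt
  simp only [e, ← smul_sub, norm_smul, Real.norm_eq_abs]
  refine ⟨fun x hx => mul_le_mul_of_nonneg_left ((h1 j hj).1 x hx) (abs_nonneg _),
    fun x hx y hy => ?_⟩
  rw [mul_assoc]
  exact mul_le_mul_of_nonneg_left ((h1 j hj).2 x hx y hy) (abs_nonneg _)

lemma holderLE_const (c : E) : HolderLE k γ K (fun _ => c) ‖c‖ := by
  induction k generalizing E with
  | zero =>
    rw [holderLE_zero]
    refine ⟨fun x _ => le_rfl, fun x _ y _ => ?_⟩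
    rw [sub_self, norm_zero]; positivity
  | succ k ih =>
    rw [holderLE_succ]
    refine ⟨?_, ?_⟩
    · rw [holderLE_zero]
      refine ⟨fun x _ => le_rfl, fun x _ y _ => ?_⟩
      rw [sub_self, norm_zero]; positivity
    · have := (ih (0 : V3 →L[ℝ] E)).mono (C' := ‖c‖) (by simp)
      exact this.congr_fun fun x => by simp

lemma holderLE_zero_fun (hC : 0 ≤ C) : HolderLE k γ K (fun _ => (0 : E)) C :=
  (holderLE_const (0 : E)).mono (by simpa using hC)

lemma holderLE_bilin_zero (B : E₁ →L[ℝ] E₂ →L[ℝ] E) {f : V3 → E₁} {g : V3 → E₂}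
    (hC : 0 ≤ C) (hD : 0 ≤ D) (h1 : HolderLE 0 γ K f C) (h2 : HolderLE 0 γ K g D) :
    HolderLE 0 γ K (fun x => B (f x) (g x)) (2 * ‖B‖ * C * D) := by
  rw [holderLE_zero] at *
  have hb : 0 ≤ ‖B‖ * C * D := by positivity
  refine ⟨fun x hx => ?_, fun x hx y hy => ?_⟩
  · calc ‖B (f x) (g x)‖ ≤ ‖B‖ * ‖f x‖ * ‖g x‖ := B.le_opNorm₂ _ _
      _ ≤ ‖B‖ * C * D := by gcongr; exacts [h1.1 x hx, h2.1 x hx]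
      _ ≤ _ := by linarith
  · have e : B (f x) (g x) - B (f y) (g y) = B (f x - f y) (g x) + B (f y) (g x - g y) := by
      simp only [map_sub, sub_apply]; abel
    rw [e]
    calc _ ≤ ‖B (f x - f y) (g x)‖ + ‖B (f y) (g x - g y)‖ := norm_add_le _ _
      _ ≤ ‖B‖ * ‖f x - f y‖ * ‖g x‖ + ‖B‖ * ‖f y‖ * ‖g x - g y‖ :=
        add_le_add (B.le_opNorm₂ _ _) (B.le_opNorm₂ _ _)
      _ ≤ ‖B‖ * (C * dist x y ^ γ) * D + ‖B‖ * C * (D * dist x y ^ γ) := by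
        gcongr
        exacts [h1.2 x hx y hy, h2.1 x hx, h1.1 y hy, h2.2 x hx y hy]
      _ = _ := by ring

/-- Leibniz rule for a bounded bilinear map. The spaces vary in the induction, since the derivative
of `B(f, g)` is a sum of two bilinear expressions with values in spaces of linear maps. -/
lemma holderLE_bilin (k : ℕ) {E E₁ E₂ : Type} [NormedAddCommGroup E] [NormedSpace ℝ E]
    [NormedAddCommGroup E₁] [NormedSpace ℝ E₁] [NormedAddCommGroup E₂] [NormedSpace ℝ E₂]
    (B : E₁ →L[ℝ] E₂ →L[ℝ] E) {f : V3 → E₁} {g : V3 → E₂}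
    (hf : ContDiff ℝ k f) (hg : ContDiff ℝ k g) (hC : 0 ≤ C) (hD : 0 ≤ D)
    (h1 : HolderLE k γ K f C) (h2 : HolderLE k γ K g D) :
    HolderLE k γ K (fun x => B (f x) (g x)) (2 ^ (k + 1) * ‖B‖ * C * D) := by
  induction k generalizing E E₁ E₂ with
  | zero => simpa using holderLE_bilin_zero B hC hD h1 h2
  | succ k ih =>
    have h10 := holderLE_succ.1 h1
    have h20 := holderLE_succ.1 h2
    have hb : 0 ≤ ‖B‖ * C * D := by positivity
    rw [holderLE_succ]
    constructor
    · refine (holderLE_bilin_zero B hC hD h10.1 h20.1).mono ?_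
      have h3 : (2 : ℝ) ≤ 2 ^ (k + 1 + 1) := by
        calc (2 : ℝ) = 2 ^ 1 := by norm_num
          _ ≤ _ := pow_le_pow_right₀ (by norm_num) (by omega)
      calc 2 * ‖B‖ * C * D = 2 * (‖B‖ * C * D) := by ring
        _ ≤ 2 ^ (k + 1 + 1) * (‖B‖ * C * D) := by gcongr
        _ = _ := by ring
    · have hne : ((k + 1 : ℕ) : WithTop ℕ∞) ≠ 0 := by exact_mod_cast Nat.succ_ne_zero k
      have df := hf.differentiable hne
      have dg := hg.differentiable hne
      have hf' : ContDiff ℝ k (fderiv ℝ f) := hf.fderiv_right (by exact_mod_cast le_rfl)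
      have hg' : ContDiff ℝ k (fderiv ℝ g) := hg.fderiv_right (by exact_mod_cast le_rfl)
      have hfk : ContDiff ℝ k f := hf.of_le (by exact_mod_cast Nat.le_succ k)
      have hgk : ContDiff ℝ k g := hg.of_le (by exact_mod_cast Nat.le_succ k)
      have i1 := ih (B.precompR V3) hfk hg' (h1.of_le (Nat.le_succ k)) h20.2
      have i2 := ih (B.precompL V3) hf' hgk h10.2 (h2.of_le (Nat.le_succ k))
      have c1 : ContDiff ℝ k (fun x => B.precompR V3 (f x) (fderiv ℝ g x)) := by
        have h0 : ContDiff ℝ k (B.precompR V3) := by apply ContinuousLinearMap.contDiff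
        have c : ContDiff ℝ k (fun x => B.precompR V3 (f x)) :=
          h0.comp hfk
        exact c.clm_apply hg'
      have c2 : ContDiff ℝ k (fun x => B.precompL V3 (fderiv ℝ f x) (g x)) := by
        have h0 : ContDiff ℝ k (B.precompL V3) := by apply ContinuousLinearMap.contDiff
        have c : ContDiff ℝ k (fun x => B.precompL V3 (fderiv ℝ f x)) :=
          h0.comp hf'
        exact c.clm_apply hgk
      refine ((holderLE_add c1 c2 i1 i2).congr_fun fun x => ?_).mono ?_
      · exact (B.fderiv_of_bilinear (df x) (dg x)).symm
      · have n1 := B.norm_precompR_le V3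
        have n2 := B.norm_precompL_le V3
        have key : ∀ a b e : ℝ, a ≤ e → b ≤ e →
            2 ^ (k + 1) * a * C * D + 2 ^ (k + 1) * b * C * D ≤ 2 ^ (k + 1 + 1) * e * C * D := by
          intro a b e ha hb
          calc _ ≤ 2 ^ (k + 1) * e * C * D + 2 ^ (k + 1) * e * C * D := by gcongr
            _ = _ := by ring
        exact key _ _ _ n1 n2

/-- Composition with an inner map whose derivative is Hölder, with uniform constants. -/
lemma holderLE_comp (k : ℕ) (hγ : 0 < γ) (hC : 0 ≤ C) (hD : 0 ≤ D) :
    ∃ C', 0 ≤ C' ∧ ∀ {E : Type} [NormedAddCommGroup E] [NormedSpace ℝ E] (f : V3 → E) (Ψ : V3 → V3),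
      ContDiff ℝ k f → ContDiff ℝ k Ψ → HolderLE k γ univ f C →
      (∀ x ∈ K, ∀ y ∈ K, ‖Ψ x - Ψ y‖ ≤ D * ‖x - y‖) →
      (∀ j < k, HolderLE j γ K (fderiv ℝ Ψ) D) → HolderLE k γ K (fun x => f (Ψ x)) C' := by
  have zero : ∀ {E : Type} [NormedAddCommGroup E] [NormedSpace ℝ E] (f : V3 → E) (Ψ : V3 → V3),
      HolderLE 0 γ univ f C → (∀ x ∈ K, ∀ y ∈ K, ‖Ψ x - Ψ y‖ ≤ D * ‖x - y‖) →
      HolderLE 0 γ K (fun x => f (Ψ x)) (C + C * D ^ γ) := by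
    intro E _ _ f Ψ hf hΨ
    rw [holderLE_zero] at hf ⊢
    have hDg : 0 ≤ D ^ γ := Real.rpow_nonneg hD _
    refine ⟨fun x _ => (hf.1 _ (mem_univ _)).trans ?_, fun x hx y hy => ?_⟩
    · have := mul_nonneg hC hDg; linarith
    · refine (hf.2 _ (mem_univ _) _ (mem_univ _)).trans ?_
      have h1 : dist (Ψ x) (Ψ y) ^ γ ≤ (D * dist x y) ^ γ := by
        refine Real.rpow_le_rpow dist_nonneg ?_ hγ.le
        rw [dist_eq_norm, dist_eq_norm]; exact hΨ x hx y hy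
      rw [Real.mul_rpow hD dist_nonneg] at h1
      calc C * dist (Ψ x) (Ψ y) ^ γ ≤ C * (D ^ γ * dist x y ^ γ) := by gcongr
        _ = C * D ^ γ * dist x y ^ γ := by ring
        _ ≤ _ := by
          have : 0 ≤ dist x y ^ γ := Real.rpow_nonneg dist_nonneg _
          nlinarith
  have hpos : 0 ≤ C + C * D ^ γ := by
    have := mul_nonneg hC (Real.rpow_nonneg hD γ); linarith
  induction k with
  | zero =>
    exact ⟨_, hpos, fun f Ψ _ _ hf hΨ _ => zero f Ψ hf hΨ⟩
  | succ k ih =>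
    obtain ⟨C', hC', h⟩ := ih
    refine ⟨max (C + C * D ^ γ) (2 ^ (k + 1) * C' * D), le_max_of_le_left hpos, ?_⟩
    intro E _ _ f Ψ hf hΨ hfH hL hΨH
    have hfs := holderLE_succ.1 hfH
    have hne : ((k + 1 : ℕ) : WithTop ℕ∞) ≠ 0 := by exact_mod_cast Nat.succ_ne_zero k
    have hf' : ContDiff ℝ k (fderiv ℝ f) := hf.fderiv_right (by exact_mod_cast le_rfl)
    have hΨ' : ContDiff ℝ k (fderiv ℝ Ψ) := hΨ.fderiv_right (by exact_mod_cast le_rfl)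
    have hΨk : ContDiff ℝ k Ψ := hΨ.of_le (by exact_mod_cast Nat.le_succ k)
    have i1 := h (fderiv ℝ f) Ψ hf' hΨk hfs.2 hL fun j hj => hΨH j (hj.trans (Nat.lt_succ_self k))
    have i2 := holderLE_bilin k (ContinuousLinearMap.compL ℝ V3 V3 E) (hf'.comp hΨk) hΨ' hC' hD i1
      (hΨH k (Nat.lt_succ_self k))
    rw [holderLE_succ]
    refine ⟨(zero f Ψ hfs.1 hL).mono (le_max_left _ _), ?_⟩
    refine (i2.congr_fun fun x => ?_).mono (le_trans ?_ (le_max_right _ _))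
    · exact (fderiv_comp x (hf.differentiable hne _) (hΨ.differentiable hne x)).symm
    · have := ContinuousLinearMap.norm_compL_le ℝ V3 V3 E
      have key : ∀ a : ℝ, a ≤ 1 → 2 ^ (k + 1) * a * C' * D ≤ 2 ^ (k + 1) * C' * D := by
        intro a ha
        calc _ ≤ 2 ^ (k + 1) * 1 * C' * D := by gcongr
          _ = _ := by ring
      exact key _ this

end holder

/-! ### Families that are small or bounded in a Hölder norm -/

section families
variable {E E₁ E₂ : Type} [NormedAddCommGroup E] [NormedSpace ℝ E]
  [NormedAddCommGroup E₁] [NormedSpace ℝ E₁] [NormedAddCommGroup E₂] [NormedSpace ℝ E₂]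

/-- The family `h s` tends to zero in `C^{k,γ}` along the filter `l`. -/
def HolderSmall (k : ℕ) (γ : ℝ) (l : Filter ℝ) (h : ℝ → V3 → E) : Prop :=
  ∀ ε > 0, ∀ᶠ s in l, ContDiff ℝ k (h s) ∧ HolderLE k γ univ (h s) ε

/-- The family `h s` is eventually bounded in `C^{k,γ}` along the filter `l`. -/
def HolderBdd (k : ℕ) (γ : ℝ) (l : Filter ℝ) (h : ℝ → V3 → E) : Prop :=
  ∃ C, 0 ≤ C ∧ ∀ᶠ s in l, ContDiff ℝ k (h s) ∧ HolderLE k γ univ (h s) C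

variable {k : ℕ} {γ γ' : ℝ} {l : Filter ℝ}

lemma HolderSmall.congr {h h' : ℝ → V3 → E} (H : HolderSmall k γ l h)
    (e : ∀ᶠ s in l, h s = h' s) : HolderSmall k γ l h' := by
  intro ε hε
  filter_upwards [H ε hε, e] with s hs he
  rwa [← he]

lemma HolderSmall.mono_filter {l' : Filter ℝ} {h : ℝ → V3 → E} (H : HolderSmall k γ l h)
    (hl : l' ≤ l) : HolderSmall k γ l' h := fun ε hε => hl (H ε hε)

lemma HolderSmall.of_le {j : ℕ} {h : ℝ → V3 → E} (H : HolderSmall k γ l h)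
    (hj : j ≤ k) : HolderSmall j γ l h := fun ε hε => by
  filter_upwards [H ε hε] with s hs
  exact ⟨hs.1.of_le (by exact_mod_cast hj), hs.2.of_le hj⟩

lemma HolderSmall.add {h h' : ℝ → V3 → E} (H : HolderSmall k γ l h) (H' : HolderSmall k γ l h') :
    HolderSmall k γ l (fun s x => h s x + h' s x) := by
  intro ε hε
  filter_upwards [H (ε / 2) (by positivity), H' (ε / 2) (by positivity)] with s hs hs'
  exact ⟨hs.1.add hs'.1, (holderLE_add hs.1 hs'.1 hs.2 hs'.2).mono (by linarith)⟩

lemma HolderSmall.bilin_bdd (B : E₁ →L[ℝ] E₂ →L[ℝ] E) {h : ℝ → V3 → E₁} {h' : ℝ → V3 → E₂}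
    (H : HolderSmall k γ l h) (H' : HolderBdd k γ l h') :
    HolderSmall k γ l (fun s x => B (h s x) (h' s x)) := by
  obtain ⟨C, hC, H'⟩ := H'
  intro ε hε
  have hp : 0 < 2 ^ (k + 1) * ‖B‖ * C + 1 := by positivity
  have hδ : 0 < ε / (2 ^ (k + 1) * ‖B‖ * C + 1) := by positivity
  filter_upwards [H _ hδ, H'] with s hs hs'
  refine ⟨(B.contDiff.comp hs.1).clm_apply hs'.1,
    (holderLE_bilin k B hs.1 hs'.1 hδ.le hC hs.2 hs'.2).mono ?_⟩
  have : ε / (2 ^ (k + 1) * ‖B‖ * C + 1) * (2 ^ (k + 1) * ‖B‖ * C + 1) = ε := by field_simp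
  nlinarith

lemma HolderSmall.bdd_bilin (B : E₁ →L[ℝ] E₂ →L[ℝ] E) {h : ℝ → V3 → E₁} {h' : ℝ → V3 → E₂}
    (H : HolderBdd k γ l h) (H' : HolderSmall k γ l h') :
    HolderSmall k γ l (fun s x => B (h s x) (h' s x)) :=
  H'.bilin_bdd B.flip H

lemma holderBdd_const {C : ℝ} {f : V3 → E} (hf : ContDiff ℝ k f) (hC : 0 ≤ C)
    (h : HolderLE k γ univ f C) : HolderBdd k γ l (fun _ => f) :=
  ⟨C, hC, Eventually.of_forall fun _ => ⟨hf, h⟩⟩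

lemma HolderBdd.smul_tendsto_zero {r : ℝ → ℝ} {h : ℝ → V3 → E} (H : HolderBdd k γ l h)
    (hr : Tendsto r l (𝓝 0)) : HolderSmall k γ l (fun s x => r s • h s x) := by
  obtain ⟨C, hC, H⟩ := H
  intro ε hε
  have hδ : 0 < ε / (C + 1) := by positivity
  have h1 : ∀ᶠ s in l, |r s| < ε / (C + 1) := by
    have := Metric.tendsto_nhds.1 hr _ hδ
    simpa [Real.dist_eq] using this
  filter_upwards [h1, H] with s hs hs'
  refine ⟨hs'.1.const_smul _, (holderLE_const_smul _ hs'.1 hs'.2).mono ?_⟩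
  have : ε / (C + 1) * (C + 1) = ε := by field_simp
  nlinarith [abs_nonneg (r s)]

lemma HolderSmall.const_smul (a : ℝ) {h : ℝ → V3 → E} (H : HolderSmall k γ l h) :
    HolderSmall k γ l (fun s x => a • h s x) := by
  intro ε hε
  filter_upwards [H (ε / (|a| + 1)) (by positivity)] with s hs
  refine ⟨hs.1.const_smul _, (holderLE_const_smul _ hs.1 hs.2).mono ?_⟩
  have : ε / (|a| + 1) * (|a| + 1) = ε := by field_simp
  have h0 : 0 < ε / (|a| + 1) := by positivity
  nlinarith [abs_nonneg a]

lemma HolderSmall.succ {h : ℝ → V3 → E} (hd : ∀ᶠ s in l, Differentiable ℝ (h s))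
    (H : HolderSmall 0 γ l h) (H' : HolderSmall k γ l (fun s => fderiv ℝ (h s))) :
    HolderSmall (k + 1) γ l h := by
  intro ε hε
  filter_upwards [hd, H ε hε, H' ε hε] with s h1 h2 h3
  refine ⟨?_, holderLE_succ.2 ⟨h2.2, h3.2⟩⟩
  have := contDiff_succ_iff_fderiv (𝕜 := ℝ) (f := h s) (n := k)
  push_cast
  exact this.2 ⟨h1, by simp, h3.1⟩

/-- Interpolation between a sup bound `p` and a `γ`-Hölder bound `M r ^ γ`: the `γ'`-Hölder constant
is small when `p` is small and `M` is bounded. -/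
lemma le_interpolate {a p M r γ γ' : ℝ} (ha : 0 ≤ a) (hp : 0 ≤ p) (hM : 0 ≤ M) (hr : 0 ≤ r)
    (hγ' : 0 < γ') (hγ : γ' < γ) (h1 : a ≤ p) (h2 : a ≤ M * r ^ γ) :
    a ≤ p ^ (1 - γ' / γ) * M ^ (γ' / γ) * r ^ γ' := by
  have hγ0 : 0 < γ := hγ'.trans hγ
  have hθ : 0 < γ' / γ := by positivity
  have hθ1 : γ' / γ < 1 := (div_lt_one hγ0).2 hγ
  have e1 : a = a ^ (1 - γ' / γ) * a ^ (γ' / γ) := by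
    rw [← Real.rpow_add_of_nonneg ha (by linarith) hθ.le]; simp
  have e2 : (M * r ^ γ) ^ (γ' / γ) = M ^ (γ' / γ) * r ^ γ' := by
    rw [Real.mul_rpow hM (Real.rpow_nonneg hr _), ← Real.rpow_mul hr]
    congr 2; field_simp
  calc a = a ^ (1 - γ' / γ) * a ^ (γ' / γ) := e1
    _ ≤ p ^ (1 - γ' / γ) * (M * r ^ γ) ^ (γ' / γ) :=
      mul_le_mul (Real.rpow_le_rpow ha h1 (by linarith)) (Real.rpow_le_rpow ha h2 hθ.le)
        (Real.rpow_nonneg ha _) (Real.rpow_nonneg hp _)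
    _ = _ := by rw [e2]; ring

end families

/-! ### Transport by the maps `x - s ζ(x)` -/

section transport
variable {γ γ' : ℝ} {ζ : V3 → V3} {Z : ℝ}

/-- The map `x ↦ x - s ζ(x)`. -/
def shiftMap (ζ : V3 → V3) (s : ℝ) (x : V3) : V3 := x - s • ζ x

lemma contDiff_shiftMap {n : WithTop ℕ∞} (hζ : ContDiff ℝ n ζ) (s : ℝ) :
    ContDiff ℝ n (shiftMap ζ s) := contDiff_id.sub (hζ.const_smul s)

lemma hasFDerivAt_shiftMap (hζ : Differentiable ℝ ζ) (s : ℝ) (x : V3) :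
    HasFDerivAt (shiftMap ζ s) (ContinuousLinearMap.id ℝ V3 - s • fderiv ℝ ζ x) x :=
  (hasFDerivAt_id x).sub ((hζ x).hasFDerivAt.const_smul s)

lemma fderiv_shiftMap (hζ : Differentiable ℝ ζ) (s : ℝ) :
    fderiv ℝ (shiftMap ζ s) = fun x => ContinuousLinearMap.id ℝ V3 + (-s) • fderiv ℝ ζ x := by
  funext x
  rw [(hasFDerivAt_shiftMap hζ s x).fderiv]
  ext v
  simp [sub_eq_add_neg]

lemma holderLE_fderiv_shiftMap {k : ℕ} (hζ : ContDiff ℝ (k + 1) ζ)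
    (hZ : HolderLE (k + 1) γ univ ζ Z) (s : ℝ) :
    HolderLE k γ univ (fderiv ℝ (shiftMap ζ s)) (1 + |s| * Z) := by
  have hd : Differentiable ℝ ζ := hζ.differentiable (by simp)
  have hf : ContDiff ℝ k (fderiv ℝ ζ) := hζ.fderiv_right le_rfl
  rw [fderiv_shiftMap hd]
  refine (holderLE_add contDiff_const (hf.const_smul (-s))
    (holderLE_const (ContinuousLinearMap.id ℝ V3)) (holderLE_const_smul (-s) hf
      (holderLE_succ.1 hZ).2)).mono ?_
  rw [abs_neg]
  have := ContinuousLinearMap.norm_id_le (𝕜 := ℝ) (E := V3)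
  linarith

lemma norm_shiftMap_sub_le (hζ : Differentiable ℝ ζ) (hZ : HolderLE 1 γ univ ζ Z) (s : ℝ)
    (x y : V3) : ‖shiftMap ζ s x - shiftMap ζ s y‖ ≤ (1 + |s| * Z) * ‖x - y‖ := by
  refine Convex.norm_image_sub_le_of_norm_hasFDerivWithin_le (s := univ)
    (fun z _ => (hasFDerivAt_shiftMap hζ s z).hasFDerivWithinAt) (fun z _ => ?_) convex_univ
    (mem_univ _) (mem_univ _)
  have h1 := ((holderLE_zero.1 (holderLE_succ.1 hZ).2).1 z (mem_univ _))
  calc ‖ContinuousLinearMap.id ℝ V3 - s • fderiv ℝ ζ z‖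
      ≤ ‖ContinuousLinearMap.id ℝ V3‖ + ‖s • fderiv ℝ ζ z‖ := norm_sub_le _ _
    _ ≤ 1 + |s| * Z := by
      rw [norm_smul, Real.norm_eq_abs]
      gcongr
      exact ContinuousLinearMap.norm_id_le

/-- Composition with `x - s ζ(x)` stays in the Hölder class, locally uniformly in `s`. -/
lemma holderLE_comp_shiftMap {E : Type} [NormedAddCommGroup E] [NormedSpace ℝ E] {k : ℕ}
    (hγ : 0 < γ) (hζ : ContDiff ℝ (k + 1) ζ)
    (hZ0 : 0 ≤ Z) (hZ : HolderLE (k + 1) γ univ ζ Z) {f : V3 → E} (hf : ContDiff ℝ k f) {C : ℝ}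
    (hC : 0 ≤ C) (hfC : HolderLE k γ univ f C) (R : ℝ) (hR : 0 ≤ R) :
    ∃ C', 0 ≤ C' ∧ ∀ s, |s| ≤ R → HolderLE k γ univ (fun x => f (shiftMap ζ s x)) C' := by
  have hd : Differentiable ℝ ζ := hζ.differentiable (by simp)
  obtain ⟨C', h0, h⟩ := holderLE_comp (K := univ) (γ := γ) (C := C) (D := 1 + R * Z) k hγ hC
    (by positivity)
  refine ⟨C', h0, fun s hs => h f _ hf ((contDiff_shiftMap hζ s).of_le ?_) hfC ?_ ?_⟩
  · exact_mod_cast Nat.le_succ k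
  · intro x _ y _
    refine (norm_shiftMap_sub_le hd (hZ.of_le (by omega)) s x y).trans ?_
    gcongr
  · intro j hj
    refine ((holderLE_fderiv_shiftMap hζ hZ s).of_le hj.le).mono ?_
    gcongr

/-- Composition with `x - s ζ(x)` depends continuously on `s` in weaker Hölder norms. In the norm of
exponent `γ` itself this fails in general, which is why admissible curves are only asked to be
continuous for `γ' < γ`. -/
lemma holderSmall_comp_shiftMap (hγ' : 0 < γ') (hγ : γ' < γ) (k : ℕ)
    (hζ : ContDiff ℝ (k + 1) ζ) (hZ0 : 0 ≤ Z) (hZ : HolderLE (k + 1) γ univ ζ Z)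
    {E : Type} [NormedAddCommGroup E] [NormedSpace ℝ E] {f : V3 → E} (hf : ContDiff ℝ k f) {C : ℝ}
    (hC : 0 ≤ C) (hfC : HolderLE k γ univ f C) (t : ℝ) :
    HolderSmall k γ' (𝓝 t) (fun s x => f (shiftMap ζ s x) - f (shiftMap ζ t x)) := by
  have hγ0 : 0 < γ := hγ'.trans hγ
  have hloc : ∀ᶠ s in 𝓝 t, |s| ≤ |t| + 1 := by
    have : ∀ᶠ s in 𝓝 t, |s| < |t| + 1 :=
      (continuous_abs.tendsto t).eventually (gt_mem_nhds (by linarith))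
    exact this.mono fun s hs => hs.le
  have hR : 0 ≤ |t| + 1 := by positivity
  -- order zero: the differences are uniformly small and bounded in `C^{0,γ}`; interpolate
  have zero : ∀ {E : Type} [NormedAddCommGroup E] [NormedSpace ℝ E] {f : V3 → E}
      (_ : Continuous f) (hfC : HolderLE 0 γ univ f C) (hζ : ContDiff ℝ 1 ζ)
      (hZ : HolderLE 1 γ univ ζ Z),
      HolderSmall 0 γ' (𝓝 t) (fun s x => f (shiftMap ζ s x) - f (shiftMap ζ t x)) := by
    intro E _ _ f hf hfC hζ hZ ε hε
    obtain ⟨M, hM0, hM⟩ := holderLE_comp_shiftMap (k := 0) hγ0 (by simpa using hζ) hZ0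
      (by simpa using hZ) (contDiff_zero.2 hf) hC hfC (|t| + 1) hR
    have lim : Tendsto (fun s : ℝ => C * (|s - t| * Z) ^ γ) (𝓝 t) (𝓝 0) := by
      have c : Continuous (fun s : ℝ => C * (|s - t| * Z) ^ γ) := by
        refine continuous_const.mul (Continuous.rpow_const (by fun_prop) fun _ => Or.inr hγ0.le)
      have := c.tendsto t
      simpa [Real.zero_rpow hγ0.ne'] using this
    have lim2 : Tendsto (fun s : ℝ => (2 * (C * (|s - t| * Z) ^ γ)) ^ (1 - γ' / γ) *
        (2 * M) ^ (γ' / γ)) (𝓝 t) (𝓝 0) := by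
      have hθ : 0 < 1 - γ' / γ := by
        have := (div_lt_one hγ0).2 hγ; linarith
      have := ((lim.const_mul 2).rpow_const (p := 1 - γ' / γ) (Or.inr hθ.le)).mul_const
        ((2 * M) ^ (γ' / γ))
      simpa [Real.zero_rpow hθ.ne'] using this
    have e1 := lim.eventually (gt_mem_nhds hε)
    have e2 := lim2.eventually (gt_mem_nhds hε)
    filter_upwards [e1, e2, hloc] with s h1 h2 h3
    have cs : ∀ s, Continuous fun x => f (shiftMap ζ s x) := fun s =>
      hf.comp (contDiff_shiftMap hζ s).continuous
    refine ⟨contDiff_zero.2 ((cs s).sub (cs t)), ?_⟩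
    have hs := holderLE_zero.1 (hM s h3)
    have ht := holderLE_zero.1 (hM t (by linarith))
    have hf' := holderLE_zero.1 hfC
    have hZ' := holderLE_zero.1 (hZ.of_le zero_le_one)
    have sup : ∀ x, ‖f (shiftMap ζ s x) - f (shiftMap ζ t x)‖ ≤ C * (|s - t| * Z) ^ γ := by
      intro x
      refine (hf'.2 _ (mem_univ _) _ (mem_univ _)).trans ?_
      gcongr
      rw [dist_eq_norm]
      have : shiftMap ζ s x - shiftMap ζ t x = (t - s) • ζ x := by
        simp only [shiftMap, sub_smul]; abel
      rw [this, norm_smul, Real.norm_eq_abs, abs_sub_comm]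
      gcongr
      exact hZ'.1 x (mem_univ _)
    rw [holderLE_zero]
    refine ⟨fun x _ => (sup x).trans h1.le, fun x _ y _ => ?_⟩
    refine (le_interpolate (norm_nonneg _) (p := 2 * (C * (|s - t| * Z) ^ γ)) (M := 2 * M)
      (r := dist x y) (by positivity) (by positivity) dist_nonneg hγ' hγ ?_ ?_).trans ?_
    · exact (norm_sub_le _ _).trans (by linarith [sup x, sup y])
    · rw [sub_sub_sub_comm]
      refine (norm_sub_le _ _).trans ?_
      have a1 := hs.2 x (mem_univ _) y (mem_univ _)
      have a2 := ht.2 x (mem_univ _) y (mem_univ _)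
      linarith
    · exact mul_le_mul_of_nonneg_right h2.le (Real.rpow_nonneg dist_nonneg _)
  induction k generalizing E with
  | zero => exact zero hf.continuous hfC (by simpa using hζ) (by simpa using hZ)
  | succ k ih =>
    have hd : Differentiable ℝ ζ := hζ.differentiable (by simp)
    have hζk : ContDiff ℝ (k + 1) ζ := hζ.of_le (by push_cast; exact self_le_add_right _ _)
    have hζ' : ContDiff ℝ (k + 1) (fderiv ℝ ζ) := hζ.fderiv_right (by push_cast; exact le_rfl)
    have hne : ((k + 1 : ℕ) : WithTop ℕ∞) ≠ 0 := by exact_mod_cast Nat.succ_ne_zero k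
    have df := hf.differentiable hne
    have hf' : ContDiff ℝ k (fderiv ℝ f) := hf.fderiv_right (by exact_mod_cast le_rfl)
    have hfs := holderLE_succ.1 hfC
    have hZs := (holderLE_succ.1 (hZ.of_le (by omega : k + 1 ≤ k + 1 + 1))).2
    have hdc : ∀ s, Differentiable ℝ fun x => f (shiftMap ζ s x) := fun s =>
      df.comp ((contDiff_shiftMap hζ s).differentiable (by simp))
    refine HolderSmall.succ (Eventually.of_forall fun s => (hdc s).sub (hdc t))
      (zero hf.continuous hfs.1 (hζ.of_le (by push_cast; exact le_add_self))
        (hZ.of_le (by omega))) ?_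
    have i1 := ih hζk (hZ.of_le (by omega)) hf' hfs.2
    have b1 : HolderBdd k γ' (𝓝 t) (fun s => fderiv ℝ (shiftMap ζ s)) := by
      refine ⟨2 * (1 + (|t| + 1) * Z), by positivity, ?_⟩
      filter_upwards [hloc] with s hs
      refine ⟨?_, ((holderLE_fderiv_shiftMap hζk (hZ.of_le (by omega)) s).mono ?_).exponent
        hγ' hγ.le (by positivity)⟩
      · exact (contDiff_shiftMap hζk s).fderiv_right le_rfl
      · gcongr
    have b2 : HolderBdd k γ' (𝓝 t) (fun _ x => fderiv ℝ f (shiftMap ζ t x)) := by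
      obtain ⟨M, hM0, hM⟩ := holderLE_comp_shiftMap hγ0 hζk hZ0 (hZ.of_le (by omega)) hf' hC hfs.2
        (|t| + 1) hR
      refine holderBdd_const (hf'.comp ((contDiff_shiftMap hζk t).of_le ?_)) (C := 2 * M)
        (by positivity) ((hM t (by linarith)).exponent hγ' hγ.le hM0)
      exact_mod_cast Nat.le_succ k
    have s2 : HolderSmall k γ' (𝓝 t) (fun s x => (t - s) • fderiv ℝ ζ x) := by
      have hb : HolderBdd k γ' (𝓝 t) (fun _ => fderiv ℝ ζ) :=
        holderBdd_const (hζ'.of_le (by exact_mod_cast Nat.le_succ k)) (by positivity)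
          (hZs.exponent hγ' hγ.le hZ0)
      refine hb.smul_tendsto_zero (r := fun s => t - s) ?_
      have : Tendsto (fun s : ℝ => t - s) (𝓝 t) (𝓝 (t - t)) :=
        (continuous_const.sub continuous_id).tendsto t
      simpa using this
    -- chain rule: `Df(Ψ_s) DΨ_s - Df(Ψ_t) DΨ_t = (Df(Ψ_s) - Df(Ψ_t)) DΨ_s + Df(Ψ_t) (DΨ_s - DΨ_t)`
    refine ((i1.bilin_bdd (ContinuousLinearMap.compL ℝ V3 V3 E) b1).add
      (HolderSmall.bdd_bilin (ContinuousLinearMap.compL ℝ V3 V3 E) b2 s2)).congr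
      (Eventually.of_forall fun s => ?_)
    funext x
    have dψ : ∀ s, fderiv ℝ (fun x => f (shiftMap ζ s x)) x =
        (fderiv ℝ f (shiftMap ζ s x)).comp (fderiv ℝ (shiftMap ζ s) x) := fun s =>
      fderiv_comp x (df _) (hasFDerivAt_shiftMap hd s x).differentiableAt
    have e : (t - s) • fderiv ℝ ζ x = fderiv ℝ (shiftMap ζ s) x - fderiv ℝ (shiftMap ζ t) x := by
      rw [fderiv_shiftMap hd, fderiv_shiftMap hd]
      refine ContinuousLinearMap.ext fun v => ?_
      change (t - s) • fderiv ℝ ζ x v =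
        (v + (-s) • fderiv ℝ ζ x v) - (v + (-t) • fderiv ℝ ζ x v)
      module
    rw [fderiv_fun_sub (hdc s x) (hdc t x), dψ, dψ, e]
    simp only [ContinuousLinearMap.compL_apply]
    ext v
    simp

end transport

/-! ### Differentiability of curves in Hölder norms -/

section slopes
variable {E : Type} [NormedAddCommGroup E] [NormedSpace ℝ E] {γ γ' : ℝ}

/-- A family whose pointwise derivative is continuous in `C^{0,γ}` is differentiable in that norm:
mean value inequality. -/
lemma holderSmall_slope_zero {g g' : ℝ → V3 → E} {t : ℝ} (hg : ∀ s, Continuous (g s))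
    (hg' : ∀ s, Continuous (g' s)) (hd : ∀ s x, HasDerivAt (fun s => g s x) (g' s x) s)
    (h : HolderSmall 0 γ (𝓝 t) (fun s x => g' s x - g' t x)) :
    HolderSmall 0 γ (𝓝[≠] t) (fun s x => (s - t)⁻¹ • (g s x - g t x) - g' t x) := by
  intro ε hε
  obtain ⟨δ, hδ, H⟩ := Metric.eventually_nhds_iff_ball.1 (h ε hε)
  have hball : ∀ᶠ s in 𝓝[≠] t, s ∈ Metric.ball t δ :=
    nhdsWithin_le_nhds (Metric.ball_mem_nhds t hδ)
  filter_upwards [hball, self_mem_nhdsWithin] with s hs hst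
  have hst' : s - t ≠ 0 := sub_ne_zero.2 hst
  refine ⟨contDiff_zero.2 ((((hg s).sub (hg t)).const_smul _).sub (hg' t)), holderLE_zero.2 ?_⟩
  -- used for `φ = g · x` and, for the Hölder seminorm, for `φ = g · x - g · y`
  have key : ∀ (φ φ' : ℝ → E) (c : ℝ), (∀ τ, HasDerivAt φ (φ' τ) τ) →
      (∀ τ ∈ Metric.ball t δ, ‖φ' τ - φ' t‖ ≤ c) →
      ‖(s - t)⁻¹ • (φ s - φ t) - φ' t‖ ≤ c := by
    intro φ φ' c h1 h2
    have hd1 : ∀ τ, HasDerivAt (fun τ => φ τ - τ • φ' t) (φ' τ - φ' t) τ := fun τ => by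
      have := (h1 τ).fun_sub ((hasDerivAt_id τ).smul_const (φ' t))
      simpa using this
    have := Convex.norm_image_sub_le_of_norm_hasDerivWithin_le (s := Metric.ball t δ)
      (fun τ _ => (hd1 τ).hasDerivWithinAt) h2 (convex_ball t δ) (Metric.mem_ball_self hδ) hs
    have e : (s - t)⁻¹ • (φ s - φ t) - φ' t =
        (s - t)⁻¹ • ((φ s - s • φ' t) - (φ t - t • φ' t)) := by
      have e1 : (φ s - s • φ' t) - (φ t - t • φ' t) = (φ s - φ t) - (s - t) • φ' t := by
        rw [sub_smul]; abel
      rw [e1, smul_sub (s - t)⁻¹ (φ s - φ t), smul_smul, inv_mul_cancel₀ hst', one_smul]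
    rw [e, norm_smul, norm_inv]
    calc ‖s - t‖⁻¹ * _ ≤ ‖s - t‖⁻¹ * (c * ‖s - t‖) := by gcongr
      _ = c := by field_simp
  constructor
  · intro x _
    exact key (fun τ => g τ x) (fun τ => g' τ x) ε (fun τ => hd τ x) fun τ hτ =>
      (holderLE_zero.1 (H τ hτ).2).1 x (mem_univ _)
  · intro x _ y _
    have := key (fun τ => g τ x - g τ y) (fun τ => g' τ x - g' τ y) (ε * dist x y ^ γ)
      (fun τ => (hd τ x).sub (hd τ y)) fun τ hτ => by
        rw [sub_sub_sub_comm]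
        exact (holderLE_zero.1 (H τ hτ).2).2 x (mem_univ _) y (mem_univ _)
    convert this using 2
    simp only [smul_sub]
    abel

/-- The same in `C^{1,γ}`, applied to the family and to its space derivatives. -/
lemma holderSmall_slope_one {g g' : ℝ → V3 → E} {t : ℝ} (hg : ∀ s, ContDiff ℝ 1 (g s))
    (hg' : ∀ s, ContDiff ℝ 1 (g' s)) (hd : ∀ s x, HasDerivAt (fun s => g s x) (g' s x) s)
    (hd1 : ∀ s x, HasDerivAt (fun s => fderiv ℝ (g s) x) (fderiv ℝ (g' s) x) s)
    (h : HolderSmall 1 γ (𝓝 t) (fun s x => g' s x - g' t x)) :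
    HolderSmall 1 γ (𝓝[≠] t) (fun s x => (s - t)⁻¹ • (g s x - g t x) - g' t x) := by
  have dg : ∀ s, Differentiable ℝ (g s) := fun s => (hg s).differentiable (by simp)
  have dg' : ∀ s, Differentiable ℝ (g' s) := fun s => (hg' s).differentiable (by simp)
  have cg : ∀ s, Continuous (fderiv ℝ (g s)) := fun s => (hg s).continuous_fderiv (by simp)
  have cg' : ∀ s, Continuous (fderiv ℝ (g' s)) := fun s => (hg' s).continuous_fderiv (by simp)
  have h1 : HolderSmall 0 γ (𝓝 t) (fun s x => fderiv ℝ (g' s) x - fderiv ℝ (g' t) x) := by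
    intro ε hε
    filter_upwards [h ε hε] with s hs
    refine ⟨contDiff_zero.2 ((cg' s).sub (cg' t)), (holderLE_succ.1 hs.2).2.congr_fun fun x => ?_⟩
    exact fderiv_fun_sub (dg' s x) (dg' t x)
  have s0 := holderSmall_slope_zero (fun s => (hg s).continuous) (fun s => (hg' s).continuous) hd
    (h.of_le zero_le_one)
  have s1 := holderSmall_slope_zero cg cg' hd1 h1
  refine HolderSmall.succ (k := 0) (Eventually.of_forall fun s => ?_) s0
    (s1.congr (Eventually.of_forall fun s => ?_))
  · exact (((dg s).sub (dg t)).const_smul _).sub (dg' t)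
  · funext x
    have e1 : DifferentiableAt ℝ (fun x => g s x - g t x) x := (dg s x).sub (dg t x)
    have e2 : DifferentiableAt ℝ (fun x => (s - t)⁻¹ • (g s x - g t x)) x := e1.const_smul _
    rw [fderiv_fun_sub e2 (dg' t x), fderiv_fun_const_smul e1, fderiv_fun_sub (dg s x) (dg t x)]

end slopes

/-! ### The transported potential -/

section potential
variable {γ γ' : ℝ} {ζ : V3 → V3} {Z : ℝ}

lemma hasDerivAt_comp_shiftMap {E : Type} [NormedAddCommGroup E] [NormedSpace ℝ E] {f : V3 → E}
    (hf : Differentiable ℝ f) (s : ℝ) (x : V3) :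
    HasDerivAt (fun s => f (shiftMap ζ s x)) (-(fderiv ℝ f (shiftMap ζ s x) (ζ x))) s := by
  have h1 : HasDerivAt (fun s : ℝ => shiftMap ζ s x) (-ζ x) s := by
    have := ((hasDerivAt_id s).smul_const (ζ x)).const_sub x
    rw [one_smul] at this
    exact this
  have := (hf (shiftMap ζ s x)).hasFDerivAt.comp_hasDerivAt s h1
  rw [map_neg] at this
  exact this

/-- The `s`-derivative of `f(x - s ζ(x))`. -/
noncomputable def shiftDeriv {E : Type} [NormedAddCommGroup E] [NormedSpace ℝ E] (ζ : V3 → V3)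
    (f : V3 → E)
    (s : ℝ) (x : V3) : E := -(fderiv ℝ f (shiftMap ζ s x) (ζ x))

lemma contDiff_shiftDeriv {E : Type} [NormedAddCommGroup E] [NormedSpace ℝ E] {f : V3 → E}
    {n : ℕ} (hζ : ContDiff ℝ n ζ) (hf : ContDiff ℝ (n + 1) f) (s : ℝ) :
    ContDiff ℝ n (shiftDeriv ζ f s) := by
  have h1 : ContDiff ℝ n (fderiv ℝ f) := hf.fderiv_right le_rfl
  exact ((h1.comp (contDiff_shiftMap hζ s)).clm_apply hζ).neg

/-- Exchange of the derivatives in `s` and in space for `f(x - s ζ(x))`. -/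
lemma hasDerivAt_fderiv_comp_shiftMap (hζ : ContDiff ℝ 1 ζ) {f : V3 → V3} (hf : ContDiff ℝ 2 f)
    (s : ℝ) (x : V3) :
    HasDerivAt (fun s => fderiv ℝ (fun x => f (shiftMap ζ s x)) x)
      (fderiv ℝ (shiftDeriv ζ f s) x) s := by
  have hd : Differentiable ℝ ζ := hζ.differentiable (by simp)
  have df : Differentiable ℝ f := hf.differentiable (by simp)
  have hf' : ContDiff ℝ 1 (fderiv ℝ f) := hf.fderiv_right (by norm_num)
  have df' : Differentiable ℝ (fderiv ℝ f) := hf'.differentiable (by simp)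
  have e1 : ∀ s, fderiv ℝ (fun x => f (shiftMap ζ s x)) x =
      (fderiv ℝ f (shiftMap ζ s x)).comp (ContinuousLinearMap.id ℝ V3 - s • fderiv ℝ ζ x) := by
    intro s
    exact ((df _).hasFDerivAt.comp x (hasFDerivAt_shiftMap hd s x)).fderiv
  simp only [e1]
  have h1 := hasDerivAt_comp_shiftMap (ζ := ζ) df' s x
  have h2 : HasDerivAt (fun s : ℝ => ContinuousLinearMap.id ℝ V3 - s • fderiv ℝ ζ x)
      (-(fderiv ℝ ζ x)) s := by
    simpa using ((hasDerivAt_id s).smul_const (fderiv ℝ ζ x)).const_sub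
      (ContinuousLinearMap.id ℝ V3)
  have h3 := h1.clm_comp h2
  refine h3.congr_deriv ?_
  have h4 : HasFDerivAt (fun x => fderiv ℝ f (shiftMap ζ s x))
      ((fderiv ℝ (fderiv ℝ f) (shiftMap ζ s x)).comp
        (ContinuousLinearMap.id ℝ V3 - s • fderiv ℝ ζ x)) x :=
    (df' _).hasFDerivAt.comp x (hasFDerivAt_shiftMap hd s x)
  have h5 := (h4.clm_apply (hd x).hasFDerivAt).neg
  have h6 : fderiv ℝ (shiftDeriv ζ f s) x = _ := h5.fderiv
  rw [h6]
  refine ContinuousLinearMap.ext fun v => ?_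
  -- symmetry of the second derivative
  have hs : IsSymmSndFDerivAt ℝ f (shiftMap ζ s x) :=
    hf.contDiffAt.isSymmSndFDerivAt (by simp)
  have := hs.eq (ζ x) (v - s • fderiv ℝ ζ x v)
  change -(fderiv ℝ (fderiv ℝ f) (shiftMap ζ s x) (ζ x) (v - s • fderiv ℝ ζ x v)) +
    fderiv ℝ f (shiftMap ζ s x) (-(fderiv ℝ ζ x v)) = -(fderiv ℝ f (shiftMap ζ s x) (fderiv ℝ ζ x v)
      + fderiv ℝ (fderiv ℝ f) (shiftMap ζ s x) (v - s • fderiv ℝ ζ x v) (ζ x))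
  rw [this, map_neg]
  abel

variable {e : V3} {η : V3 → ℝ}

/-- The potential `A∘Ψ_s - s ⟨A∘Ψ_s, e⟩ ∇η`, the pull-back of the one-form `A` under
`Ψ_s = id - s η e`. -/
noncomputable def transported (e : V3) (η : V3 → ℝ) (A : V3 → V3) (s : ℝ) (x : V3) : V3 :=
  A (shiftMap (fun y => η y • e) s x) -
    s • (inner ℝ (A (shiftMap (fun y => η y • e) s x)) e • grad η x)

/-- The `s`-derivative of `transported`. -/
noncomputable def transportedDeriv (e : V3) (η : V3 → ℝ) (A : V3 → V3) (s : ℝ) (x : V3) : V3 :=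
  shiftDeriv (fun y => η y • e) A s x -
    inner ℝ (A (shiftMap (fun y => η y • e) s x)) e • grad η x -
    s • (inner ℝ (shiftDeriv (fun y => η y • e) A s x) e • grad η x)

/-- The bilinear map `(a, b) ↦ ⟨a, e⟩ b`. -/
noncomputable def innerSmul (e : V3) : V3 →L[ℝ] V3 →L[ℝ] V3 :=
  (ContinuousLinearMap.smulRightL ℝ V3 V3 (innerSL ℝ e)).flip

lemma innerSmul_apply (e a b : V3) : innerSmul e a b = inner ℝ a e • b := by
  simp [innerSmul, real_inner_comm]

lemma transported_eq (A : V3 → V3) (s : ℝ) (x : V3) :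
    transported e η A s x = A (shiftMap (fun y => η y • e) s x) -
      s • innerSmul e (A (shiftMap (fun y => η y • e) s x)) (grad η x) := by
  rw [transported, innerSmul_apply]

lemma transportedDeriv_eq (A : V3 → V3) (s : ℝ) (x : V3) :
    transportedDeriv e η A s x = shiftDeriv (fun y => η y • e) A s x -
      innerSmul e (A (shiftMap (fun y => η y • e) s x)) (grad η x) -
      s • innerSmul e (shiftDeriv (fun y => η y • e) A s x) (grad η x) := by
  rw [transportedDeriv, innerSmul_apply, innerSmul_apply]

lemma transported_zero (A : V3 → V3) : transported e η A 0 = A := by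
  funext x; simp [transported, shiftMap]

section regularity
variable {A : V3 → V3} {C : ℝ} (hγ' : 0 < γ') (hγ : γ' < γ) (hη : ContDiff ℝ 4 η)
  (hZ0 : 0 ≤ Z) (hZ : HolderLE 3 γ univ (fun y => η y • e) Z)
  (hG : HolderLE 2 γ univ (grad η) Z) (hA : ContDiff ℝ 2 A) (hC : 0 ≤ C)
  (hAC : HolderLE 2 γ univ A C)
include hγ' hγ hη hZ0 hZ hG hA hC hAC

lemma memHolder_transported (s : ℝ) : MemHolder 2 γ (transported e η A s) := by
  have hζ : ContDiff ℝ 3 (fun y => η y • e) :=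
    (hη.of_le (by norm_num)).smul contDiff_const
  have hgr : ContDiff ℝ 2 (grad η) := contDiff_grad hη (by norm_num)
  obtain ⟨M, hM0, hM⟩ := holderLE_comp_shiftMap (k := 2) (hγ'.trans hγ)
    (hζ.of_le (by norm_num)) hZ0 hZ hA hC hAC |s| (abs_nonneg s)
  have hc : ContDiff ℝ 2 (fun x => A (shiftMap (fun y => η y • e) s x)) :=
    hA.comp (contDiff_shiftMap (hζ.of_le (by norm_num)) s)
  have h1 := holderLE_bilin (γ := γ) (K := univ) 2 (innerSmul e) hc hgr hM0 hZ0 (hM s le_rfl) hG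
  have c1 : ContDiff ℝ 2 (fun x => innerSmul e (A (shiftMap (fun y => η y • e) s x)) (grad η x)) :=
    ((innerSmul e).contDiff.comp hc).clm_apply hgr
  have h2 := holderLE_add hc (c1.const_smul (-s)) (hM s le_rfl) (holderLE_const_smul (-s) c1 h1)
  have e1 : transported e η A s = fun x => A (shiftMap (fun y => η y • e) s x) +
      (-s) • innerSmul e (A (shiftMap (fun y => η y • e) s x)) (grad η x) := by
    funext x; rw [transported_eq, neg_smul, sub_eq_add_neg]
  rw [e1]
  exact ⟨hc.add (c1.const_smul (-s)), _, h2⟩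

lemma memHolder_transportedDeriv (s : ℝ) : MemHolder 1 γ' (transportedDeriv e η A s) := by
  have hζ : ContDiff ℝ 3 (fun y => η y • e) :=
    (hη.of_le (by norm_num)).smul contDiff_const
  have hζ1 : ContDiff ℝ 1 (fun y => η y • e) := hζ.of_le (by norm_num)
  have hgr : ContDiff ℝ 1 (grad η) := contDiff_grad hη (by norm_num)
  have hA1 : ContDiff ℝ 1 A := hA.of_le (by norm_num)
  have hA' : ContDiff ℝ 1 (fderiv ℝ A) := hA.fderiv_right (by norm_num)
  obtain ⟨M, hM0, hM⟩ := holderLE_comp_shiftMap (k := 1) (hγ'.trans hγ)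
    (hζ.of_le (by norm_num)) hZ0 (hZ.of_le (by norm_num)) hA1 hC (hAC.of_le (by norm_num)) |s|
    (abs_nonneg s)
  obtain ⟨M', hM0', hM'⟩ := holderLE_comp_shiftMap (k := 1) (hγ'.trans hγ)
    (hζ.of_le (by norm_num)) hZ0 (hZ.of_le (by norm_num)) hA' hC (holderLE_succ.1 hAC).2 |s|
    (abs_nonneg s)
  have hc : ContDiff ℝ 1 (fun x => A (shiftMap (fun y => η y • e) s x)) :=
    hA1.comp (contDiff_shiftMap hζ1 s)
  have hc' : ContDiff ℝ 1 (fun x => fderiv ℝ A (shiftMap (fun y => η y • e) s x)) :=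
    hA'.comp (contDiff_shiftMap hζ1 s)
  have hd : HolderLE 1 γ univ (shiftDeriv (fun y => η y • e) A s) _ :=
    (holderLE_const_smul (-1) (hc'.clm_apply hζ1) (holderLE_bilin (γ := γ) (K := univ) 1
      (ContinuousLinearMap.id ℝ (V3 →L[ℝ] V3)) hc' hζ1 hM0' hZ0 (hM' s le_rfl)
      (hZ.of_le (by norm_num)))).congr_fun fun x => by simp [shiftDeriv]
  have cd : ContDiff ℝ 1 (shiftDeriv (fun y => η y • e) A s) := contDiff_shiftDeriv hζ1 hA s
  have h1 := holderLE_bilin (γ := γ) (K := univ) 1 (innerSmul e) hc hgr hM0 hZ0 (hM s le_rfl)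
    (hG.of_le (by norm_num))
  have c1 : ContDiff ℝ 1 (fun x => innerSmul e (A (shiftMap (fun y => η y • e) s x)) (grad η x)) :=
    ((innerSmul e).contDiff.comp hc).clm_apply hgr
  have h2 := holderLE_bilin (γ := γ) (K := univ) 1 (innerSmul e) cd hgr (by positivity) hZ0 hd
    (hG.of_le (by norm_num))
  have c2 : ContDiff ℝ 1
      (fun x => innerSmul e (shiftDeriv (fun y => η y • e) A s x) (grad η x)) :=
    ((innerSmul e).contDiff.comp cd).clm_apply hgr
  have h3 := holderLE_add (cd.add (c1.const_smul (-1 : ℝ))) (c2.const_smul (-s))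
    (holderLE_add cd (c1.const_smul (-1 : ℝ)) hd (holderLE_const_smul (-1) c1 h1))
    (holderLE_const_smul (-s) c2 h2)
  have e1 : transportedDeriv e η A s = fun x => shiftDeriv (fun y => η y • e) A s x +
      (-1 : ℝ) • innerSmul e (A (shiftMap (fun y => η y • e) s x)) (grad η x) +
      (-s) • innerSmul e (shiftDeriv (fun y => η y • e) A s x) (grad η x) := by
    funext x; rw [transportedDeriv_eq]; module
  rw [e1]
  exact ⟨(cd.add (c1.const_smul (-1 : ℝ))).add (c2.const_smul (-s)), _,
    h3.exponent hγ' hγ.le (by positivity)⟩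

lemma holderContinuousAt_transported (t : ℝ) :
    HolderContinuousAt 2 γ' univ (transported e η A) t := by
  have hζ : ContDiff ℝ 3 (fun y => η y • e) :=
    (hη.of_le (by norm_num)).smul contDiff_const
  have hgr : ContDiff ℝ 2 (grad η) := contDiff_grad hη (by norm_num)
  have hG' : HolderBdd 2 γ' (𝓝 t) (fun _ => grad η) :=
    holderBdd_const hgr (by positivity) (hG.exponent hγ' hγ.le hZ0)
  have s1 := holderSmall_comp_shiftMap hγ' hγ 2 (hζ.of_le (by norm_num)) hZ0 hZ hA hC hAC t
  have s2 := (s1.bilin_bdd (innerSmul e) hG').const_smul (-t)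
  have hb : HolderBdd 2 γ' (𝓝 t)
      (fun s x => innerSmul e (A (shiftMap (fun y => η y • e) s x)) (grad η x)) := by
    obtain ⟨M, hM0, hM⟩ := holderLE_comp_shiftMap (k := 2) (hγ'.trans hγ)
      (hζ.of_le (by norm_num)) hZ0 hZ hA hC hAC (|t| + 1) (by positivity)
    refine ⟨2 ^ (2 + 1) * ‖innerSmul e‖ * (2 * M) * (2 * Z), by positivity, ?_⟩
    have hloc : ∀ᶠ s in 𝓝 t, |s| < |t| + 1 :=
      (continuous_abs.tendsto t).eventually (gt_mem_nhds (by linarith))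
    filter_upwards [hloc] with s hs
    have hc : ContDiff ℝ 2 (fun x => A (shiftMap (fun y => η y • e) s x)) :=
      hA.comp (contDiff_shiftMap (hζ.of_le (by norm_num)) s)
    exact ⟨((innerSmul e).contDiff.comp hc).clm_apply hgr, holderLE_bilin 2 (innerSmul e) hc hgr
      (by positivity) (by positivity) ((hM s hs.le).exponent hγ' hγ.le hM0)
      (hG.exponent hγ' hγ.le hZ0)⟩
  have s3 := hb.smul_tendsto_zero (r := fun s => t - s) (by
    have : Tendsto (fun s : ℝ => t - s) (𝓝 t) (𝓝 (t - t)) :=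
      (continuous_const.sub continuous_id).tendsto t
    simpa using this)
  intro ε hε
  filter_upwards [((s1.add s2).add s3) ε hε] with s hs
  refine hs.2.congr_fun fun x => ?_
  rw [transported_eq, transported_eq, map_sub, sub_apply]
  module

lemma holderHasDerivAt_transported (t : ℝ) :
    HolderHasDerivAt 1 γ' univ (transported e η A) (transportedDeriv e η A t) t := by
  have hζ : ContDiff ℝ 3 (fun y => η y • e) :=
    (hη.of_le (by norm_num)).smul contDiff_const
  have hζ1 : ContDiff ℝ 1 (fun y => η y • e) := hζ.of_le (by norm_num)
  have hgr : ContDiff ℝ 1 (grad η) := contDiff_grad hη (by norm_num)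
  have hA1 : ContDiff ℝ 1 A := hA.of_le (by norm_num)
  have hA' : ContDiff ℝ 1 (fderiv ℝ A) := hA.fderiv_right (by norm_num)
  have hG' : HolderBdd 1 γ' (𝓝[≠] t) (fun _ => grad η) :=
    holderBdd_const hgr (by positivity) ((hG.of_le (by norm_num)).exponent hγ' hγ.le hZ0)
  have hζ' : HolderBdd 1 γ' (𝓝 t) (fun _ y => η y • e) :=
    holderBdd_const hζ1 (by positivity) ((hZ.of_le (by norm_num)).exponent hγ' hγ.le hZ0)
  have s0 := holderSmall_comp_shiftMap hγ' hγ 1 (hζ.of_le (by norm_num)) hZ0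
    (hZ.of_le (by norm_num)) hA1 hC (hAC.of_le (by norm_num)) t
  have s1 := holderSmall_comp_shiftMap hγ' hγ 1 (hζ.of_le (by norm_num)) hZ0
    (hZ.of_le (by norm_num)) hA' hC (holderLE_succ.1 hAC).2 t
  have s2 := ((s1.bilin_bdd (ContinuousLinearMap.id ℝ (V3 →L[ℝ] V3)) hζ').const_smul (-1)).congr
    (h' := fun s x => shiftDeriv (fun y => η y • e) A s x - shiftDeriv (fun y => η y • e) A t x)
    (Eventually.of_forall fun s => by
      funext x
      simp only [shiftDeriv, ContinuousLinearMap.id_apply, sub_apply]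
      module)
  have s3 : HolderSmall 1 γ' (𝓝[≠] t) (fun s x => (s - t)⁻¹ •
      (A (shiftMap (fun y => η y • e) s x) - A (shiftMap (fun y => η y • e) t x)) -
        shiftDeriv (fun y => η y • e) A t x) := by
    refine holderSmall_slope_one (fun s => hA1.comp (contDiff_shiftMap hζ1 s))
      (fun s => contDiff_shiftDeriv hζ1 hA s)
      (fun s x => hasDerivAt_comp_shiftMap (hA.differentiable (by simp)) s x)
      (fun s x => hasDerivAt_fderiv_comp_shiftMap hζ1 hA s x) s2
  have s4 := ((s0.mono_filter nhdsWithin_le_nhds).bilin_bdd (innerSmul e) hG').const_smul (-1)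
  have s5 := (s3.bilin_bdd (innerSmul e) hG').const_smul (-t)
  intro ε hε
  filter_upwards [((s3.add s4).add s5) ε hε, self_mem_nhdsWithin] with s hs hst
  have hst' : s - t ≠ 0 := sub_ne_zero.2 hst
  refine hs.2.congr_fun fun x => ?_
  rw [transported_eq, transported_eq, transportedDeriv_eq]
  simp only [map_sub, map_smul, sub_apply, smul_apply]
  have h1 : s = t + (s - t) := by ring
  generalize innerSmul e (A (shiftMap (fun y => η y • e) s x)) (grad η x) = p
  generalize innerSmul e (A (shiftMap (fun y => η y • e) t x)) (grad η x) = q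
  generalize innerSmul e (shiftDeriv (fun y => η y • e) A t x) (grad η x) = w
  generalize A (shiftMap (fun y => η y • e) s x) = a
  generalize A (shiftMap (fun y => η y • e) t x) = b
  -- product rule for difference quotients: `s p - t q = t (p - q) + (s - t) p`
  have h2 : (s - t)⁻¹ • (a - s • p - (b - t • q)) =
      (s - t)⁻¹ • (a - b) - t • ((s - t)⁻¹ • (p - q)) - p := by
    have : p = (s - t)⁻¹ • (s - t) • p := by rw [smul_smul, inv_mul_cancel₀ hst', one_smul]
    nth_rw 3 [this]
    module
  rw [h2]
  module

end regularity
end potential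

/-! ### Periodic functions on space -/

section periodic
variable {E : Type} [NormedAddCommGroup E] (T : V3 ≃L[ℝ] (Fin 3 → ℝ))

/-- A continuous function that is periodic with respect to a lattice of full rank is bounded. -/
lemma exists_bound_of_periodic {f : V3 → E} (hf : Continuous f)
    (hp : ∀ i x, f (x + T.symm (Pi.single i 1)) = f x) : ∃ C, 0 ≤ C ∧ ∀ x, ‖f x‖ ≤ C := by
  have hz : ∀ i (n : ℤ) x, f (x + n • T.symm (Pi.single i 1)) = f x := fun i n x =>
    (Function.Periodic.zsmul (f := f) (c := T.symm (Pi.single i 1)) (hp i) n) x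
  have hK : IsCompact (T.symm '' Icc 0 1) := isCompact_Icc.image T.symm.continuous
  obtain ⟨C, hC⟩ := hK.exists_bound_of_continuousOn hf.continuousOn
  refine ⟨max C 0, le_max_right _ _, fun x => le_trans ?_ (le_max_left _ _)⟩
  have e : x = T.symm (fun i => Int.fract (T x i)) + ⌊T x 0⌋ • T.symm (Pi.single 0 1) +
      ⌊T x 1⌋ • T.symm (Pi.single 1 1) + ⌊T x 2⌋ • T.symm (Pi.single 2 1) := by
    apply T.injective
    simp only [map_add, map_zsmul, ContinuousLinearEquiv.apply_symm_apply]
    funext i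
    fin_cases i <;> simp [Int.fract_add_floor]
  rw [e, hz, hz, hz]
  refine hC _ (mem_image_of_mem _ ⟨fun i => Int.fract_nonneg _, fun i => (Int.fract_lt_one _).le⟩)

/-- Smooth functions that are periodic with respect to a lattice of full rank lie in all Hölder
classes. -/
lemma holderLE_of_periodic [NormedSpace ℝ E] {γ : ℝ} (hγ : 0 < γ) (hγ1 : γ ≤ 1) (k : ℕ) {f : V3 → E}
    (hf : ContDiff ℝ (k + 1) f) (hp : ∀ i x, f (x + T.symm (Pi.single i 1)) = f x) :
    ∃ C, 0 ≤ C ∧ HolderLE k γ univ f C := by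
  have hb : ∀ j : Fin (k + 2), ∃ C, 0 ≤ C ∧ ∀ x, ‖iteratedFDeriv ℝ j f x‖ ≤ C := by
    intro j
    refine exists_bound_of_periodic T (hf.continuous_iteratedFDeriv ?_) fun i x => ?_
    · exact_mod_cast Nat.lt_succ_iff.1 j.2
    · rw [← iteratedFDeriv_comp_add_right]
      congr 1
      funext y
      exact hp i y
  choose C hC0 hC using hb
  have hsum : ∀ j, C j ≤ ∑ j, C j := fun j =>
    Finset.single_le_sum (fun i _ => hC0 i) (Finset.mem_univ j)
  have h0 : 0 ≤ ∑ j, C j := Finset.sum_nonneg fun i _ => hC0 i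
  have hle : ∀ j ≤ k + 1, ∀ x, ‖iteratedFDeriv ℝ j f x‖ ≤ ∑ j, C j := fun j hj x =>
    (hC ⟨j, by omega⟩ x).trans (hsum _)
  refine ⟨2 * ∑ j, C j, by positivity, fun j hj => ⟨fun x _ => ?_, fun x _ y _ => ?_⟩⟩
  · linarith [hle j (by omega) x]
  · refine le_rpow_of_le_of_le dist_nonneg h0 hγ hγ1 ?_ ?_
    · refine (norm_sub_le _ _).trans ?_
      linarith [hle j (by omega) x, hle j (by omega) y]
    · rw [Real.rpow_one, dist_eq_norm]
      have hd : Differentiable ℝ (iteratedFDeriv ℝ j f) :=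
        hf.differentiable_iteratedFDeriv (by exact_mod_cast Nat.lt_succ_iff.2 hj)
      refine Convex.norm_image_sub_le_of_norm_fderiv_le (s := univ) (fun z _ => hd z)
        (fun z _ => ?_) convex_univ (mem_univ _) (mem_univ _)
      rw [norm_fderiv_iteratedFDeriv]
      exact hle _ (by omega) z

end periodic

/-! ### Periodic bump functions -/

/-- A smooth `1`-periodic function with values in `[0, 1]`, equal to `1` at distance at most `h / 2`
from the integers and to `0` at distance at least `h`. -/
noncomputable def profile (h a : ℝ) : ℝ :=
  Real.smoothTransition ((Real.cos (2 * Real.pi * a) - Real.cos (2 * Real.pi * h)) /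
    (Real.cos (Real.pi * h) - Real.cos (2 * Real.pi * h)))

section profile
variable {h a : ℝ}

lemma contDiff_profile {n : ℕ} (h : ℝ) : ContDiff ℝ n (profile h) := by
  refine Real.smoothTransition.contDiff.comp ?_
  exact ((Real.contDiff_cos.comp (contDiff_const.mul contDiff_id)).sub contDiff_const).div_const _

lemma cos_two_pi_sub_int (a : ℝ) (n : ℤ) :
    Real.cos (2 * Real.pi * a) = Real.cos (2 * Real.pi * |a - n|) := by
  have e : 2 * Real.pi * |a - n| = |2 * Real.pi * a - n * (2 * Real.pi)| := by
    rw [show 2 * Real.pi * a - n * (2 * Real.pi) = 2 * Real.pi * (a - n) by ring, abs_mul,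
      abs_of_pos Real.two_pi_pos]
  rw [e, Real.cos_abs, Real.cos_sub_int_mul_two_pi]

lemma profile_add_int (h a : ℝ) (n : ℤ) : profile h (a + n) = profile h a := by
  rw [profile, profile, show 2 * Real.pi * (a + n) = 2 * Real.pi * a + n * (2 * Real.pi) by ring,
    Real.cos_add_int_mul_two_pi]

lemma cos_gap (h0 : 0 < h) (h1 : h < 1 / 2) :
    0 < Real.cos (Real.pi * h) - Real.cos (2 * Real.pi * h) := by
  have hπ := Real.pi_pos
  have := Real.cos_lt_cos_of_nonneg_of_le_pi (x := Real.pi * h) (y := 2 * Real.pi * h)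
    (by positivity) (by nlinarith) (by nlinarith)
  linarith

lemma profile_eq_one (h0 : 0 < h) (h1 : h < 1 / 2) {n : ℤ} (ha : |a - n| ≤ h / 2) :
    profile h a = 1 := by
  have hπ := Real.pi_pos
  refine Real.smoothTransition.one_of_one_le ?_
  rw [one_le_div (cos_gap h0 h1), cos_two_pi_sub_int a n]
  have := Real.cos_le_cos_of_nonneg_of_le_pi (x := 2 * Real.pi * |a - n|) (y := Real.pi * h)
    (by positivity) (by nlinarith) (by nlinarith)
  linarith

lemma exists_int_of_profile_ne_zero (h0 : 0 < h) (h1 : h < 1 / 2) (ha : profile h a ≠ 0) :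
    ∃ n : ℤ, |a - n| < h := by
  refine ⟨round a, ?_⟩
  have hπ := Real.pi_pos
  by_contra hlt
  push Not at hlt
  refine ha (Real.smoothTransition.zero_of_nonpos ?_)
  refine div_nonpos_of_nonpos_of_nonneg ?_ (cos_gap h0 h1).le
  rw [cos_two_pi_sub_int a (round a)]
  have hr := abs_sub_round a
  have := Real.cos_le_cos_of_nonneg_of_le_pi (x := 2 * Real.pi * h)
    (y := 2 * Real.pi * |a - round a|) (by positivity) (by nlinarith) (by nlinarith)
  linarith

end profile

section coordinates
variable {lam : Fin 2 → V2}

lemma hor_add (x y : V3) : hor (x + y) = hor x + hor y := by apply V2.ext' <;> simp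
lemma hor_smul (a : ℝ) (x : V3) : hor (a • x) = a • hor x := by apply V2.ext' <;> simp

/-- Coordinates with respect to the basis `λ₁, λ₂, L e₃` of space. -/
noncomputable def latCoord (lam : Fin 2 → V2) (hlam : LinearIndependent ℝ lam) {L : ℝ}
    (hL : L ≠ 0) : V3 ≃L[ℝ] (Fin 3 → ℝ) :=
  LinearEquiv.toContinuousLinearEquiv
  { toFun := fun x => ![((latL lam hlam).symm (hor x)).1, ((latL lam hlam).symm (hor x)).2, x 2 / L]
    invFun := fun c => lift (latL lam hlam (c 0, c 1)) (c 2 * L)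
    map_add' := fun a b => by
      funext i; fin_cases i <;> simp [hor_add, add_div]
    map_smul' := fun a b => by
      funext i; fin_cases i <;> simp [hor_smul, mul_div_assoc]
    left_inv := fun x => by
      have : lift (hor x) (x 2) = x := lift_hor x
      simpa [div_mul_cancel₀ _ hL] using this
    right_inv := fun c => by
      funext i; fin_cases i <;> simp [hor_lift, hL] }

variable (hlam : LinearIndependent ℝ lam) {L : ℝ} (hL : L ≠ 0)

lemma latCoord_two (x : V3) : latCoord lam hlam hL x 2 = x 2 / L := rfl

lemma latCoord_symm (c : Fin 3 → ℝ) :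
    (latCoord lam hlam hL).symm c = lift (c 0 • lam 0 + c 1 • lam 1) (c 2 * L) := by
  have : (latCoord lam hlam hL).symm c = lift (latL lam hlam (c 0, c 1)) (c 2 * L) := rfl
  rw [this, latL_apply]

lemma latCoord_lift_lattice (n m : ℤ) :
    latCoord lam hlam hL (lift (n • lam 0 + m • lam 1) 0) = ![(n : ℝ), m, 0] := by
  have : lift (n • lam 0 + m • lam 1) 0 = (latCoord lam hlam hL).symm ![(n : ℝ), m, 0] := by
    rw [latCoord_symm]
    simp [Int.cast_smul_eq_zsmul]
  rw [this, ContinuousLinearEquiv.apply_symm_apply]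

end coordinates

/-- A smooth function `η` with values in `[0, 1]`, periodic in the horizontal variables and with
respect to a lattice of full rank, with `η x₀ = 1`, whose support within `{|z| ≤ Zm}` lies in the
translates of `U`. -/
structure IsBump (lam : Fin 2 → V2) (Zm : ℝ) (x₀ : V3) (U : Set V3) (η : V3 → ℝ) : Prop where
  contDiff : ∀ n : ℕ, ContDiff ℝ n η
  nonneg : ∀ x, 0 ≤ η x
  le_one : ∀ x, η x ≤ 1
  self : η x₀ = 1
  periodic : ∀ v ∈ lattice lam, ∀ x, η (x + lift v 0) = η x
  periodic' : ∃ T : V3 ≃L[ℝ] (Fin 3 → ℝ), ∀ i x, η (x + T.symm (Pi.single i 1)) = η x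
  support : ∀ x, |x 2| ≤ Zm → η x ≠ 0 → ∃ v ∈ lattice lam, x + lift v 0 ∈ U

/-- If `ℓ` is small on `x - x₀`, one of the coordinates of `x - x₀` is controlled by the others. -/
lemma exists_coord_le_of_small (T : V3 ≃L[ℝ] (Fin 3 → ℝ)) {ℓ : V3 →L[ℝ] ℝ} (hℓ : ℓ ≠ 0) (x₀ : V3) :
    ∃ (j : Fin 3) (K ε : ℝ), ℓ (T.symm (Pi.single j 1)) ≠ 0 ∧ 1 ≤ K ∧ 0 < ε ∧
      ∀ x, ‖ℓ (x - x₀)‖ ≤ ε * ‖x - x₀‖ → ∀ m, 0 ≤ m →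
        (∀ i ≠ j, |T x i - T x₀ i| ≤ m) → |T x j - T x₀ j| ≤ K * m := by
  set b : Fin 3 → V3 := fun i => T.symm (Pi.single i 1) with hb
  have hexp : ∀ y, ℓ y = ∑ i, T y i * ℓ (b i) := by
    intro y
    have : y = ∑ i, T y i • b i := by
      apply T.injective
      rw [map_sum]
      simp only [map_smul, hb, ContinuousLinearEquiv.apply_symm_apply]
      exact pi_eq_sum_univ' (T y)
    conv_lhs => rw [this]
    simp [map_sum]
  obtain ⟨j, hj⟩ : ∃ j, ℓ (b j) ≠ 0 := by
    by_contra hall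
    push Not at hall
    exact hℓ (ContinuousLinearMap.ext fun y => by rw [hexp]; simp [hall])
  set p := |ℓ (b j)| with hp
  have hp0 : 0 < p := abs_pos.2 hj
  set Q := ∑ i, |ℓ (b i)| with hQ
  have hQ0 : 0 ≤ Q := Finset.sum_nonneg fun i _ => abs_nonneg _
  set M := ‖(T.symm : (Fin 3 → ℝ) →L[ℝ] V3)‖ + 1 with hM
  have hM0 : 0 < M := by positivity
  have hε : 0 < p / (2 * M) := by positivity
  set K := (2 * Q + p) / p with hK
  have hK1 : 1 ≤ K := by rw [hK, one_le_div hp0]; linarith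
  refine ⟨j, K, p / (2 * M), hj, hK1, hε, ?_⟩
  intro x hx m hm hi
  have hn : ‖x - x₀‖ ≤ M * (|T x j - T x₀ j| + m) := by
    have h1 : ‖x - x₀‖ ≤ ‖(T.symm : (Fin 3 → ℝ) →L[ℝ] V3)‖ * ‖T (x - x₀)‖ := by
      have := (T.symm : (Fin 3 → ℝ) →L[ℝ] V3).le_opNorm (T (x - x₀))
      simpa using this
    have h2 : ‖T (x - x₀)‖ ≤ |T x j - T x₀ j| + m := by
      rw [pi_norm_le_iff_of_nonneg (by positivity)]
      intro i
      rw [map_sub, Pi.sub_apply, Real.norm_eq_abs]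
      by_cases hij : i = j
      · subst hij; linarith
      · exact (hi i hij).trans (by linarith [abs_nonneg (T x j - T x₀ j)])
    calc ‖x - x₀‖ ≤ _ := h1
      _ ≤ M * (|T x j - T x₀ j| + m) := by
        gcongr
        rw [hM]; linarith
  have hs : |ℓ (x - x₀) - (T x j - T x₀ j) * ℓ (b j)| ≤ Q * m := by
    have h1 : ℓ (x - x₀) - (T x j - T x₀ j) * ℓ (b j) =
        ∑ i ∈ Finset.univ.erase j, (T x i - T x₀ i) * ℓ (b i) := by
      rw [hexp, ← Finset.add_sum_erase _ _ (Finset.mem_univ j)]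
      simp only [map_sub, Pi.sub_apply]; ring
    rw [h1]
    calc _ ≤ ∑ i ∈ Finset.univ.erase j, |(T x i - T x₀ i) * ℓ (b i)| :=
          Finset.abs_sum_le_sum_abs _ _
      _ ≤ ∑ i ∈ Finset.univ.erase j, |ℓ (b i)| * m := by
          refine Finset.sum_le_sum fun i hi' => ?_
          rw [abs_mul, mul_comm]
          exact mul_le_mul_of_nonneg_left (hi i (Finset.ne_of_mem_erase hi')) (abs_nonneg _)
      _ ≤ ∑ i, |ℓ (b i)| * m :=
          Finset.sum_le_sum_of_subset_of_nonneg (Finset.erase_subset _ _)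
            fun i _ _ => by positivity
      _ = Q * m := by rw [hQ, Finset.sum_mul]
  have h3 : |T x j - T x₀ j| * p ≤ Q * m + p / 2 * (|T x j - T x₀ j| + m) := by
    have h4 : |T x j - T x₀ j| * p = |(T x j - T x₀ j) * ℓ (b j)| := by rw [abs_mul]
    have h5 : |(T x j - T x₀ j) * ℓ (b j)| ≤ |ℓ (x - x₀)| + Q * m := by
      have := abs_sub_abs_le_abs_sub ((T x j - T x₀ j) * ℓ (b j)) (ℓ (x - x₀))
      rw [abs_sub_comm] at this
      linarith
    have h6 : |ℓ (x - x₀)| ≤ p / (2 * M) * (M * (|T x j - T x₀ j| + m)) :=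
      hx.trans (by gcongr)
    have h7 : p / (2 * M) * (M * (|T x j - T x₀ j| + m)) =
        p / 2 * (|T x j - T x₀ j| + m) := by field_simp
    linarith
  have h8 : K * p = 2 * Q + p := by rw [hK]; field_simp
  have h9 : |T x j - T x₀ j| * p ≤ K * m * p := by
    calc _ ≤ (2 * Q + p) * m := by linarith
      _ = _ := by rw [← h8]; ring
  exact le_of_mul_le_mul_right h9 hp0

/-- Used with the vertical period `8 Zm`: a point of the slab `|z| ≤ Zm` in a translate of a small
box lies in a horizontal translate of that box. -/
lemma exists_lattice_translate {lam : Fin 2 → V2} (hlam : LinearIndependent ℝ lam) {Zm : ℝ}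
    (hZ : 0 < Zm) (hL : 8 * Zm ≠ 0) {x₀ : V3} (hx₀ : |x₀ 2| ≤ Zm) {h : ℝ} (hh1 : h ≤ 1 / 8) (x : V3)
    (n : Fin 3 → ℤ) (hx : |x 2| ≤ Zm)
    (hn : ∀ i, |latCoord lam hlam hL x i - latCoord lam hlam hL x₀ i - n i| < 2 * h) :
    ∃ v ∈ lattice lam, ∀ i, latCoord lam hlam hL (x + lift v 0) i - latCoord lam hlam hL x₀ i =
      latCoord lam hlam hL x i - latCoord lam hlam hL x₀ i - n i := by
  have hn2 : n 2 = 0 := by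
    have h1 := hn 2
    rw [latCoord_two, latCoord_two] at h1
    have h2 : |x 2 / (8 * Zm) - x₀ 2 / (8 * Zm)| ≤ 1 / 4 := by
      rw [← sub_div, abs_div, abs_of_pos (show 0 < 8 * Zm by positivity),
        div_le_iff₀ (by positivity)]
      have := abs_sub (x 2) (x₀ 2)
      linarith
    have h3 : |(n 2 : ℝ)| < 1 := by
      have := abs_sub_abs_le_abs_sub (n 2 : ℝ) (x 2 / (8 * Zm) - x₀ 2 / (8 * Zm))
      rw [abs_sub_comm (n 2 : ℝ)] at this
      linarith
    rw [← Int.abs_lt_one_iff]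
    exact_mod_cast h3
  refine ⟨(-n 0) • lam 0 + (-n 1) • lam 1, ⟨-n 0, -n 1, rfl⟩, fun i => ?_⟩
  rw [map_add, latCoord_lift_lattice]
  fin_cases i
  · simp; ring
  · simp; ring
  · simp [hn2]

/-- Around every point there is a periodic bump function, together with a direction `e` transversal
to `ker ℓ` such that `η` is locally constant in direction `e` at the points of a given periodic set
`Γ` that is tangent to `ker ℓ` at `x₀`. The bump function is a product of profiles in lattice
coordinates. It is wider in direction `e`, which is one of the coordinate directions, than in the
other two: where the narrow profiles do not vanish, the tangency forces points of `Γ` into the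
plateau of the wide one. -/
lemma exists_bump {lam : Fin 2 → V2} (hlam : LinearIndependent ℝ lam) {Zm : ℝ} (hZ : 0 < Zm)
    {x₀ : V3} (hx₀ : |x₀ 2| ≤ Zm) {Γ : Set V3}
    (hΓ : ∀ x ∈ Γ, |x 2| ≤ Zm) (hΓp : ∀ v ∈ lattice lam, ∀ x ∈ Γ, x + lift v 0 ∈ Γ)
    {ℓ : V3 →L[ℝ] ℝ} (hℓ : ℓ ≠ 0)
    (hΓℓ : (fun x => ℓ (x - x₀)) =o[𝓝[Γ] x₀] fun x => x - x₀) :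
    ∃ e : V3, ℓ e ≠ 0 ∧ ∀ U ∈ 𝓝 x₀, ∃ η : V3 → ℝ, IsBump lam Zm x₀ U η ∧
      ∃ τ : ℝ, 0 < τ ∧ ∀ x ∈ Γ, ∀ s : ℝ, |s| ≤ τ → η (x + s • e) = η x := by
  have hL : 8 * Zm ≠ 0 := by positivity
  obtain ⟨T, hTlat, near⟩ : ∃ T : V3 ≃L[ℝ] (Fin 3 → ℝ),
      (∀ v ∈ lattice lam, ∀ i, ∃ n : ℤ, T (lift v 0) i = n) ∧
      ∀ (h : ℝ), h ≤ 1 / 8 → ∀ (x : V3) (n : Fin 3 → ℤ), |x 2| ≤ Zm →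
        (∀ i, |T x i - T x₀ i - n i| < 2 * h) →
        ∃ v ∈ lattice lam, ∀ i, T (x + lift v 0) i - T x₀ i = T x i - T x₀ i - n i := by
    refine ⟨latCoord lam hlam hL, ?_, fun h hh1 x n hx hn =>
      exists_lattice_translate hlam hZ hL hx₀ hh1 x n hx hn⟩
    rintro v ⟨n, m, rfl⟩ i
    rw [latCoord_lift_lattice]
    fin_cases i
    exacts [⟨n, rfl⟩, ⟨m, rfl⟩, ⟨0, by simp⟩]
  -- the tangency of `Γ` bounds the coordinate `j` by the other two
  obtain ⟨j, K, ε, hj, hK1, hε, key⟩ := exists_coord_le_of_small T hℓ x₀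
  have htan := hΓℓ.def hε
  rw [eventually_nhdsWithin_iff] at htan
  refine ⟨T.symm (Pi.single j 1), hj, fun U hU => ?_⟩
  -- a box inside the neighbourhoods at hand
  obtain ⟨h, hh0, hh1, hbox⟩ : ∃ h : ℝ, 0 < h ∧ h ≤ 1 / 8 ∧ ∀ y, (∀ i, |T y i - T x₀ i| < 2 * h) →
      y ∈ U ∧ (y ∈ Γ → ‖ℓ (y - x₀)‖ ≤ ε * ‖y - x₀‖) := by
    have h1 : ∀ᶠ c in 𝓝 (T x₀), T.symm c ∈ U ∧ (T.symm c ∈ Γ →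
        ‖ℓ (T.symm c - x₀)‖ ≤ ε * ‖T.symm c - x₀‖) := by
      have h2 : Tendsto T.symm (𝓝 (T x₀)) (𝓝 x₀) := by
        have := T.symm.continuous.tendsto (T x₀)
        rwa [T.symm_apply_apply] at this
      exact h2.eventually ((eventually_mem_set.2 hU).and htan)
    obtain ⟨r, hr, hr'⟩ := Metric.eventually_nhds_iff.1 h1
    refine ⟨min (r / 4) (1 / 8), by positivity, min_le_right _ _, fun y hy => ?_⟩
    have := @hr' (T y) (by
      refine (dist_pi_lt_iff hr).2 fun i => ?_
      rw [Real.dist_eq]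
      refine (hy i).trans_le ?_
      have := min_le_left (r / 4) (1 / 8 : ℝ)
      linarith)
    rwa [T.symm_apply_apply] at this
  -- the widths are `h` in direction `j` and `κ h` in the others; by the choice of `κ` the
  -- coordinate `j` of points of `Γ` in the support is at most `h / 8`, while the plateau has
  -- half-width `h / 2`
  set κ := 1 / (8 * K) with hκ
  have hκ0 : 0 < κ := by positivity
  have hκK : K * κ = 1 / 8 := by rw [hκ]; field_simp
  have hκ1 : κ ≤ 1 / 8 := by nlinarith
  set w : Fin 3 → ℝ := fun i => if i = j then h else κ * h with hw
  have hw0 : ∀ i, 0 < w i := fun i => by simp only [hw]; split_ifs <;> positivity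
  have hwh : ∀ i, w i ≤ h := fun i => by
    simp only [hw]; split_ifs
    · exact le_rfl
    · nlinarith
  have hw1 : ∀ i, w i < 1 / 2 := fun i => (hwh i).trans_lt (by linarith)
  refine ⟨fun x => ∏ i, profile (w i) (T x i - T x₀ i), ?_, h / 4, by positivity, ?_⟩
  · have hper : ∀ x y : V3, (∀ i, ∃ n : ℤ, T y i = n) →
        (∏ i, profile (w i) (T (x + y) i - T x₀ i)) = ∏ i, profile (w i) (T x i - T x₀ i) := by
      intro x y hy
      refine Finset.prod_congr rfl fun i _ => ?_
      obtain ⟨n, hn⟩ := hy i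
      rw [map_add, Pi.add_apply, hn, add_sub_right_comm, profile_add_int]
    refine ⟨fun n => ?_, fun x => ?_, fun x => ?_, ?_, fun v hv x => ?_, ⟨T, fun i x => ?_⟩,
      fun x hx hne => ?_⟩
    · refine contDiff_prod fun i _ => (contDiff_profile (w i)).comp ?_
      exact ((contDiff_apply ℝ ℝ i).comp T.contDiff).sub contDiff_const
    · exact Finset.prod_nonneg fun i _ => Real.smoothTransition.nonneg _
    · exact Finset.prod_le_one (fun i _ => Real.smoothTransition.nonneg _)
        fun i _ => Real.smoothTransition.le_one _
    · refine Finset.prod_eq_one fun i _ => ?_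
      refine profile_eq_one (n := 0) (hw0 i) (hw1 i) ?_
      have := hw0 i
      simp; positivity
    · exact hper x _ (hTlat v hv)
    · refine hper x _ fun k => ?_
      rw [ContinuousLinearEquiv.apply_symm_apply]
      by_cases hki : k = i
      · subst hki; exact ⟨1, by simp⟩
      · exact ⟨0, by simp [hki]⟩
    · have h1 : ∀ i, ∃ n : ℤ, |T x i - T x₀ i - n| < w i := fun i =>
        exists_int_of_profile_ne_zero (hw0 i) (hw1 i)
          (Finset.prod_ne_zero_iff.1 hne i (Finset.mem_univ i))
      choose n hn using h1
      obtain ⟨v, hv, hv'⟩ := near h hh1 x n hx fun i => (hn i).trans_le (by linarith [hwh i])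
      refine ⟨v, hv, (hbox _ fun i => ?_).1⟩
      rw [hv']
      exact (hn i).trans_le (by linarith [hwh i])
  · intro x hx s hs
    have hTs : ∀ i, T (x + s • T.symm (Pi.single j 1)) i = if i = j then T x j + s else T x i := by
      intro i
      rw [map_add, map_smul]
      simp only [ContinuousLinearEquiv.apply_symm_apply, Pi.add_apply, Pi.smul_apply]
      by_cases hij : i = j
      · subst hij; simp
      · simp [hij]
    have hother : ∀ i ≠ j, profile (w i) (T (x + s • T.symm (Pi.single j 1)) i - T x₀ i) =
        profile (w i) (T x i - T x₀ i) := fun i hij => by rw [hTs, if_neg hij]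
    -- if a narrow profile vanishes at `x`, both values of `η` are zero
    by_cases hA : ∃ i, i ≠ j ∧ profile (w i) (T x i - T x₀ i) = 0
    · obtain ⟨i, hij, hi⟩ := hA
      beta_reduce
      rw [Finset.prod_eq_zero (Finset.mem_univ i) ((hother i hij).trans hi),
        Finset.prod_eq_zero (Finset.mem_univ i) hi]
    push Not at hA
    suffices hjj : profile (w j) (T (x + s • T.symm (Pi.single j 1)) j - T x₀ j) =
        profile (w j) (T x j - T x₀ j) by
      refine Finset.prod_congr rfl fun i _ => ?_
      by_cases hij : i = j
      · subst hij; exact hjj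
      · exact hother i hij
    have hwj : w j = h := by simp [hw]
    rw [hTs, if_pos rfl, hwj]
    by_contra hne
    -- the values of the wide profile at `x` and `x + s e` differ, so one of them is not zero
    have hn : ∃ n : ℤ, |T x j - T x₀ j - n| < 2 * h := by
      by_cases h0 : profile h (T x j - T x₀ j) = 0
      · have h1 : profile h (T x j + s - T x₀ j) ≠ 0 := by rwa [h0] at hne
        obtain ⟨n, hn⟩ := exists_int_of_profile_ne_zero hh0 (by linarith) h1
        refine ⟨n, ?_⟩
        have h2 : T x j - T x₀ j - n = (T x j + s - T x₀ j - n) - s := by ring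
        rw [h2]
        have := abs_sub (T x j + s - T x₀ j - n) s
        linarith
      · obtain ⟨n, hn⟩ := exists_int_of_profile_ne_zero hh0 (by linarith) h0
        exact ⟨n, by linarith⟩
    have hn' : ∀ i, ∃ n : ℤ, |T x i - T x₀ i - n| < 2 * h ∧
        (i ≠ j → |T x i - T x₀ i - n| ≤ κ * h) := by
      intro i
      by_cases hij : i = j
      · subst hij
        obtain ⟨n, hn⟩ := hn
        exact ⟨n, hn, fun h => absurd rfl h⟩
      · obtain ⟨n, hn⟩ := exists_int_of_profile_ne_zero (hw0 i) (hw1 i) (hA i hij)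
        have hwi : w i = κ * h := by simp [hw, hij]
        exact ⟨n, by linarith [hwh i], fun _ => by rw [← hwi]; exact hn.le⟩
    choose n hn1 hn2 using hn'
    obtain ⟨v, hv, hv'⟩ := near h hh1 x n (hΓ x hx) hn1
    have h3 := (hbox (x + lift v 0) fun i => by rw [hv']; exact hn1 i).2 (hΓp v hv x hx)
    have h4 := key _ h3 (κ * h) (by positivity) fun i hij => by rw [hv']; exact hn2 i hij
    rw [hv', ← mul_assoc, hκK] at h4
    have h5 : |T x j + s - T x₀ j - n j| ≤ h / 2 := by
      rw [show T x j + s - T x₀ j - n j = (T x j - T x₀ j - n j) + s by ring]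
      linarith [abs_add_le (T x j - T x₀ j - n j) s]
    exact hne ((profile_eq_one hh0 (by linarith) h5).trans
      (profile_eq_one (n := n j) hh0 (by linarith) (by linarith)).symm)

/-! ### Periodicity of the fluid domain -/

section domain
variable {lam : Fin 2 → V2} {d γ γ' m₁ m₂ : ℝ} {A F : V3 → V3}

lemma exists_lattice_add_mem_closedCell (hlam : LinearIndependent ℝ lam) (p : V2) :
    ∃ v ∈ lattice lam, p + v ∈ closedCell lam := by
  obtain ⟨q, rfl⟩ := (latL lam hlam).surjective p
  refine ⟨(-⌊q.1⌋) • lam 0 + (-⌊q.2⌋) • lam 1, ⟨_, _, rfl⟩, (Int.fract q.1, Int.fract q.2),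
    ⟨⟨Int.fract_nonneg _, (Int.fract_lt_one _).le⟩, Int.fract_nonneg _, (Int.fract_lt_one _).le⟩, ?_⟩
  rw [latL_apply]
  simp only [Int.fract, ← Int.cast_smul_eq_zsmul ℝ]
  push_cast
  module

lemma closedCell_subset_closure (hlam : LinearIndependent ℝ lam) :
    closedCell lam ⊆ closure (cell lam) := by
  rw [cell_eq lam hlam]
  have h1 := (latL lam hlam).toHomeomorph.image_closure (Ioo (0 : ℝ) 1 ×ˢ Ioo (0 : ℝ) 1)
  rw [closure_prod_eq, closure_Ioo zero_ne_one] at h1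
  refine subset_trans ?_ h1.subset
  rintro _ ⟨q, hq, rfl⟩
  exact ⟨q, hq, latL_apply lam hlam q⟩

/-- A continuous periodic function is determined by its values on the open cell. -/
lemma eq_zero_of_periodic_of_cell (hlam : LinearIndependent ℝ lam) {E : Type*}
    [NormedAddCommGroup E] {f : V2 → E} (hf : Continuous f)
    (hp : ∀ v ∈ lattice lam, ∀ p, f (p + v) = f p) (h0 : ∀ p ∈ cell lam, f p = 0) (p : V2) :
    f p = 0 := by
  obtain ⟨v, hv, hpv⟩ := exists_lattice_add_mem_closedCell hlam p
  rw [← hp v hv]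
  have hc : IsClosed {p | f p = 0} := isClosed_singleton.preimage hf
  exact closure_minimal (t := {p | f p = 0}) h0 hc (closedCell_subset_closure hlam hpv)

lemma lift_add_lattice (p v : V2) (z : ℝ) : lift p z + lift v 0 = lift (p + v) z :=
  (lift_add_zero p v z).symm

/-- The closed fluid domain is vertically bounded. -/
lemma MemMper.exists_height_bound (hF : MemMper lam d γ F) (hlam : LinearIndependent ℝ lam) :
    ∃ Zm, 0 < Zm ∧ ∀ p : V2, ∀ z ∈ Icc (-d) 0, |F (lift p z) 2| ≤ Zm := by
  have hc : Continuous fun x => F x 2 :=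
    (contDiff_coord hF.contDiff 2).continuous
  obtain ⟨C, hC⟩ := (isCompact_closedSlabCell (lam := lam) (d := d)).exists_bound_of_continuousOn
    hc.continuousOn
  refine ⟨max C 1, by positivity, fun p z hz => le_trans ?_ (le_max_left _ _)⟩
  obtain ⟨v, hv, hpv⟩ := exists_lattice_add_mem_closedCell hlam p
  have h1 := hC (lift (p + v) z) ⟨(p + v, z), ⟨hpv, hz⟩, rfl⟩
  rw [← lift_add_lattice, hF.periodic v hv] at h1
  simpa using h1

end domain

/-! ### Fields built from bump functions -/

section bumpfields
variable {lam : Fin 2 → V2} {Zm : ℝ} {x₀ : V3} {U : Set V3} {η : V3 → ℝ}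

lemma IsBump.differentiable (hη : IsBump lam Zm x₀ U η) : Differentiable ℝ η :=
  (hη.contDiff 1).differentiable (by simp)

/-- The gradient vanishes where `η` attains its minimum `0`. -/
lemma IsBump.fderiv_eq_zero (hη : IsBump lam Zm x₀ U η) {x : V3} (hx : η x = 0) :
    fderiv ℝ η x = 0 := by
  have : IsLocalMin η x := Eventually.of_forall fun y => by rw [hx]; exact hη.nonneg y
  exact this.fderiv_eq_zero

lemma IsBump.grad_eq_zero (hη : IsBump lam Zm x₀ U η) {x : V3} (hx : η x = 0) :
    grad η x = 0 := by
  apply V3.ext' <;> simp [pdr, hη.fderiv_eq_zero hx]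

lemma grad_periodic {f : V3 → ℝ} {v : V3} (h : ∀ x, f (x + v) = f x) (x : V3) :
    grad f (x + v) = grad f x := by
  have := fderiv_periodic (f := f) (v := v) (c := 0) (by simpa using h) x
  apply V3.ext' <;> simp [pdr, this]

lemma IsBump.contDiff_smul (hη : IsBump lam Zm x₀ U η) (n : ℕ) (e : V3) :
    ContDiff ℝ n (fun y => η y • e) := (hη.contDiff n).smul contDiff_const

lemma IsBump.exists_holderLE (hη : IsBump lam Zm x₀ U η) {γ : ℝ} (hγ : 0 < γ) (hγ1 : γ ≤ 1)
    (e : V3) : ∃ Z, 0 ≤ Z ∧ HolderLE 3 γ univ (fun y => η y • e) Z ∧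
      HolderLE 2 γ univ (grad η) Z := by
  obtain ⟨T, hT⟩ := hη.periodic'
  obtain ⟨C, hC, h1⟩ := holderLE_of_periodic T hγ hγ1 3 (f := fun y => η y • e)
    (by exact_mod_cast hη.contDiff_smul 4 e) fun i x => by rw [hT]
  obtain ⟨D, hD, h2⟩ := holderLE_of_periodic T hγ hγ1 2 (f := grad η)
    (contDiff_grad (hη.contDiff 4) (by norm_num)) fun i x => grad_periodic (hT i) x
  exact ⟨C + D, by positivity, h1.mono (by linarith), h2.mono (by linarith)⟩

end bumpfields

/-! ### Variations of the potential in the interior -/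

section interior
variable {lam : Fin 2 → V2} {d γ γ' m₁ m₂ : ℝ} {A F : V3 → V3}

/-- Affine curves are differentiable in every Hölder norm: their difference quotients are
constant. -/
lemma holderHasDerivAt_of_affine {k : ℕ} {γ : ℝ} {K : Set V3} {f f' : V3 → V3} (t : ℝ) :
    HolderHasDerivAt k γ K (fun s x => f x + s • f' x) f' t := by
  intro ε hε
  filter_upwards [self_mem_nhdsWithin] with s hs
  have hst : s - t ≠ 0 := sub_ne_zero.2 hs
  refine (holderLE_zero_fun (E := V3) hε.le).congr_fun fun x => ?_
  rw [add_sub_add_left_eq_sub, ← sub_smul, smul_smul, inv_mul_cancel₀ hst, one_smul, sub_self]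

lemma holderHasDerivAt_const {k : ℕ} {γ : ℝ} {K : Set V3} {f : V3 → V3} (t : ℝ) :
    HolderHasDerivAt k γ K (fun _ => f) (fun _ => 0) t := by
  have := holderHasDerivAt_of_affine (k := k) (γ := γ) (K := K) (f := f) (f' := fun _ => 0) t
  simpa using this

lemma holderContinuousAt_const {k : ℕ} {γ : ℝ} {K : Set V3} {f : V3 → V3} (t : ℝ) :
    HolderContinuousAt k γ K (fun _ => f) t := by
  intro ε hε
  refine Eventually.of_forall fun s => (holderLE_zero_fun (E := V3) hε.le).congr_fun fun x => ?_
  simp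

/-- Adding to the potential multiples of a field that vanishes on the boundary, on a fixed
domain. -/
lemma AdmissiblePair.admissibleCurve_add (h : AdmissiblePair lam d γ m₁ m₂ A F) (hγ' : 0 < γ')
    (hγ'γ : γ' < γ) {B : V3 → V3} (hB : ContDiff ℝ 2 B) {C : ℝ} (hC : 0 ≤ C)
    (hBC : HolderLE 2 γ univ B C) (hper : IsPer lam B) (htop : ∀ p, B (surf F p) = 0)
    (hbot : ∀ p, B (lift p (-d)) = 0) :
    AdmissibleCurve lam d γ γ' m₁ m₂ 1 (fun s x => A x + s • B x) (fun _ => F) := by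
  obtain ⟨hA, D, hD⟩ := h.mem_holder
  have hB1 : HolderLE 2 γ' univ B (2 * C) := hBC.exponent hγ' hγ'γ.le hC
  refine ⟨fun t _ => ⟨h.mem_Mper, ⟨hA.add (hB.const_smul t), _, holderLE_add hA (hB.const_smul t)
    (holderLE_iff.2 hD) (holderLE_const_smul t hB hBC)⟩, fun v hv x => ?_, fun p => ?_, fun p => ?_⟩,
    ⟨fun _ _ => 0, fun t _ => ⟨⟨contDiff_const, fun R => ⟨0, holderLE_zero_fun le_rfl⟩⟩,
      fun R => ⟨holderHasDerivAt_const t, holderContinuousAt_const t⟩⟩⟩, fun t _ => ?_, fun t _ =>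
      ⟨B, ⟨hB.of_le (by norm_num), _, hB1.of_le (by norm_num)⟩, holderHasDerivAt_of_affine t⟩⟩
  · rw [h.periodic v hv, hper v hv]
  · beta_reduce
    rw [htop, smul_zero, add_zero]; exact h.bc.1 p
  · beta_reduce
    rw [hbot, smul_zero, add_zero]; exact h.bc.2 p
  · have hr : Tendsto (fun s : ℝ => s - t) (𝓝 t) (𝓝 0) := by
      have : Tendsto (fun s : ℝ => s - t) (𝓝 t) (𝓝 (t - t)) :=
        (continuous_id.sub continuous_const).tendsto t
      simpa using this
    have := (holderBdd_const (l := 𝓝 t) hB (by positivity) hB1).smul_tendsto_zero hr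
    intro ε hε
    filter_upwards [this ε hε] with s hs
    refine hs.2.congr_fun fun x => ?_
    module

end interior

/-! ### Variations of the free surface -/

section surface
variable {lam : Fin 2 → V2} {d γ γ' m₁ m₂ Zm Z : ℝ} {A F : V3 → V3} {η : V3 → ℝ} {e x₀ : V3}
  {U : Set V3}

lemma norm_sub_le_of_holderLE {ζ : V3 → V3} (hζ : Differentiable ℝ ζ)
    (hZ : HolderLE 1 γ univ ζ Z) (x y : V3) : ‖ζ x - ζ y‖ ≤ Z * ‖x - y‖ :=
  Convex.norm_image_sub_le_of_norm_fderiv_le (s := univ) (fun z _ => hζ z)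
    (fun z _ => (holderLE_zero.1 (holderLE_succ.1 hZ).2).1 z (mem_univ _)) convex_univ
    (mem_univ _) (mem_univ _)

lemma hasFDerivAt_smul_const (hη : Differentiable ℝ η) (e x : V3) :
    HasFDerivAt (fun y => η y • e) ((fderiv ℝ η x).smulRight e) x :=
  (hη x).hasFDerivAt.smul_const e

/-- The derivative of `x - s η(x) e` is a rank-one perturbation of the identity. -/
lemma det_fderiv_shiftMap (hη : Differentiable ℝ η) (s : ℝ) (x : V3) :
    (fderiv ℝ (shiftMap (fun y => η y • e) s) x).det = 1 - s * fderiv ℝ η x e := by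
  have hd : Differentiable ℝ (fun y => η y • e) := fun x =>
    (hasFDerivAt_smul_const hη e x).differentiableAt
  rw [(hasFDerivAt_shiftMap hd s x).fderiv, (hasFDerivAt_smul_const hη e x).fderiv]
  have : ((ContinuousLinearMap.id ℝ V3 - s • (fderiv ℝ η x).smulRight e : V3 →L[ℝ] V3) :
      V3 →ₗ[ℝ] V3) = LinearMap.transvection ((-s) • (fderiv ℝ η x : V3 →ₗ[ℝ] ℝ)) e := by
    refine LinearMap.ext fun v => ?_
    simp [LinearMap.transvection.apply, smul_smul, sub_eq_add_neg]
  rw [ContinuousLinearMap.det, this, LinearMap.transvection.det]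
  simp [sub_eq_add_neg]

lemma abs_fderiv_le_of_holderLE (hη : Differentiable ℝ η)
    (hZ : HolderLE 1 γ univ (fun y => η y • e) Z) (x : V3) : |fderiv ℝ η x e| ≤ Z := by
  have h1 := (holderLE_zero.1 (holderLE_succ.1 hZ).2).1 x (mem_univ _)
  rw [(hasFDerivAt_smul_const hη e x).fderiv, ContinuousLinearMap.norm_smulRight_apply] at h1
  exact ((fderiv ℝ η x).le_opNorm e).trans h1

/-- For small `s` the map `x - s η(x) e` is a diffeomorphism of space: it is a Lipschitz
perturbation of the identity with constant less than `1`. -/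
lemma exists_inverse_shiftMap {n : ℕ} (hn : n ≠ 0) (hη : ContDiff ℝ n η)
    (hZ : HolderLE 1 γ univ (fun y => η y • e) Z) {s : ℝ} (hs : |s| * Z < 1) :
    (∀ x, 0 < (fderiv ℝ (shiftMap (fun y => η y • e) s) x).det) ∧
    ∃ G : V3 → V3, Function.LeftInverse G (shiftMap (fun y => η y • e) s) ∧
      Function.RightInverse G (shiftMap (fun y => η y • e) s) ∧ ContDiff ℝ n G := by
  have hd : Differentiable ℝ η := hη.differentiable (by exact_mod_cast hn)
  have hZ0 : 0 ≤ Z := (norm_nonneg _).trans ((holderLE_zero.1 (hZ.of_le zero_le_one)).1 0 (mem_univ _))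
  have hdet : ∀ x, 0 < (fderiv ℝ (shiftMap (fun y => η y • e) s) x).det := by
    intro x
    rw [det_fderiv_shiftMap hd]
    have h1 : |s * fderiv ℝ η x e| ≤ |s| * Z := by
      rw [abs_mul]
      exact mul_le_mul_of_nonneg_left (abs_fderiv_le_of_holderLE hd hZ x) (abs_nonneg s)
    linarith [le_abs_self (s * fderiv ℝ η x e)]
  refine ⟨hdet, ?_⟩
  have hζ : ContDiff ℝ n (fun y => η y • e) := hη.smul contDiff_const
  have hζd : Differentiable ℝ (fun y => η y • e) := hζ.differentiable (by exact_mod_cast hn)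
  have hs0 : 0 ≤ |s| * Z := by positivity
  have happ : ApproximatesLinearOn (shiftMap (fun y => η y • e) s)
      ((ContinuousLinearEquiv.refl ℝ V3 : V3 ≃L[ℝ] V3) : V3 →L[ℝ] V3) univ ⟨|s| * Z, hs0⟩ := by
    intro x _ y _
    have h1 : shiftMap (fun y => η y • e) s x - shiftMap (fun y => η y • e) s y - (x - y) =
        -(s • (η x • e - η y • e)) := by
      simp only [shiftMap]; module
    change ‖shiftMap (fun y => η y • e) s x - shiftMap (fun y => η y • e) s y - (x - y)‖ ≤
      |s| * Z * ‖x - y‖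
    rw [h1, norm_neg, norm_smul, Real.norm_eq_abs, mul_assoc]
    exact mul_le_mul_of_nonneg_left (norm_sub_le_of_holderLE hζd hZ x y) (abs_nonneg s)
  let H := happ.toHomeomorph (shiftMap (fun y => η y • e) s) (Or.inr (by
    have h1 : ‖((ContinuousLinearEquiv.refl ℝ V3).symm : V3 →L[ℝ] V3)‖₊ = 1 := by
      apply NNReal.eq
      exact ContinuousLinearMap.norm_id
    rw [h1, inv_one]
    exact hs))
  have hH : ∀ x, H x = shiftMap (fun y => η y • e) s x := fun x => rfl
  refine ⟨H.symm, fun x => H.symm_apply_apply x, fun x => H.apply_symm_apply x, ?_⟩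
  refine Homeomorph.contDiff_symm H (f₀' := fun x =>
    ContinuousLinearMap.toContinuousLinearEquivOfDetNeZero _ (hdet x).ne') (fun x => ?_)
    (contDiff_shiftMap hζ s)
  rw [ContinuousLinearMap.coe_toContinuousLinearEquivOfDetNeZero]
  exact ((contDiff_shiftMap hζ s).differentiable (by exact_mod_cast hn) x).hasFDerivAt

lemma shiftMap_periodic {ζ : V3 → V3} {v : V3} (h : ∀ x, ζ (x + v) = ζ x) (s : ℝ) (x : V3) :
    shiftMap ζ s (x + v) = shiftMap ζ s x + v := by
  rw [shiftMap, h, shiftMap]; abel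

/-- Compositions of Hölder fields with the parametrizations of the fluid domain. -/
lemma MemMper.memHolderLoc_comp (hF : MemMper lam d γ F) (hγ : 0 < γ) {ζ : V3 → V3}
    (hζ : ContDiff ℝ 3 ζ) (hZ0 : 0 ≤ Z) (hZ : HolderLE 3 γ univ ζ Z) :
    MemHolderLoc 3 γ (fun x => ζ (F x)) := by
  refine ⟨hζ.comp hF.contDiff, fun R => ?_⟩
  obtain ⟨C, hC⟩ := hF.mem_holder.2 R
  obtain ⟨M, hM⟩ := hF.bounded_deriv
  have hM0 : 0 ≤ M := (norm_nonneg _).trans (hM 0)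
  obtain ⟨C', -, h⟩ := holderLE_comp (K := Metric.closedBall 0 R) (γ := γ) (C := Z)
    (D := max M C) 3 hγ hZ0 (le_max_of_le_left hM0)
  refine ⟨C', h ζ F hζ hF.contDiff hZ (fun x _ y _ => ?_) fun j hj => ?_⟩
  · refine (Convex.norm_image_sub_le_of_norm_fderiv_le (s := univ)
      (fun z _ => hF.differentiable z) (fun z _ => hM z) convex_univ (mem_univ _)
      (mem_univ _)).trans ?_
    gcongr
    exact le_max_left _ _
  · exact ((holderLE_succ.1 (holderLE_iff.2 hC)).2.of_le (by omega)).mono (le_max_right _ _)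

/-- Composition with a small shift that leaves the bottom fixed preserves `M_per`. -/
lemma MemMper.shift (hF : MemMper lam d γ F) (hγ : 0 < γ) (hη : IsBump lam Zm x₀ U η)
    (hZ : HolderLE 3 γ univ (fun y => η y • e) Z) (hbot : ∀ p : V2, η (lift p (-d)) = 0) {s : ℝ}
    (hs : |s| * Z < 1) : MemMper lam d γ (fun x => shiftMap (fun y => η y • e) s (F x)) := by
  have hZ0 : 0 ≤ Z := (norm_nonneg _).trans ((holderLE_zero.1 (hZ.of_le (by omega))).1 0 (mem_univ _))
  have hζ : ContDiff ℝ 3 (fun y => η y • e) := hη.contDiff_smul 3 e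
  have hζd : Differentiable ℝ (fun y => η y • e) := hζ.differentiable (by simp)
  obtain ⟨hdet, H, hH1, hH2, hH3⟩ := exists_inverse_shiftMap (n := 3) (by norm_num) (hη.contDiff 3)
    (hZ.of_le (by norm_num)) hs
  have hcd : ContDiff ℝ 3 (shiftMap (fun y => η y • e) s) := contDiff_shiftMap hζ s
  have hfd : ∀ x, fderiv ℝ (fun x => shiftMap (fun y => η y • e) s (F x)) x =
      (fderiv ℝ (shiftMap (fun y => η y • e) s) (F x)).comp (fderiv ℝ F x) := fun x =>
    fderiv_comp x (hcd.differentiable (by norm_num) _) (hF.differentiable x)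
  constructor
  · obtain ⟨hc, hb⟩ := hF.memHolderLoc_comp hγ hζ hZ0 hZ
    refine ⟨hcd.comp hF.contDiff, fun R => ?_⟩
    obtain ⟨C1, h1⟩ := hF.mem_holder.2 R
    obtain ⟨C2, h2⟩ := hb R
    refine ⟨C1 + |-s| * C2, (holderLE_add hF.contDiff (hc.const_smul (-s)) (holderLE_iff.2 h1)
      (holderLE_const_smul (-s) hc (holderLE_iff.2 h2))).congr_fun fun x => ?_⟩
    rw [shiftMap, neg_smul, sub_eq_add_neg]
  · obtain ⟨G, hG1, hG2, hG3⟩ := hF.diffeo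
    refine ⟨fun x => G (H x), fun x => ?_, fun x => ?_, hG3.comp hH3⟩
    · beta_reduce
      rw [hH1, hG1]
    · beta_reduce
      rw [hG2, hH2]
  · obtain ⟨C, hC⟩ := hF.bounded_deriv
    refine ⟨(1 + |s| * Z) * C, fun x => ?_⟩
    rw [hfd]
    refine (ContinuousLinearMap.opNorm_comp_le _ _).trans ?_
    have h1 := (holderLE_zero.1 (holderLE_fderiv_shiftMap (k := 0) (by simpa using hζ.of_le (by norm_num))
      (hZ.of_le (by norm_num)) s)).1 (F x) (mem_univ _)
    exact mul_le_mul h1 (hC x) (norm_nonneg _) (by positivity)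
  · intro x
    rw [hfd]
    change 0 < LinearMap.det ((fderiv ℝ (shiftMap (fun y => η y • e) s) (F x) : V3 →ₗ[ℝ] V3) ∘ₗ
      (fderiv ℝ F x : V3 →ₗ[ℝ] V3))
    rw [LinearMap.det_comp]
    exact mul_pos (hdet (F x)) (hF.det_pos x)
  · intro p
    rw [hF.bottom, shiftMap, hbot]; simp
  · intro v hv x
    rw [hF.periodic v hv, shiftMap_periodic fun y => by rw [hη.periodic v hv]]

/-- The transported potential is the pull-back of the one-form `A`. -/
lemma inner_transported (hη : Differentiable ℝ η) (s : ℝ) (x v : V3) :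
    inner ℝ (transported e η A s x) v = inner ℝ (A (shiftMap (fun y => η y • e) s x))
      (fderiv ℝ (shiftMap (fun y => η y • e) s) x v) := by
  have hd : Differentiable ℝ (fun y => η y • e) := fun x =>
    (hasFDerivAt_smul_const hη e x).differentiableAt
  rw [(hasFDerivAt_shiftMap hd s x).fderiv, (hasFDerivAt_smul_const hη e x).fderiv, transported,
    inner_sub_left, real_inner_smul_left, real_inner_smul_left, grad_inner]
  simp only [sub_apply, smul_apply, ContinuousLinearMap.id_apply,
    ContinuousLinearMap.smulRight_apply, inner_sub_right, real_inner_smul_right]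
  ring

lemma cross_surfCross_eq_zero {a : V3} {p : V2} (h0 : inner ℝ a (pdS 0 (surf F) p) = 0)
    (h1 : inner ℝ a (pdS 1 (surf F) p) = 0) : cross a (surfCross F p) = 0 := by
  rw [surfCross]
  rw [inner_eq] at h0 h1
  apply V3.ext' <;> simp
  · linear_combination pdS 0 (surf F) p 0 * h1 - pdS 1 (surf F) p 0 * h0
  · linear_combination pdS 0 (surf F) p 1 * h1 - pdS 1 (surf F) p 1 * h0
  · linear_combination pdS 0 (surf F) p 2 * h1 - pdS 1 (surf F) p 2 * h0

lemma cross_normal_eq_zero {a : V3} {p : V2} (h0 : inner ℝ a (pdS 0 (surf F) p) = 0)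
    (h1 : inner ℝ a (pdS 1 (surf F) p) = 0) : cross a (normal F p) = 0 := by
  have h3 := (crossL a).map_smul (‖surfCross F p‖⁻¹) (surfCross F p)
  simp only [crossL_apply] at h3
  rw [normal, h3, cross_surfCross_eq_zero h0 h1, smul_zero]

/-- Moving the free surface by `x + s η(x) e` and transporting the potential by pull-back under
`Ψ_s(x) = x - s η(x) e`. If `η` is locally constant in direction `e` along the surface, then `Ψ_s`
maps the new surface exactly onto the old one, so that the pull-back of `A` is normal to the new
surface. Other inverses of the flow, such as the inverse of `x + s η(x) e`, would not be explicit
in `s`. -/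
lemma AdmissiblePair.exists_admissibleCurve (h : AdmissiblePair lam d γ m₁ m₂ A F) (hγ' : 0 < γ')
    (hγ'γ : γ' < γ) (hγ : γ < 1) (hη : IsBump lam Zm x₀ U η)
    (hbot : ∀ p : V2, η (lift p (-d)) = 0) {τ : ℝ} (hτ : 0 < τ)
    (hplat : ∀ p, ∀ s : ℝ, |s| ≤ τ → η (surf F p + s • e) = η (surf F p)) :
    ∃ δ > 0, AdmissibleCurve lam d γ γ' m₁ m₂ δ (transported e η A)
      (fun s x => F x + s • (η (F x) • e)) := by
  have hγ0 : 0 < γ := hγ'.trans hγ'γ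
  obtain ⟨Z, hZ0, hZ, hG⟩ := hη.exists_holderLE hγ0 hγ.le e
  obtain ⟨hA, C0, hC0⟩ := h.mem_holder
  have hC : 0 ≤ max C0 0 := le_max_right _ _
  have hAC : HolderLE 2 γ univ A (max C0 0) := (holderLE_iff.2 hC0).mono (le_max_left _ _)
  have hζ : ContDiff ℝ 3 (fun y => η y • e) := hη.contDiff_smul 3 e
  have hη4 : ContDiff ℝ 4 η := hη.contDiff 4
  have hFs : ∀ s : ℝ, (fun x => F x + s • (η (F x) • e)) =
      fun x => shiftMap (fun y => η y • e) (-s) (F x) := fun s => by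
    funext x; rw [shiftMap, neg_smul, sub_neg_eq_add]
  refine ⟨min τ (1 / (Z + 1)), by positivity, fun s hs => ?_, ⟨fun _ x => η (F x) • e, fun t _ =>
    ⟨h.mem_Mper.memHolderLoc_comp hγ0 hζ hZ0 hZ, fun R => ⟨holderHasDerivAt_of_affine t,
      holderContinuousAt_const t⟩⟩⟩,
    fun t _ => holderContinuousAt_transported hγ' hγ'γ hη4 hZ0 hZ hG hA hC hAC t,
    fun t _ => ⟨_, memHolder_transportedDeriv hγ' hγ'γ hη4 hZ0 hZ hG hA hC hAC t,
      holderHasDerivAt_transported hγ' hγ'γ hη4 hZ0 hZ hG hA hC hAC t⟩⟩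
  have hs' : |s| < min τ (1 / (Z + 1)) := abs_lt.2 hs
  have hsτ : |s| < τ := hs'.trans_le (min_le_left _ _)
  have hsZ : |-s| * Z < 1 := by
    rw [abs_neg]
    have h1 : |s| < 1 / (Z + 1) := hs'.trans_le (min_le_right _ _)
    rw [lt_div_iff₀ (by positivity)] at h1
    nlinarith [abs_nonneg s]
  rw [hFs]
  have hM := h.mem_Mper.shift hγ0 hη hZ hbot hsZ
  refine ⟨hM, memHolder_transported hγ' hγ'γ hη4 hZ0 hZ hG hA hC hAC s, fun v hv x => ?_,
    fun p => ?_, fun p => ?_⟩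
  · have h1 := shiftMap_periodic (ζ := fun y => η y • e) (v := lift v 0)
      (fun x => by rw [hη.periodic v hv]) s x
    rw [transported, transported, h1, h.periodic v hv, grad_periodic (hη.periodic v hv)]
  · -- on the surface the shift by `-s` is inverted by the shift by `s`
    have hinv : ∀ q, shiftMap (fun y => η y • e) s
        (surf (fun x => shiftMap (fun y => η y • e) (-s) (F x)) q) = surf F q := by
      intro q
      have h1 : surf (fun x => shiftMap (fun y => η y • e) (-s) (F x)) q =
          surf F q + (s * η (surf F q)) • e := by
        simp only [surf, shiftMap]; module
      have h2 : η (surf F q + (s * η (surf F q)) • e) = η (surf F q) := by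
        refine hplat q _ ?_
        rw [abs_mul, abs_of_nonneg (hη.nonneg _)]
        have := hη.le_one (surf F q)
        nlinarith [abs_nonneg s, hη.nonneg (surf F q)]
      rw [h1, shiftMap, h2]
      module
    have dS : DifferentiableAt ℝ (surf (fun x => shiftMap (fun y => η y • e) (-s) (F x))) p :=
      hM.contDiff_surf.differentiable (by norm_num) p
    have dΨ : Differentiable ℝ (shiftMap (fun y => η y • e) s) :=
      (contDiff_shiftMap hζ s).differentiable (by norm_num)
    have hpd : ∀ i, fderiv ℝ (shiftMap (fun y => η y • e) s)
        (surf (fun x => shiftMap (fun y => η y • e) (-s) (F x)) p)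
        (pdS i (surf (fun x => shiftMap (fun y => η y • e) (-s) (F x))) p) = pdS i (surf F) p := by
      intro i
      have h1 := (dΨ _).hasFDerivAt.comp p dS.hasFDerivAt
      have h2 : (shiftMap (fun y => η y • e) s ∘
          surf (fun x => shiftMap (fun y => η y • e) (-s) (F x))) = surf F := funext hinv
      rw [h2] at h1
      rw [pdS, pdS, h1.fderiv]
      rfl
    have hd := h.mem_Mper.differentiable (lift p 0)
    have ht := h.top_tangential p
    rw [← pdS_surf_zero hd, ← pdS_surf_one hd] at ht
    refine cross_normal_eq_zero ?_ ?_
    · rw [inner_transported hη.differentiable, hpd, hinv]; exact ht.1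
    · rw [inner_transported hη.differentiable, hpd, hinv]; exact ht.2
  · have h1 : transported e η A s (lift p (-d)) = A (lift p (-d)) := by
      rw [transported, hη.grad_eq_zero (hbot p), shiftMap, hbot]; simp
    rw [h1]; exact h.bc.2 p

end surface

/-! ### Critical points -/

section critical
variable {lam : Fin 2 → V2} {d γ γ' g σ α μ m₁ m₂ δ : ℝ} {A F : V3 → V3} {Ac Fc : ℝ → V3 → V3}

/-- The quantity that the dynamic boundary condition with `c = -μ / 2` sets to zero. -/
noncomputable def bernoulliDefect (g σ μ : ℝ) (A F : V3 → V3) (p : V2) : ℝ :=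
  ‖curl A (surf F p)‖ ^ 2 / 2 + g * surf F p 2 - 2 * σ * meanCurv F p + μ / 2

lemma bernoulli_iff : Bernoulli g σ (-μ / 2) (curl A) F ↔ ∀ p, bernoulliDefect g σ μ A F p = 0 := by
  refine forall_congr' fun p => ?_
  rw [bernoulliDefect]
  constructor <;> intro h <;> linarith

lemma pdS_periodic {f : V2 → V3} {v : V2} (h : ∀ p, f (p + v) = f p) (i : Fin 2) (p : V2) :
    pdS i f (p + v) = pdS i f p := by
  rw [pdS, pdS, ← fderiv_comp_add_right]
  simp only [h]

lemma MemMper.meanCurv_periodic (hF : MemMper lam d γ F) {v : V2} (hv : v ∈ lattice lam) (p : V2) :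
    meanCurv F (p + v) = meanCurv F p := by
  simp only [meanCurv, surfDiv, pdS_periodic (hF.normal_periodic hv), hF.pdS_surf_periodic hv,
    hF.surfCross_periodic hv, hF.normal_periodic hv]

lemma AdmissiblePair.bernoulliDefect_periodic (h : AdmissiblePair lam d γ m₁ m₂ A F) {v : V2}
    (hv : v ∈ lattice lam) (p : V2) :
    bernoulliDefect g σ μ A F (p + v) = bernoulliDefect g σ μ A F p := by
  have h1 := h.mem_Mper.surf_periodic hv p
  simp only [bernoulliDefect, h.mem_Mper.meanCurv_periodic hv, h1, h.periodic.curl v hv]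
  simp

lemma AdmissiblePair.continuous_bernoulliDefect (h : AdmissiblePair lam d γ m₁ m₂ A F) :
    Continuous (bernoulliDefect g σ μ A F) := by
  have hS := h.mem_Mper.contDiff_surf.continuous
  have hu : Continuous (curl A) := (contDiff_curl h.mem_holder.1 (m := 1) (by norm_num)).continuous
  have h2 : Continuous fun p => surf F p 2 := (contDiff_coord h.mem_Mper.contDiff_surf 2).continuous
  exact (((((hu.comp hS).norm.pow 2).div_const 2).add (h2.const_mul g)).sub
    (h.mem_Mper.continuous_meanCurv.const_mul (2 * σ))).add continuous_const

/-- At a critical point the first variation of `J` vanishes along every admissible curve. -/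
lemma IsCritical.first_variation (hc : IsCritical lam d γ γ' g σ α μ m₁ m₂ A F)
    (hlam : LinearIndependent ℝ lam) (hd : 0 < d) (hδ : 0 < δ)
    (h : AdmissibleCurve lam d γ γ' m₁ m₂ δ Ac Fc) (hA : Ac 0 = A) (hF : Fc 0 = F) {W : V3 → V3}
    (hW : ContDiff ℝ 3 W) (hw : ∀ x, HasDerivAt (fun s => Fc s x) (W (F x)) 0) :
    ∃ A' : V3 → V3, (∀ x, HasDerivAt (fun s => Ac s x) (A' x) 0) ∧
      (∫ x in slabCell lam d, (fderiv ℝ F x).det *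
        (2 * inner ℝ (A' (F x) + grad (fun z => inner ℝ (A z) (W z)) (F x))
          (curl (curl A) (F x) - α • curl A (F x)))) -
      2 * ∫ p in cell lam, bernoulliDefect g σ μ A F p *
        inner ℝ (W (surf F p)) (surfCross F p) = 0 := by
  obtain ⟨A', w, hv⟩ := h.exists_isVariation hδ
  refine ⟨A', fun x => hv.hasDerivAt_A x, ?_⟩
  have h0 := hc δ hδ Ac Fc h hA hF
  subst hA hF
  have hw' : ∀ x, W (Fc 0 x) = w x := fun x => (hw x).unique (hv.hasDerivAt_F x)
  have h1 := (hv.hasDerivAt_functionalJ (g := g) (σ := σ) (α := α) (μ := μ) hlam hd hW hw').unique h0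
  simp only [← hw'] at h1
  exact h1

/-- A continuous nonnegative function with vanishing integral over an open set vanishes there. -/
lemma eqOn_zero_of_setIntegral_eq_zero {X : Type*} [MeasurableSpace X] [TopologicalSpace X]
    [OpensMeasurableSpace X] {ν : Measure X} [ν.IsOpenPosMeasure] {S : Set X} (hS : IsOpen S)
    {f : X → ℝ} (hf : Continuous f) (hi : IntegrableOn f S ν) (h0 : ∀ x ∈ S, 0 ≤ f x)
    (h : ∫ x in S, f x ∂ν = 0) : ∀ x ∈ S, f x = 0 := by
  have h1 : 0 ≤ᵐ[ν.restrict S] f :=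
    (ae_restrict_mem hS.measurableSet).mono fun x hx => h0 x hx
  have h2 := (setIntegral_eq_zero_iff_of_nonneg_ae h1 hi).1 h
  exact Measure.eqOn_open_of_ae_eq h2 hS hf.continuousOn continuousOn_const

/-- Variations of the potential that are localized in the interior give `curl u = α u`. -/
lemma IsCritical.curl_curl_eq (hc : IsCritical lam d γ γ' g σ α μ m₁ m₂ A F)
    (h : AdmissiblePair lam d γ m₁ m₂ A F) (hlam : LinearIndependent ℝ lam) (hd : 0 < d)
    (hγ' : 0 < γ') (hγ'γ : γ' < γ) (hγ : γ < 1) :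
    ∀ x ∈ F '' slab d, curl (curl A) x = α • curl A x := by
  have hM := h.mem_Mper
  have hγ0 : 0 < γ := hγ'.trans hγ'γ
  set V : V3 → V3 := fun x => curl (curl A) x - α • curl A x with hV
  have cu : ContDiff ℝ 1 (curl A) := contDiff_curl h.mem_holder.1 (by norm_num)
  have cV : Continuous V :=
    (contDiff_curl (m := 0) cu (by norm_num)).continuous.sub (cu.continuous.const_smul α)
  have hVper : IsPer lam V := fun v hv x => by
    simp only [hV, h.periodic.curl.curl v hv, h.periodic.curl v hv]
  suffices hcell : ∀ z ∈ Ioo (-d) 0, ∀ p ∈ cell lam, V (F (lift p z)) = 0 by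
    rintro _ ⟨_, ⟨p, z, hz, rfl⟩, rfl⟩
    refine sub_eq_zero.1 (eq_zero_of_periodic_of_cell hlam (f := fun p => V (F (lift p z)))
      (cV.comp (hM.contDiff.continuous.comp (contDiff_lift (n := 0) z).continuous))
      (fun v hv q => ?_) (hcell z hz) p)
    beta_reduce
    rw [← lift_add_lattice, hM.periodic v hv, hVper v hv]
  intro z hz p hp
  by_contra hne
  obtain ⟨G, hG1, hG2, hG3⟩ := hM.diffeo
  obtain ⟨Zm, hZm, hZ⟩ := hM.exists_height_bound hlam
  set v₀ := V (F (lift p z)) with hv₀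
  -- `U` lies inside the fluid, where `V = curl u - α u` makes an acute angle with its value at the
  -- centre
  set U : Set V3 := {x | G x 2 ∈ Ioo (-d) 0 ∧ 0 < inner ℝ v₀ (V x)} with hU
  have hUo : IsOpen U := by
    have h1 : IsOpen {x | 0 < inner ℝ v₀ (V x)} := isOpen_lt continuous_const (by fun_prop)
    exact (isOpen_Ioo.preimage (contDiff_coord hG3 2).continuous).inter h1
  have hx₀ : F (lift p z) ∈ U := by
    refine ⟨by rw [hG1]; exact hz, ?_⟩
    rw [← hv₀, real_inner_self_eq_norm_sq]
    positivity
  have hℓ : innerSL ℝ (e3 0) ≠ 0 := by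
    intro h0
    have := congr_arg (fun L : V3 →L[ℝ] ℝ => L (e3 0)) h0
    simp at this
  obtain ⟨_, -, hbump⟩ := exists_bump hlam hZm (x₀ := F (lift p z))
    -- no constraint along a surface is needed here, hence `Γ = ∅`
    (hZ p z (Ioo_subset_Icc_self hz)) (Γ := ∅) (by simp) (by simp) hℓ (by simp)
  obtain ⟨η, hη, -⟩ := hbump U (hUo.mem_nhds hx₀)
  have hzero : ∀ q : V2, ∀ y ∈ Icc (-d) 0, y ∉ Ioo (-d) 0 → η (F (lift q y)) = 0 := by
    intro q y hy hy'
    by_contra h0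
    obtain ⟨v, hv, hvU⟩ := hη.support _ (hZ q y hy) h0
    have := hvU.1
    rw [← hM.periodic v hv, lift_add_lattice, hG1] at this
    exact hy' this
  obtain ⟨Z, hZ0, hZH, -⟩ := hη.exists_holderLE hγ0 hγ.le v₀
  have hcurve := h.admissibleCurve_add hγ' hγ'γ (B := fun x => η x • v₀)
    (hη.contDiff_smul 2 v₀) hZ0 (hZH.of_le (by norm_num))
    (fun v hv x => by beta_reduce; rw [hη.periodic v hv])
    (fun q => by
      beta_reduce
      rw [surf, hzero q 0 ⟨by linarith, le_rfl⟩ (by simp), zero_smul])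
    (fun q => by
      have := hzero q (-d) ⟨le_rfl, by linarith⟩ (by simp)
      rw [hM.bottom] at this
      beta_reduce
      rw [this, zero_smul])
  obtain ⟨A', hA', hfv⟩ := hc.first_variation hlam hd one_pos hcurve (by simp) rfl
    (W := fun _ => 0) contDiff_const (fun x => hasDerivAt_const _ _)
  have hA'eq : ∀ x, A' x = η x • v₀ := by
    intro x
    have h1 : HasDerivAt (fun s : ℝ => A x + s • (η x • v₀)) (η x • v₀) 0 := by
      simpa using ((hasDerivAt_id (0 : ℝ)).smul_const (η x • v₀)).const_add (A x)
    exact (hA' x).unique h1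
  have hgr : ∀ x, grad (fun z => inner ℝ (A z) (0 : V3)) x = 0 := by
    intro x
    apply V3.ext' <;> simp [pdr]
  simp only [hgr, hA'eq, add_zero, inner_zero_left, mul_zero, integral_zero, sub_zero,
    real_inner_smul_left] at hfv
  have hcont : Continuous fun x => (fderiv ℝ F x).det * (2 * (η (F x) * inner ℝ v₀ (V (F x)))) := by
    have c1 : Continuous fun x => (fderiv ℝ F x).det :=
      ContinuousLinearMap.continuous_det.comp (hM.contDiff.continuous_fderiv (by norm_num))
    have c2 := hM.contDiff.continuous
    exact c1.mul (continuous_const.mul (((hη.contDiff 0).continuous.comp c2).mul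
      (continuous_const.inner (cV.comp c2))))
  have hpos : ∀ x ∈ slabCell lam d,
      0 ≤ (fderiv ℝ F x).det * (2 * (η (F x) * inner ℝ v₀ (V (F x)))) := by
    rintro _ ⟨q, -, y, hy, rfl⟩
    refine mul_nonneg (hM.det_pos _).le (mul_nonneg zero_le_two ?_)
    by_cases h0 : η (F (lift q y)) = 0
    · rw [h0, zero_mul]
    · obtain ⟨v, hv, hvU⟩ := hη.support _ (hZ q y (Ioo_subset_Icc_self hy)) h0
      have := hvU.2
      rw [hVper v hv] at this
      exact mul_nonneg (hη.nonneg _) this.le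
  have := eqOn_zero_of_setIntegral_eq_zero (isOpen_slabCell hlam) hcont
    (integrableOn_slabCell hcont) hpos hfv (lift p z) ⟨p, hp, z, hz, rfl⟩
  rw [hη.self, one_mul] at this
  exact (mul_pos (hM.det_pos _) (mul_pos two_pos hx₀.2)).ne' this

/-- Variations of the free surface, with velocity `η e` localized near a point where the defect `k`
of the Bernoulli condition does not vanish, give the dynamic boundary condition. -/
lemma IsCritical.bernoulli (hc : IsCritical lam d γ γ' g σ α μ m₁ m₂ A F)
    (h : AdmissiblePair lam d γ m₁ m₂ A F) (hlam : LinearIndependent ℝ lam) (hd : 0 < d)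
    (hγ' : 0 < γ') (hγ'γ : γ' < γ) (hγ : γ < 1) :
    Bernoulli g σ (-μ / 2) (curl A) F := by
  have hM := h.mem_Mper
  have hcurl := hc.curl_curl_eq h hlam hd hγ' hγ'γ hγ
  rw [bernoulli_iff]
  refine eq_zero_of_periodic_of_cell hlam h.continuous_bernoulliDefect
    (fun v hv p => h.bernoulliDefect_periodic hv p) fun p₀ hp₀ => ?_
  by_contra hne
  obtain ⟨G, hG1, hG2, hG3⟩ := hM.diffeo
  obtain ⟨Zm, hZm, hZ⟩ := hM.exists_height_bound hlam
  have h00 : (0 : ℝ) ∈ Icc (-d) 0 := ⟨by linarith, le_rfl⟩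
  -- the free surface is the zero set of the third component of `F⁻¹`
  have cf : ContDiff ℝ 3 fun x => G x 2 := contDiff_coord hG3 2
  have df : Differentiable ℝ fun x => G x 2 := cf.differentiable (by norm_num)
  have hfF : ∀ x, G (F x) 2 = x 2 := fun x => by rw [hG1]
  set x₀ := surf F p₀ with hx₀
  set ℓ := fderiv ℝ (fun x => G x 2) x₀ with hℓdef
  have hℓF : ∀ v, ℓ (fderiv ℝ F (lift p₀ 0) v) = v 2 := by
    intro v
    have h1 := (df (F (lift p₀ 0))).hasFDerivAt.comp (lift p₀ 0)
      (hM.differentiable (lift p₀ 0)).hasFDerivAt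
    have h2 : ((fun x => G x 2) ∘ F) = fun x => x 2 := funext hfF
    rw [h2] at h1
    have h3 : HasFDerivAt (fun x : V3 => x 2) (EuclideanSpace.proj (𝕜 := ℝ) (2 : Fin 3)) (lift p₀ 0) :=
      (EuclideanSpace.proj (𝕜 := ℝ) (2 : Fin 3)).hasFDerivAt
    have h4 := congr_arg (fun L : V3 →L[ℝ] ℝ => L v) (h1.unique h3)
    exact h4
  have hℓ : ℓ ≠ 0 := by
    intro h0
    have := hℓF (e3 2)
    rw [h0] at this
    simp at this
  have hΓ : ∀ x ∈ range (surf F), |x 2| ≤ Zm := by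
    rintro _ ⟨q, rfl⟩; exact hZ q 0 h00
  have hΓp : ∀ v ∈ lattice lam, ∀ x ∈ range (surf F), x + lift v 0 ∈ range (surf F) := by
    rintro v hv _ ⟨q, rfl⟩; exact ⟨q + v, hM.surf_periodic hv q⟩
  have hΓf : ∀ q, G (surf F q) 2 = 0 := fun q => by rw [surf, hfF]; simp
  have hΓℓ : (fun x => ℓ (x - x₀)) =o[𝓝[range (surf F)] x₀] fun x => x - x₀ := by
    have h1 := ((df x₀).hasFDerivAt.isLittleO.mono
      (nhdsWithin_le_nhds (s := range (surf F)))).neg_left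
    refine h1.congr' ?_ EventuallyEq.rfl
    filter_upwards [self_mem_nhdsWithin] with x hx
    obtain ⟨q, rfl⟩ := hx
    change -(G (surf F q) 2 - G (surf F p₀) 2 - ℓ (surf F q - x₀)) = ℓ (surf F q - x₀)
    rw [hΓf, hΓf]
    ring
  obtain ⟨e, hℓe, hbump⟩ := exists_bump hlam hZm (x₀ := x₀) (hZ p₀ 0 h00) hΓ hΓp hℓ hΓℓ
  -- `e` is transversal to the surface at `x₀`
  have hNe : inner ℝ (surfCross F p₀) e ≠ 0 := by
    intro h0
    have h1 : cross (grad (fun x => G x 2) x₀) (surfCross F p₀) = 0 := by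
      refine cross_surfCross_eq_zero ?_ ?_
      · rw [grad_inner, pdS_surf_zero (hM.differentiable _), pd]
        exact (hℓF _).trans (by simp)
      · rw [grad_inner, pdS_surf_one (hM.differentiable _), pd]
        exact (hℓF _).trans (by simp)
    have h2 := inner_eq_zero_of_cross_eq_zero h1 (hM.surfCross_ne_zero p₀) h0
    rw [grad_inner] at h2
    exact hℓe h2
  set k : V2 → ℝ := fun p => bernoulliDefect g σ μ A F p * inner ℝ e (surfCross F p) with hk
  have ck : Continuous k := h.continuous_bernoulliDefect.mul
    (continuous_const.inner hM.contDiff_surfCross.continuous)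
  have hkper : ∀ v ∈ lattice lam, ∀ p, k (p + v) = k p := fun v hv p => by
    simp only [hk, h.bernoulliDefect_periodic hv, hM.surfCross_periodic hv]
  have hk0 : k p₀ ≠ 0 := mul_ne_zero hne (by rwa [real_inner_comm])
  have chor : Continuous hor := by
    have h1 : hor = fun x => (liftL.symm x).1 := rfl
    rw [h1]
    exact continuous_fst.comp liftL.symm.continuous
  -- `U` avoids the bottom, and on its part of the surface `k` has the sign of `k p₀`
  set U : Set V3 := {x | x 2 ≠ -d ∧ 0 < k (hor (G x)) * k p₀} with hU
  have hUo : IsOpen U := by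
    have c2 : Continuous fun x : V3 => x 2 := (EuclideanSpace.proj (𝕜 := ℝ) (2 : Fin 3)).continuous
    exact (isOpen_ne_fun c2 continuous_const).inter
      (isOpen_lt continuous_const ((ck.comp (chor.comp hG3.continuous)).mul continuous_const))
  have hGS : ∀ q, G (surf F q) = lift q 0 := fun q => hG1 _
  have hx₀U : x₀ ∈ U := by
    refine ⟨fun h0 => ?_, ?_⟩
    · have h1 : F (lift (hor x₀) (-d)) = F (lift p₀ 0) := by
        rw [hM.bottom, ← h0, lift_hor]; rfl
      have h2 := congr_arg (fun y : V3 => y 2) (hM.injective h1)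
      simp at h2
      linarith
    · rw [hx₀, hGS, hor_lift]; exact mul_self_pos.2 hk0
  obtain ⟨η, hη, τ, hτ, hplat⟩ := hbump U (hUo.mem_nhds hx₀U)
  have hbot : ∀ p : V2, η (lift p (-d)) = 0 := by
    intro q
    by_contra h0
    have h1 := hZ q (-d) ⟨le_rfl, by linarith⟩
    rw [hM.bottom] at h1
    obtain ⟨v, -, hvU⟩ := hη.support _ h1 h0
    exact hvU.1 (by simp)
  obtain ⟨δ, hδ, hcurve⟩ := h.exists_admissibleCurve hγ' hγ'γ hγ hη hbot hτ
    fun q s hs => hplat _ ⟨q, rfl⟩ s hs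
  obtain ⟨A', -, hfv⟩ := hc.first_variation hlam hd hδ hcurve (transported_zero A) (by simp)
    (W := fun y => η y • e) (hη.contDiff_smul 3 e) (fun x => by
      simpa using ((hasDerivAt_id (0 : ℝ)).smul_const (η (F x) • e)).const_add (F x))
  have hbulk : (∫ x in slabCell lam d, (fderiv ℝ F x).det *
      (2 * inner ℝ (A' (F x) + grad (fun z => inner ℝ (A z) (η z • e)) (F x))
        (curl (curl A) (F x) - α • curl A (F x)))) = 0 := by
    refine setIntegral_eq_zero_of_forall_eq_zero fun x hx => ?_
    obtain ⟨q, -, y, hy, rfl⟩ := hx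
    rw [hcurl _ ⟨_, ⟨q, y, hy, rfl⟩, rfl⟩, sub_self, inner_zero_right, mul_zero, mul_zero]
  rw [hbulk, zero_sub, neg_eq_zero, mul_eq_zero, or_iff_right two_ne_zero] at hfv
  have hint : ∫ p in cell lam, η (surf F p) * (k p * k p₀) = 0 := by
    have h1 : ∀ p, η (surf F p) * (k p * k p₀) = (bernoulliDefect g σ μ A F p *
        inner ℝ (η (surf F p) • e) (surfCross F p)) * k p₀ := fun p => by
      rw [real_inner_smul_left]; simp only [hk]; ring
    simp only [h1]
    rw [integral_mul_const, hfv, zero_mul]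
  have hcont : Continuous fun p => η (surf F p) * (k p * k p₀) :=
    ((hη.contDiff 0).continuous.comp hM.contDiff_surf.continuous).mul (ck.mul continuous_const)
  have hpos : ∀ p ∈ cell lam, 0 ≤ η (surf F p) * (k p * k p₀) := by
    intro p _
    by_cases h0 : η (surf F p) = 0
    · rw [h0, zero_mul]
    · obtain ⟨v, hv, hvU⟩ := hη.support _ (hΓ _ ⟨p, rfl⟩) h0
      have h1 := hvU.2
      rw [← hM.surf_periodic hv, hGS, hor_lift, hkper v hv] at h1
      exact mul_nonneg (hη.nonneg _) h1.le
  have := eqOn_zero_of_setIntegral_eq_zero (isOpen_cell hlam) hcont (integrableOn_cell hcont) hpos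
    hint p₀ hp₀
  rw [hη.self, one_mul] at this
  exact hk0 (mul_self_eq_zero.1 this)

/-- Beltrami flows with the dynamic boundary condition are critical points: both integrals in the
first variation vanish. -/
lemma AdmissiblePair.isCritical (h : AdmissiblePair lam d γ m₁ m₂ A F)
    (hlam : LinearIndependent ℝ lam) (hd : 0 < d) (hu : IsBeltrami α (curl A) (F '' slab d))
    (hB : Bernoulli g σ (-μ / 2) (curl A) F) :
    IsCritical lam d γ γ' g σ α μ m₁ m₂ A F := by
  intro δ hδ Ac Fc hcurve hA hF
  subst hA hF
  obtain ⟨A', w, hv⟩ := hcurve.exists_isVariation hδ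
  obtain ⟨G, hG1, hG2, hG3⟩ := h.mem_Mper.diffeo
  have h1 := hv.hasDerivAt_functionalJ (g := g) (σ := σ) (α := α) (μ := μ) hlam hd
    (W := fun y => w (G y)) (hv.contDiff_w.comp hG3) fun x => by rw [hG1]
  refine h1.congr_deriv ?_
  rw [setIntegral_eq_zero_of_forall_eq_zero, setIntegral_eq_zero_of_forall_eq_zero]
  · simp
  · intro p _
    have := bernoulli_iff.1 hB p
    rw [bernoulliDefect] at this
    rw [this, zero_mul]
  · rintro _ ⟨q, -, y, hy, rfl⟩
    rw [(hu _ ⟨_, ⟨q, y, hy, rfl⟩, rfl⟩).2, sub_self, inner_zero_right, mul_zero, mul_zero]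

lemma AdmissiblePair.isCritical_iff (h : AdmissiblePair lam d γ m₁ m₂ A F)
    (hlam : LinearIndependent ℝ lam) (hd : 0 < d) (hγ' : 0 < γ') (hγ'γ : γ' < γ) (hγ : γ < 1)
    (μ : ℝ) : IsCritical lam d γ γ' g σ α μ m₁ m₂ A F ↔
      IsBeltrami α (curl A) (F '' slab d) ∧ Kinematic d (curl A) F ∧
        Bernoulli g σ (-μ / 2) (curl A) F :=
  ⟨fun hc => ⟨fun x hx => ⟨div_curl h.mem_holder.1 x,
    hc.curl_curl_eq h hlam hd hγ' hγ'γ hγ x hx⟩, h.kinematic, hc.bernoulli h hlam hd hγ' hγ'γ hγ⟩,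
    fun ⟨hu, _, hB⟩ => h.isCritical hlam hd hu hB⟩

end critical

end BeltramiWaves

theorem mainTheorem1 (lam : Fin 2 → V2) (hlam : LinearIndependent ℝ lam)
    (d : ℝ) (hd : 0 < d) (γ γ' : ℝ) (hγ' : 0 < γ') (hγ'γ : γ' < γ) (hγ : γ < 1)
    (g σ : ℝ) (hσ : 0 < σ) (α m₁ m₂ : ℝ) (A F : V3 → V3)
    (hAF : AdmissiblePair lam d γ m₁ m₂ A F) :
    (∀ μ : ℝ, IsCritical lam d γ γ' g σ α μ m₁ m₂ A F ↔
      IsBeltrami α (curl A) (F '' slab d) ∧ Kinematic d (curl A) F ∧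
        Bernoulli g σ (-μ / 2) (curl A) F) ∧
    ((∃ μ : ℝ, IsCritical lam d γ γ' g σ α μ m₁ m₂ A F) ↔
      IsBeltrami α (curl A) (F '' slab d) ∧ Kinematic d (curl A) F ∧
        ∃ c : ℝ, Bernoulli g σ c (curl A) F) := by
  refine ⟨fun μ => hAF.isCritical_iff hlam hd hγ' hγ'γ hγ μ, ?_⟩
  simp only [hAF.isCritical_iff hlam hd hγ' hγ'γ hγ]
  constructor
  · rintro ⟨μ, hu, hk, hB⟩
    exact ⟨hu, hk, _, hB⟩
  · rintro ⟨hu, hk, c, hB⟩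
    refine ⟨-2 * c, hu, hk, ?_⟩
    rwa [show -(-2 * c) / 2 = c by ring]
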